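/- **Nets.** A *ground-structure* is a finite directed acyclic labelled graph. Its nodes (*links*), with their incoming edges (*premises*) and outgoing edges (*conclusions*), are: $ax$ (no premise, two conclusions), $cut$ (two premises, no conclusion), $\otimes$ and $\parr$ (an ordered pair of premises, one conclusion), $1$ and $\bot$ (no premise, one conclusion), $\flat$ (one premise, one structural conclusion), $?$ ($k\ge 0$ structural premises, one conclusion), and $!$ (no premise, one main conclusion and $k\ge0$ structural *auxiliary* conclusions). All edges not said to be structural are *logical*. Every edge is the conclusion of exactly one link; it is a premise of exactly one link or else one of the conclusions (given in an order) of the ground-structure. A *$\flat$-structure* is a ground-structure together with, for every $!$-link $o$, a $\flat$-structure $\pi^o$ (its *box*) having exactly one logical conclusion and a bijection between the auxiliary conclusions of $o$ and the structural conclusions of $\pi^o$ (the nesting of boxes is finite). A *switching* of a ground-structure is the undirected graph obtained by deleting one of the two premises of each $\parr$-link and all but one of the premises of each $?$-link that has premises. A *net* is a $\flat$-structure without structural conclusions such that all switchings of all its ground-structures (at every depth) are acyclic. If $c$, $c'$ are conclusions of the nets $\pi$, $\pi'$, then $\langle\pi|\pi'\rangle_{c,c'}$ is the net obtained from their disjoint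 union by adding a $cut$-link with premises $c,c'$. **Cut elimination.** A step $\pi\rightsquigarrow\pi_1$ eliminates one cut, at any depth: * a cut between a conclusion $b$ of an axiom with conclusions $a,b$ and an edge $c$ is removed together with the axiom, and $c$ takes the place of $a$; * a cut between the conclusions of a $\otimes$- and a $\parr$-link is replaced, together with these links, by a cut between their left premises and a cut between their right premises; * a cut between the conclusions of a $1$- and a $\bot$-link is erased with these links; * for a cut between the main conclusion of a $!$-link $o$ and the conclusion of a $?$-link with $k\ge0$ premises $s_1,\dots,s_k$, the cut and the two links are removed and, for each $j$, the $\flat$-link in which the structural edge $s_j$ originates (possibly inside boxes) is replaced, where it stands, by a copy of $\pi^o$ together with a cut between the premise of that $\flat$-link and the main conclusion of the copy. The structural conclusions of the copies become auxiliary conclusions of the $!$-links whose boxes contain them, and each auxiliary conclusion of $o$ is replaced by its $k$ copies at the $?$-link below it (and at the borders of the boxes crossed in between). A *clash* is a $cut$-link neither of whose premises is a conclusion of an axiom and whose premises are not the conclusions of, respectively, a $\otimes$- and a $\parr$-link, a $1$- and a $\bot$-link, or a $!$- and a $?$-link. A net $\pi$ is *strongly normalizable* if every sequence of steps from $\pi$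 is finite and no reduct of $\pi$ (including $\pi$ itself) contains a clash, at any depth. **Points.** Let $A$ be a set and let $D$ be the least set such that $D=\{+,-\}\times(A\sqcup\{*\})\ \sqcup\ \{+,-\}\times D\times D\ \sqcup\ \{+,-\}\times\mathcal M_{fin}(D)$, where $\mathcal M_{fin}$ denotes finite multisets. For $x\in D$, $x^\perp$ is obtained by exchanging $+$ and $-$ everywhere in $x$. **Experiments.** By induction on the depth, an *$\mathcal S^{ex}$-experiment* $e$ of a $\flat$-structure $\pi$ assigns an element $e(a)\in D$ to every edge $a$ of depth $0$ and a **non-empty** finite multiset $e(o)$ of $\mathcal S^{ex}$-experiments of $\pi^o$ to every $!$-link $o$ of depth $0$, so that: $e(a)=e(b)^\perp$ if $a,b$ are the two conclusions of an $ax$-link or the two premises of a $cut$-link; $e(c)=(+,*)$, resp. $(-,*)$, for the conclusion $c$ of a $1$-, resp. $\bot$-link; $e(c)=(+,e(a),e(b))$, resp. $(-,e(a),e(b))$, for the conclusion $c$ of a $\otimes$-, resp. $\parr$-link with premises $a,b$; $e(c)=(-,[e(a)])$ for the conclusion $c$ of a $\flat$-link with premise $a$; $e(c)=(-,\sum_i\mu_i)$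 for the conclusion $c$ of a $?$-link with premises $a_1,\dots,a_n$, $n\ge1$, where $e(a_i)=(-,\mu_i)$; $e(c)=(-,\mu)$ for some arbitrary $\mu\in\mathcal M_{fin}(D)$ if $c$ is the conclusion of a $?$-link without premises; and for a $!$-link $o$ with $e(o)=[e_1,\dots,e_n]$, $e(c)=(+,[e_1(c^o),\dots,e_n(c^o)])$ for its main conclusion $c$, where $c^o$ is the logical conclusion of $\pi^o$, and $e(c)=(-,\sum_i\mu_i)$ for an auxiliary conclusion $c$, where $c^o$ is the associated structural conclusion of $\pi^o$ and $e_i(c^o)=(-,\mu_i)$. Let $\mathcal W(e)$ be the sum of the multisets $\mu$ with $e(c)=(-,\mu)$, over the conclusions $c$ of the $?$-links of depth $0$ without premises, plus the sum of $\mathcal W(e')$ over all $!$-links $o$ of depth $0$ and all $e'\in e(o)$, counted with multiplicity. For a net $\pi$ with conclusions $c_1,\dots,c_n$ let $\mathcal S^{ex}(\pi)$ be the set of all pairs $(\mathbf x,\mathcal W(e))$ with $\mathbf x=(e(c_1),\dots,e(c_n))$, where $e$ is an $\mathcal S^{ex}$-experiment of $\pi$, and write $\mathbf x_{c_i}=e(c_i)$.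 **Corollary.** Let $\pi$ and $\pi'$ be nets, $c$ a conclusion of $\pi$ and $c'$ a conclusion of $\pi'$. The net $\langle\pi|\pi'\rangle_{c,c'}$ is strongly normalizable if and only if there are $(\mathbf x,\mathcal W)\in\mathcal S^{ex}(\pi)$ and $(\mathbf x',\mathcal W')\in\mathcal S^{ex}(\pi')$ such that $\mathbf x_c=(\mathbf x'_{c'})^\perp$. -/

import Mathlib

namespace LLNet

universe u

/-! ### The set `D` of points

`D` is the least set with `D = {+,-} × (A ∪ {*}) ∪ {+,-} × D × D ∪ {+,-} × M_fin(D)`. It is built as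
the quotient of finite trees (with lists in the place of multisets) by permutation of these lists at
every level; `D.equivView` below is the displayed fixed-point equation. -/

/-- The polarities `+` and `-`. -/
inductive Sign : Type
  | pos
  | neg

/-- `+^⊥ = -` and `-^⊥ = +`. -/
def Sign.flip : Sign → Sign
  | .pos => .neg
  | .neg => .pos

/-- Trees that represent the points of `D`; in `atom p o` the value `o = none` stands for `*`. -/
inductive PreD (A : Type u) : Type u
  | atom (p : Sign) (o : Option A)
  | pair (p : Sign) (x y : PreD A)
  | bag (p : Sign) (l : List (PreD A))

/-- The congruence generated by permutation of the lists. -/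
inductive PreD.Rel {A : Type u} : PreD A → PreD A → Prop
  | refl (x : PreD A) : Rel x x
  | symm {x y : PreD A} : Rel x y → Rel y x
  | trans {x y z : PreD A} : Rel x y → Rel y z → Rel x z
  | pair (p : Sign) {x x' y y' : PreD A} : Rel x x' → Rel y y' → Rel (.pair p x y) (.pair p x' y')
  | perm (p : Sign) {l l' : List (PreD A)} : l.Perm l' → Rel (.bag p l) (.bag p l')
  | head (p : Sign) {x x' : PreD A} (l : List (PreD A)) :
      Rel x x' → Rel (.bag p (x :: l)) (.bag p (x' :: l))

instance PreD.setoid (A : Type u) : Setoid (PreD A) :=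
  ⟨PreD.Rel, ⟨PreD.Rel.refl, PreD.Rel.symm, PreD.Rel.trans⟩⟩

/-- The set `D` of points over the set `A` of atoms. -/
def D (A : Type u) : Type u := Quotient (PreD.setoid A)

namespace D

variable {A : Type u}

/-- The point of a tree. -/
def mk (x : PreD A) : D A := Quotient.mk (PreD.setoid A) x

/-- A tree of a point. -/
noncomputable def out (x : D A) : PreD A := Quotient.out (s := PreD.setoid A) x

theorem mk_out (x : D A) : mk x.out = x := Quotient.out_eq (s := PreD.setoid A) x

theorem mk_eq {x y : PreD A} (h : PreD.Rel x y) : mk x = mk y :=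
  Quotient.sound (s := PreD.setoid A) h

theorem out_mk (x : PreD A) : PreD.Rel (mk x).out x := Quotient.mk_out (s := PreD.setoid A) x

theorem map_mk_out (l : List (D A)) : (l.map out).map mk = l := by
  rw [List.map_map]
  have : (mk ∘ out : D A → D A) = id := funext mk_out
  rw [this, List.map_id]

/-- The point `(p, a)` for `a ∈ A`. -/
def atom (p : Sign) (a : A) : D A := mk (.atom p (some a))

/-- The point `(p, *)`. -/
def star (p : Sign) : D A := mk (.atom p none)

/-- The point `(p, x, y)`. -/
def pair (p : Sign) (x y : D A) : D A :=
  Quotient.liftOn₂ x y (fun s t => mk (.pair p s t))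
    (fun _ _ _ _ h h' => mk_eq (PreD.Rel.pair p h h'))

/-- The point `(p, m)` for a finite multiset `m` of points. -/
noncomputable def bag (p : Sign) (m : Multiset (D A)) : D A :=
  Quotient.liftOn m (fun l => mk (.bag p (l.map out)))
    (fun _ _ h => mk_eq (PreD.Rel.perm p (List.Perm.map out h)))

end D

/-- `x^⊥` on trees: all polarities are flipped. -/
def PreD.dual {A : Type u} : PreD A → PreD A
  | .atom p o => .atom p.flip o
  | .pair p x y => .pair p.flip x.dual y.dual
  | .bag p l => .bag p.flip (l.map fun x => x.dual)

theorem PreD.Rel.dual {A : Type u} {x y : PreD A} (h : PreD.Rel x y) :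
    PreD.Rel x.dual y.dual := by
  induction h with
  | refl x => exact .refl _
  | symm _ ih => exact ih.symm
  | trans _ _ ih ih' => exact ih.trans ih'
  | pair p _ _ ih ih' => simp only [PreD.dual]; exact .pair _ ih ih'
  | perm p h => simp only [PreD.dual]; exact .perm _ (h.map _)
  | head p l _ ih => simp only [PreD.dual, List.map_cons]; exact .head _ _ ih

namespace D

variable {A : Type u}

/-- The involution `x ↦ x^⊥` of `D`. -/
def dual (x : D A) : D A := Quotient.map PreD.dual (fun _ _ h => PreD.Rel.dual h) x

theorem bag_coe_map_mk (p : Sign) (l : List (PreD A)) :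
    bag p (l.map mk : List (D A)) = mk (.bag p l) := by
  have key : ∀ (l k : List (PreD A)), PreD.Rel
      (.bag p ((l.map mk).map out ++ k)) (.bag p (l ++ k)) := by
    intro l
    induction l with
    | nil => intro k; exact .refl _
    | cons x l ih =>
      intro k
      refine .trans (.head p _ (out_mk x)) ?_
      refine .trans (.perm p List.perm_middle.symm) ?_
      exact .trans (ih (x :: k)) (.perm p List.perm_middle)
  have := key l []
  simp only [List.append_nil] at this
  exact mk_eq this

/-- The three shapes of a point of `D`, on trees. -/
def preView : PreD A → Sign × (Option A ⊕ (D A × D A) ⊕ Multiset (D A))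
  | .atom p o => (p, .inl o)
  | .pair p x y => (p, .inr (.inl (mk x, mk y)))
  | .bag p l => (p, .inr (.inr (l.map mk : List (D A))))

theorem preView_eq {x y : PreD A} (h : PreD.Rel x y) : preView x = preView y := by
  induction h with
  | refl x => rfl
  | symm _ ih => exact ih.symm
  | trans _ _ ih ih' => exact ih.trans ih'
  | pair p h h' _ _ =>
    simp only [preView, mk_eq h, mk_eq h']
  | perm p h =>
    simp only [preView]
    rw [Multiset.coe_eq_coe.2 (h.map mk)]
  | head p l h _ =>
    simp only [preView, List.map_cons, mk_eq h]

/-- The sign of a point together with its shape: `*` or an atom, a pair, or a finite multiset. -/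
def view (x : D A) : Sign × (Option A ⊕ (D A × D A) ⊕ Multiset (D A)) :=
  Quotient.liftOn x preView (fun _ _ h => preView_eq h)

@[simp] theorem view_atom (p : Sign) (a : A) : (atom p a).view = (p, .inl (some a)) := rfl

@[simp] theorem view_star (p : Sign) : (star p : D A).view = (p, .inl none) := rfl

@[simp] theorem view_pair (p : Sign) (x y : D A) :
    (pair p x y).view = (p, .inr (.inl (x, y))) := by
  induction x using Quotient.inductionOn
  induction y using Quotient.inductionOn
  rfl

@[simp] theorem view_bag (p : Sign) (m : Multiset (D A)) :
    (bag p m).view = (p, .inr (.inr m)) := by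
  induction m using Quotient.inductionOn with
  | h l =>
    have : (bag p (l : Multiset (D A))).view =
        (p, .inr (.inr ((l.map out).map mk : List (D A)))) := rfl
    rw [map_mk_out] at this
    exact this

/-- `D` is in bijection with `{+,-} × (A ∪ {*}) ∪ {+,-} × D × D ∪ {+,-} × M_fin(D)`. -/
noncomputable def equivView : D A ≃ Sign × (Option A ⊕ (D A × D A) ⊕ Multiset (D A)) where
  toFun := view
  invFun v := match v with
    | (p, .inl none) => star p
    | (p, .inl (some a)) => atom p a
    | (p, .inr (.inl (x, y))) => pair p x y
    | (p, .inr (.inr m)) => bag p m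
  left_inv x := by
    induction x using Quotient.inductionOn with
    | h x =>
      match x with
      | .atom p none => rfl
      | .atom p (some a) => rfl
      | .pair p x y => rfl
      | .bag p l => exact bag_coe_map_mk p l
  right_inv v := by
    match v with
    | (p, .inl none) => rfl
    | (p, .inl (some a)) => rfl
    | (p, .inr (.inl (x, y))) => exact view_pair p x y
    | (p, .inr (.inr m)) => exact view_bag p m

theorem dual_mk (x : PreD A) : (mk x).dual = mk x.dual := rfl

@[simp] theorem dual_atom (p : Sign) (a : A) : (atom p a).dual = atom p.flip a := by
  simp only [atom, dual_mk, PreD.dual]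

@[simp] theorem dual_star (p : Sign) : (star p : D A).dual = star p.flip := by
  simp only [star, dual_mk, PreD.dual]

@[simp] theorem dual_pair (p : Sign) (x y : D A) :
    (pair p x y).dual = pair p.flip x.dual y.dual := by
  rw [← mk_out x, ← mk_out y]
  change (mk (.pair p x.out y.out)).dual = mk (.pair p.flip x.out.dual y.out.dual)
  rw [dual_mk, PreD.dual]

@[simp] theorem dual_bag (p : Sign) (m : Multiset (D A)) :
    (bag p m).dual = bag p.flip (m.map dual) := by
  induction m using Quotient.inductionOn with
  | h l =>
    change (bag p (l : Multiset (D A))).dual = bag p.flip ((l : Multiset (D A)).map dual)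
    rw [← map_mk_out l, bag_coe_map_mk, Multiset.map_coe, List.map_map, dual_mk, PreD.dual]
    have : (dual ∘ mk : PreD A → D A) = mk ∘ PreD.dual := rfl
    rw [this, ← List.map_map, bag_coe_map_mk]

/-- The multiset `m` of a point `(p, m)` (and the empty multiset for the other points). -/
def content (x : D A) : Multiset (D A) :=
  match x.view with
  | (_, .inr (.inr m)) => m
  | _ => 0

end D

/-! ### Structures and nets -/

/-- The links (nodes) of a structure, given together with the names of their incident edges.
Logical edges and structural (`♭`-labelled) edges are named by natural numbers, in two separate
name spaces, and the name spaces of a structure and of the boxes of its `!`-links are separate too.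

* `ax a b` has the conclusions `a`, `b`; `cut a b` has the premises `a`, `b`;
* `tens a b c` and `par a b c` have left premise `a`, right premise `b` and conclusion `c`;
* `one c` and `bot c` have the conclusion `c`;
* `flat a s` has the logical premise `a` and the structural conclusion `s`;
* `why ps c` has the structural premises `ps` and the logical conclusion `c`;
* `bang c links m aux` has the main conclusion `c` and the auxiliary (structural) conclusions `aux`;
  its box has the links `links`, the main conclusion `m`, and the structural conclusions `aux`: a
  structural conclusion of the box has the same name as the auxiliary conclusion of the `!`-link
  with which it is associated. -/
inductive Link : Type
  | ax (a b : ℕ)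
  | cut (a b : ℕ)
  | tens (a b c : ℕ)
  | par (a b c : ℕ)
  | one (c : ℕ)
  | bot (c : ℕ)
  | flat (a s : ℕ)
  | why (ps : List ℕ) (c : ℕ)
  | bang (c : ℕ) (links : List Link) (m : ℕ) (aux : List ℕ)

/-- The data of a `♭`-structure: its links at depth `0` (with their boxes), its logical conclusions
in order, and its structural conclusions. -/
structure Struct : Type where
  links : List Link
  concl : List ℕ
  aux : List ℕ

/-- Edges of a structure at depth `0`: logical or structural. -/
inductive Edge : Type
  | logical (n : ℕ)
  | structural (n : ℕ)

namespace Link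

def premises : Link → List Edge
  | .cut a b => [.logical a, .logical b]
  | .tens a b _ => [.logical a, .logical b]
  | .par a b _ => [.logical a, .logical b]
  | .flat a _ => [.logical a]
  | .why ps _ => ps.map .structural
  | _ => []

def conclusions : Link → List Edge
  | .ax a b => [.logical a, .logical b]
  | .cut _ _ => []
  | .tens _ _ c => [.logical c]
  | .par _ _ c => [.logical c]
  | .one c => [.logical c]
  | .bot c => [.logical c]
  | .flat _ s => [.structural s]
  | .why _ c => [.logical c]
  | .bang c _ _ aux => .logical c :: aux.map .structural

/-- The premises that a switching `φ` keeps: the premise `φ l` of a `⅋`-link or of a `?`-link with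
at least one premise, and all the premises of the other links. -/
def keptPremises (φ : Link → Edge) : Link → List Edge
  | .par a b c => [φ (.par a b c)]
  | .why (p :: ps) c => [φ (.why (p :: ps) c)]
  | l => l.premises

end Link

namespace Struct

/-- `a` is a premise and `b` a conclusion of a same link. -/
def Above (S : Struct) (a b : Edge) : Prop :=
  ∃ l ∈ S.links, a ∈ l.premises ∧ b ∈ l.conclusions

/-- The links at depth `0` form a directed acyclic graph: every edge is the conclusion of exactly
one link, is either the premise of exactly one link or else one of the conclusions of the structure,
and there is no directed cycle. -/
structure IsGround (S : Struct) : Prop where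
  nodup : (S.links.flatMap Link.conclusions).Nodup
  perm : (S.links.flatMap Link.conclusions).Perm
    (S.links.flatMap Link.premises ++ (S.concl.map .logical ++ S.aux.map .structural))
  acyclic : ∀ a, ¬ Relation.TransGen S.Above a a

/-- A switching chooses a premise of every link that has premises (the choice is used for `⅋`-links
and `?`-links only). -/
def IsSwitching (S : Struct) (φ : Link → Edge) : Prop :=
  ∀ l ∈ S.links, l.premises ≠ [] → φ l ∈ l.premises

/-- The undirected graph of a switching at depth `0`. Its vertices are the links and the edges
of the structure, a link being adjacent to the edges that it keeps: this is the barycentric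
subdivision of the usual multigraph of the switching, so that it is acyclic if and only if that
multigraph is. -/
def switchingGraph (S : Struct) (φ : Link → Edge) : SimpleGraph (Link ⊕ Edge) :=
  SimpleGraph.fromRel fun v w => match v, w with
    | .inl l, .inr a => l ∈ S.links ∧ (a ∈ l.conclusions ∨ a ∈ l.keptPremises φ)
    | _, _ => False

/-- Untyped `♭`-nets: `♭`-structures all of whose switchings, at every depth, are acyclic. -/
inductive IsFlatNet : Struct → Prop
  | intro (S : Struct) (ground : S.IsGround)
      (switching : ∀ φ, S.IsSwitching φ → (S.switchingGraph φ).IsAcyclic)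
      (boxes : ∀ c L m aux, Link.bang c L m aux ∈ S.links → IsFlatNet ⟨L, [m], aux⟩) :
      IsFlatNet S

/-- Untyped nets: `♭`-nets without structural conclusions. -/
def IsNet (S : Struct) : Prop := S.IsFlatNet ∧ S.aux = []

end Struct

/-! ### Cut elimination -/

/-- `tag 0`, `tag 1`, … are injective renamings with pairwise disjoint ranges; they are used to keep
the names of distinct copies distinct. -/
def tag (j n : ℕ) : ℕ := Nat.pair j n

namespace Link

/-- Rename all edges, at every depth. -/
def rename (f : ℕ → ℕ) : Link → Link
  | .ax a b => .ax (f a) (f b)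
  | .cut a b => .cut (f a) (f b)
  | .tens a b c => .tens (f a) (f b) (f c)
  | .par a b c => .par (f a) (f b) (f c)
  | .one c => .one (f c)
  | .bot c => .bot (f c)
  | .flat a s => .flat (f a) (f s)
  | .why ps c => .why (ps.map f) (f c)
  | .bang c L m aux => .bang (f c) (L.map fun l => l.rename f) (f m) (aux.map f)

/-- Rename all edges by `f`, except that every premise `s` of a `?`-link (at depth `0`) is replaced
by the premises `σ s`. -/
def substWhy (f : ℕ → ℕ) (σ : ℕ → List ℕ) : Link → Link
  | .why ps c => .why (ps.flatMap σ) (f c)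
  | l => l.rename f

/-- Rename the logical premises of a link. -/
def renamePremises (f : ℕ → ℕ) : Link → Link
  | .cut a b => .cut (f a) (f b)
  | .tens a b c => .tens (f a) (f b) c
  | .par a b c => .par (f a) (f b) c
  | .flat a s => .flat (f a) s
  | l => l

/-- Put the structure with links `K`, main conclusion `m` and structural conclusions `xs` in the
place of the `♭`-link associated with the structural edge `p`, inside the boxes that contain that
`♭`-link, with a new cut between the premise of the `♭`-link and `m`. The auxiliary conclusion `p`
of every `!`-link whose box contains the `♭`-link is replaced by the auxiliary conclusions `xs`. -/
def graft (p : ℕ) (K : List Link) (m : ℕ) (xs : List ℕ) : Link → List Link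
  | .flat a s => if s = p then .cut a m :: K else [.flat a s]
  | .bang c L n aux =>
      [.bang c (if p ∈ aux then L.flatMap fun l => l.graft p K m xs else L) n
        (aux.flatMap fun s => if s = p then xs else [s])]
  | l => [l]

end Link

namespace Struct

/-- In the elimination of a cut between a `!`-link with auxiliary conclusions `aux` and a `k`-ary
`?`-link: the edges that replace the structural edge `s`. -/
def copies (k : ℕ) (aux : List ℕ) (s : ℕ) : List ℕ :=
  if s ∈ aux then (List.range k).map fun j => tag (j + 1) s else [tag 0 s]

/-- The links that replace `bang c L m aux`, `why ps w`, the cut between `c` and `w`, and the other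
links `R`: for the `j`-th premise `p` of the `?`-link (`j = 0, 1, …`), a copy of the box, with its
edges renamed by `tag (j + 1)`, is put in the place of the `♭`-link associated with `p`, and each
edge in `aux`, as a premise of a `?`-link, is replaced by its copies. -/
def dispatch (L : List Link) (m : ℕ) (aux ps : List ℕ) (R : List Link) : List Link :=
  ps.zipIdx.foldl
    (fun K pj => K.flatMap (Link.graft (tag 0 pj.1) (L.map (Link.rename (tag (pj.2 + 1))))
      (tag (pj.2 + 1) m) (aux.map (tag (pj.2 + 1)))))
    (R.map (Link.substWhy (tag 0) (copies ps.length aux)))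

/-- `StepWith f σ S S'`: the structure `S'` is obtained from `S` by the elimination of one cut, at
any depth; here `f` is the renaming of the edges of `S` not affected by the step, and the step
replaces the structural conclusion `s` of `S` by the structural conclusions `σ s`. -/
inductive StepWith : (ℕ → ℕ) → (ℕ → List ℕ) → Struct → Struct → Prop
  /-- An axiom with conclusions `a`, `b` and a cut with premises `b`, `c`: the edge `c` takes the
  place of `a`. -/
  | ax {S : Struct} {a b c : ℕ} {l t : Link} {R : List Link}
      (hl : l = .ax a b ∨ l = .ax b a) (ht : t = .cut b c ∨ t = .cut c b)
      (h : S.links.Perm (l :: t :: R)) :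
      StepWith id (fun s => [s]) S
        ⟨R.map (Link.renamePremises fun n => if n = a then c else n),
          S.concl.map (fun n => if n = a then c else n), S.aux⟩
  | mult {S : Struct} {a b c a' b' c' : ℕ} {t : Link} {R : List Link}
      (ht : t = .cut c c' ∨ t = .cut c' c)
      (h : S.links.Perm (.tens a b c :: .par a' b' c' :: t :: R)) :
      StepWith id (fun s => [s]) S ⟨.cut a a' :: .cut b b' :: R, S.concl, S.aux⟩
  | unit {S : Struct} {c c' : ℕ} {t : Link} {R : List Link}
      (ht : t = .cut c c' ∨ t = .cut c' c)
      (h : S.links.Perm (.one c :: .bot c' :: t :: R)) :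
      StepWith id (fun s => [s]) S ⟨R, S.concl, S.aux⟩
  | exp {S : Struct} {c w m : ℕ} {L : List Link} {aux ps : List ℕ} {t : Link} {R : List Link}
      (ht : t = .cut c w ∨ t = .cut w c)
      (h : S.links.Perm (.bang c L m aux :: .why ps w :: t :: R)) :
      StepWith (tag 0) (copies ps.length aux) S
        ⟨dispatch L m aux ps R, S.concl.map (tag 0), S.aux.flatMap (copies ps.length aux)⟩
  /-- A step inside the box of a `!`-link. -/
  | box {f : ℕ → ℕ} {σ : ℕ → List ℕ} {S : Struct} {c m m' : ℕ} {L L' R : List Link}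
      {aux aux' : List ℕ} (h : S.links.Perm (.bang c L m aux :: R))
      (step : StepWith f σ ⟨L, [m], aux⟩ ⟨L', [m'], aux'⟩) :
      StepWith f (fun s => if s ∈ aux then σ s else [f s]) S
        ⟨.bang (f c) L' m' aux' ::
            R.map (Link.substWhy f fun s => if s ∈ aux then σ s else [f s]),
          S.concl.map f, S.aux.flatMap fun s => if s ∈ aux then σ s else [f s]⟩

/-- One step of cut elimination. -/
def Step (S S' : Struct) : Prop := ∃ f σ, StepWith f σ S S'

/-- `a`, `b` are the conclusions of a `⊗`-link and a `⅋`-link, or of a `1`-link and a `⊥`-link, or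
of a `!`-link and a `?`-link, in this order. -/
def DualEdges (S : Struct) (a b : ℕ) : Prop :=
  (∃ x y x' y', Link.tens x y a ∈ S.links ∧ Link.par x' y' b ∈ S.links) ∨
  (Link.one a ∈ S.links ∧ Link.bot b ∈ S.links) ∨
  (∃ L m aux ps, Link.bang a L m aux ∈ S.links ∧ Link.why ps b ∈ S.links)

/-- `a` is a conclusion of an axiom. -/
def IsAxConclusion (S : Struct) (a : ℕ) : Prop :=
  ∃ b, Link.ax a b ∈ S.links ∨ Link.ax b a ∈ S.links

/-- `S` contains a clash, at some depth. -/
inductive HasClash : Struct → Prop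
  | here (S : Struct) (a b : ℕ) (h : Link.cut a b ∈ S.links)
      (hab : ¬ S.DualEdges a b) (hba : ¬ S.DualEdges b a)
      (ha : ¬ S.IsAxConclusion a) (hb : ¬ S.IsAxConclusion b) : HasClash S
  | box (S : Struct) (c m : ℕ) (L : List Link) (aux : List ℕ)
      (h : Link.bang c L m aux ∈ S.links) (hc : HasClash ⟨L, [m], aux⟩) : HasClash S

/-- `S` is a net, there is no infinite reduction sequence from `S`, and no reduct of `S` contains
a clash. -/
def StronglyNormalizable (S : Struct) : Prop :=
  S.IsNet ∧ (¬ ∃ F : ℕ → Struct, F 0 = S ∧ ∀ n, Step (F n) (F (n + 1))) ∧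
    ∀ S', Relation.ReflTransGen Step S S' → ¬ S'.HasClash

/-- The net obtained from the disjoint union of `S` and `S'` by a cut between the conclusion of
`S` at position `i` and the conclusion of `S'` at position `j`. -/
def cutNets (S S' : Struct) (i : Fin S.concl.length) (j : Fin S'.concl.length) : Struct where
  links := .cut (tag 0 S.concl[i]) (tag 1 S'.concl[j]) ::
    (S.links.map (Link.rename (tag 0)) ++ S'.links.map (Link.rename (tag 1)))
  concl := (S.concl.eraseIdx i).map (tag 0) ++ (S'.concl.eraseIdx j).map (tag 1)
  aux := S.aux.map (tag 0) ++ S'.aux.map (tag 1)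

end Struct

/-! ### Experiments -/

/-- The data of an experiment: `val a` is the value of the logical edge `a`, the value of the
structural edge `s` is `(-, str s)`, and `box c` is the multiset of experiments (enumerated as a
list, whose order is irrelevant) of the box of the `!`-link with main conclusion `c`. The values at
names that do not occur are irrelevant. -/
inductive Experiment (A : Type u) : Type u
  | mk (val : ℕ → D A) (str : ℕ → Multiset (D A)) (box : ℕ → List (Experiment A))

namespace Experiment

variable {A : Type u}

def val : Experiment A → ℕ → D A
  | mk v _ _ => v

def str : Experiment A → ℕ → Multiset (D A)
  | mk _ s _ => s

def box : Experiment A → ℕ → List (Experiment A)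
  | mk _ _ b => b

/-- The condition that a link at depth `0` imposes on the values of an experiment. -/
def Satisfies (e : Experiment A) : Link → Prop
  | .ax a b => e.val a = (e.val b).dual
  | .cut a b => e.val a = (e.val b).dual
  | .tens a b c => e.val c = D.pair .pos (e.val a) (e.val b)
  | .par a b c => e.val c = D.pair .neg (e.val a) (e.val b)
  | .one c => e.val c = D.star .pos
  | .bot c => e.val c = D.star .neg
  | .flat a s => e.str s = {e.val a}
  | .why [] c => ∃ μ : Multiset (D A), e.val c = D.bag .neg μ
  | .why (p :: ps) c => e.val c = D.bag .neg (((p :: ps).map e.str).sum)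
  | .bang c _ m aux =>
      e.val c = D.bag .pos ((e.box c).map fun e' => e'.val m : List (D A)) ∧
      ∀ s ∈ aux, e.str s = ((e.box c).map fun e' => e'.str s).sum

/-- `e` is an `𝓢ᵉˣ`-experiment of `S`. -/
inductive IsExperiment : Struct → Experiment A → Prop
  | intro (S : Struct) (e : Experiment A) (sat : ∀ l ∈ S.links, e.Satisfies l)
      (nonempty : ∀ c L m aux, Link.bang c L m aux ∈ S.links → e.box c ≠ [])
      (boxes : ∀ c L m aux, Link.bang c L m aux ∈ S.links →
        ∀ e' ∈ e.box c, IsExperiment ⟨L, [m], aux⟩ e') :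
      IsExperiment S e

end Experiment

/-- The contribution of a link at depth `0` to the multiset `𝓦(e)`: the multiset `μ` with
`e(c) = (-, μ)` for a `0`-ary `?`-link with conclusion `c`, and the sum of all `𝓦(e')` with `e'` in
`e(o)` for a `!`-link `o`. -/
def Link.weakenings {A : Type u} : Link → Experiment A → Multiset (D A)
  | .why [] c, e => (e.val c).content
  | .bang c L _ _, e =>
      ((e.box c).map fun e' => (L.map fun l => l.weakenings e').sum).sum
  | _, _ => 0

namespace Struct

/-- The multiset `𝓦(e)` of an experiment `e` of `S`. -/
def weakenings {A : Type u} (S : Struct) (e : Experiment A) : Multiset (D A) :=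
  (S.links.map fun l => l.weakenings e).sum

/-- The `𝓢ᵉˣ`-interpretation of a net: the pairs `(|e|, 𝓦(e))`, where `e` is an `𝓢ᵉˣ`-experiment
and `|e|` is the family of the values of the conclusions. -/
def interpEx (A : Type u) (S : Struct) : Set ((Fin S.concl.length → D A) × Multiset (D A)) :=
  {r | ∃ e : Experiment A, e.IsExperiment S ∧ r = (fun i => e.val S.concl[i], S.weakenings e)}

end Struct

end LLNet

namespace LLNet

universe u

/-! ### Forests of hyperedges -/

section Forest

variable {E : Type*} {F : Type*}

/-- The combinations of the elements of `H` with sum of coefficients zero. -/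
noncomputable def zeroSum (H : Set E) : Submodule ℚ (E →₀ ℚ) :=
  Finsupp.supported ℚ ℚ H ⊓ LinearMap.ker (Finsupp.linearCombination ℚ fun _ : E => (1 : ℚ))

/-- The sum of the spaces `zeroSum H`. -/
noncomputable def cutSpace : List (Set E) → Submodule ℚ (E →₀ ℚ)
  | [] => ⊥
  | H :: Hs => zeroSum H ⊔ cutSpace Hs

/-- The hyperedges form a forest: the sum of the spaces `zeroSum H` is direct. -/
def Forest : List (Set E) → Prop
  | [] => True
  | H :: Hs => Disjoint (zeroSum H) (cutSpace Hs) ∧ Forest Hs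

/-- The vertices `x` and `y` are connected by hyperedges. -/
def Conn (Hs : List (Set E)) (x y : E) : Prop :=
  Finsupp.single x (1 : ℚ) - Finsupp.single y 1 ∈ cutSpace Hs

theorem zeroSum_mono {H H' : Set E} (h : H ⊆ H') : zeroSum H ≤ zeroSum H' :=
  inf_le_inf_right _ (Finsupp.supported_mono h)

theorem single_sub_single_mem {H : Set E} {x y : E} (hx : x ∈ H) (hy : y ∈ H) :
    Finsupp.single x (1 : ℚ) - Finsupp.single y 1 ∈ zeroSum H := by
  refine ⟨Submodule.sub_mem _ (Finsupp.single_mem_supported _ _ hx)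
    (Finsupp.single_mem_supported _ _ hy), ?_⟩
  simp

/-- The difference is the combination, with the coefficients of `z`, of the differences of a point
and its image. -/
theorem sub_mapDomain_mem {W : Submodule ℚ (E →₀ ℚ)} {ρ : E → E} {z : E →₀ ℚ}
    (h : ∀ x ∈ z.support, Finsupp.single x (1 : ℚ) - Finsupp.single (ρ x) 1 ∈ W) :
    z - z.mapDomain ρ ∈ W := by
  have : z - z.mapDomain ρ =
      z.sum fun x c => c • (Finsupp.single x (1 : ℚ) - Finsupp.single (ρ x) 1) := by
    simp only [smul_sub, Finsupp.sum_sub, Finsupp.smul_single, smul_eq_mul, mul_one]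
    rw [Finsupp.sum_single]; rfl
  rw [this]
  exact Submodule.sum_mem _ fun x hx => Submodule.smul_mem _ _ (h x hx)

/-- Differences of points of `H` generate the space: moving all the mass of `z` to one point `y` of
`H` changes `z` by such differences, and what remains is the total mass at `y`, which is zero. -/
theorem zeroSum_le {H : Set E} {W : Submodule ℚ (E →₀ ℚ)}
    (h : ∀ x ∈ H, ∀ y ∈ H, Finsupp.single x (1 : ℚ) - Finsupp.single y 1 ∈ W) :
    zeroSum H ≤ W := by
  intro z hz
  obtain ⟨hs, h0⟩ := hz
  rcases H.eq_empty_or_nonempty with rfl | ⟨y, hy⟩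
  · rw [Finsupp.supported_empty] at hs
    rw [(Submodule.mem_bot _).1 hs]; exact zero_mem _
  · have key : z - z.mapDomain (fun _ => y) ∈ W :=
      sub_mapDomain_mem fun x hx => h x (hs hx) y hy
    have h1 : z.mapDomain (fun _ => y) = 0 := by
      rw [SetLike.mem_coe, LinearMap.mem_ker, Finsupp.linearCombination_apply] at h0
      simp only [smul_eq_mul, mul_one] at h0
      rw [Finsupp.mapDomain, ← Finsupp.single_sum, h0, Finsupp.single_zero]
    rwa [h1, sub_zero] at key

theorem cutSpace_append (Hs Hs' : List (Set E)) :
    cutSpace (Hs ++ Hs') = cutSpace Hs ⊔ cutSpace Hs' := by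
  induction Hs with
  | nil => simp [cutSpace]
  | cons H Hs ih => simp [cutSpace, ih, sup_assoc]

theorem zeroSum_le_cutSpace {Hs : List (Set E)} {H : Set E} (h : H ∈ Hs) :
    zeroSum H ≤ cutSpace Hs := by
  induction Hs with
  | nil => simp at h
  | cons K Hs ih =>
    rcases List.mem_cons.1 h with rfl | h
    · exact le_sup_left
    · exact (ih h).trans le_sup_right

theorem cutSpace_le {Hs : List (Set E)} {W : Submodule ℚ (E →₀ ℚ)}
    (h : ∀ H ∈ Hs, zeroSum H ≤ W) : cutSpace Hs ≤ W := by
  induction Hs with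
  | nil => exact bot_le
  | cons K Hs ih =>
    exact sup_le (h K (by simp)) (ih fun H hH => h H (by simp [hH]))

theorem cutSpace_mono {Hs Hs' : List (Set E)}
    (h : ∀ H ∈ Hs, ∃ H' ∈ Hs', H ⊆ H') : cutSpace Hs ≤ cutSpace Hs' :=
  cutSpace_le fun H hH => by
    obtain ⟨H', hH', hs⟩ := h H hH
    exact (zeroSum_mono hs).trans (zeroSum_le_cutSpace hH')

theorem cutSpace_perm {Hs Hs' : List (Set E)} (h : Hs.Perm Hs') : cutSpace Hs = cutSpace Hs' :=
  le_antisymm (cutSpace_mono fun H hH => ⟨H, h.mem_iff.1 hH, le_rfl⟩)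
    (cutSpace_mono fun H hH => ⟨H, h.mem_iff.2 hH, le_rfl⟩)

theorem cutSpace_le_zeroSum (Hs : List (Set E)) : cutSpace Hs ≤ zeroSum {x | ∃ H ∈ Hs, x ∈ H} :=
  cutSpace_le fun H hH => zeroSum_mono fun _ hx => ⟨H, hH, hx⟩

theorem forest_append {Hs Hs' : List (Set E)} :
    Forest (Hs ++ Hs') ↔ Forest Hs ∧ Forest Hs' ∧ Disjoint (cutSpace Hs) (cutSpace Hs') := by
  induction Hs with
  | nil => simp [Forest, cutSpace]
  | cons H Hs ih =>
    simp only [List.cons_append, Forest, ih, cutSpace_append, cutSpace]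
    constructor
    · rintro ⟨h, h1, h2, h3⟩
      exact ⟨⟨h.mono_right le_sup_left, h1⟩, h2,
        (h3.symm.disjoint_sup_right_of_disjoint_sup_left (by rw [sup_comm]; exact h.symm)).symm
          |>.mono_left (by rw [sup_comm])⟩
    · rintro ⟨⟨h, h1⟩, h2, h3⟩
      exact ⟨h.disjoint_sup_right_of_disjoint_sup_left h3, h1, h2, h3.mono_left le_sup_right⟩

theorem Forest.perm {Hs Hs' : List (Set E)} (h : Hs.Perm Hs') (hf : Forest Hs) : Forest Hs' := by
  induction h with
  | nil => trivial
  | cons x h ih => exact ⟨by rw [← cutSpace_perm h]; exact hf.1, ih hf.2⟩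
  | swap x y l =>
    obtain ⟨h1, h2, h3⟩ := hf
    have h1' : Disjoint (zeroSum y) (zeroSum x ⊔ cutSpace l) := h1
    refine ⟨?_, ?_, h3⟩
    · change Disjoint (zeroSum x) (zeroSum y ⊔ cutSpace l)
      rw [sup_comm]
      refine h2.disjoint_sup_right_of_disjoint_sup_left h1'.symm
    · exact h1'.mono_right le_sup_right
  | trans _ _ ih ih' => exact ih' (ih hf)

/-- A block `Y` may take the place of a block `X`. -/
theorem Forest.replace {X Y Z : List (Set E)} (h : Forest (X ++ Z)) (hY : Forest Y)
    (hXY : cutSpace Y ⊓ cutSpace Z ≤ cutSpace X) : Forest (Y ++ Z) := by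
  obtain ⟨_, h2, h3⟩ := forest_append.1 h
  refine forest_append.2 ⟨hY, h2, disjoint_iff_inf_le.2 ?_⟩
  exact (le_inf hXY inf_le_right).trans (disjoint_iff_inf_le.1 h3)

/-- This allows a switching to be compared with one that keeps more edges, so that only the largest
hyperedges have to be examined. -/
theorem Forest.mono {Hs Hs' : List (Set E)} (h : List.Forall₂ (· ⊆ ·) Hs Hs') (hf : Forest Hs') :
    Forest Hs := by
  induction h with
  | nil => trivial
  | @cons H H' Hs Hs' hH h ih =>
    refine ⟨hf.1.mono (zeroSum_mono hH) (cutSpace_mono fun K hK => ?_), ih hf.2⟩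
    clear ih hf
    induction h with
    | nil => simp at hK
    | cons h' _ ih =>
      rcases List.mem_cons.1 hK with rfl | hK
      · exact ⟨_, by simp, h'⟩
      · obtain ⟨K', h1, h2⟩ := ih hK
        exact ⟨K', by simp [h1], h2⟩

namespace Conn

variable {Hs : List (Set E)} {x y z : E}

theorem refl (Hs : List (Set E)) (x : E) : Conn Hs x x := by simp [Conn]

theorem symm (h : Conn Hs x y) : Conn Hs y x := by
  have := (cutSpace Hs).neg_mem h
  rwa [neg_sub] at this

theorem trans (h : Conn Hs x y) (h' : Conn Hs y z) : Conn Hs x z := by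
  have := (cutSpace Hs).add_mem h h'
  rwa [sub_add_sub_cancel] at this

theorem of_mem {H : Set E} (hH : H ∈ Hs) (hx : x ∈ H) (hy : y ∈ H) : Conn Hs x y :=
  zeroSum_le_cutSpace hH (single_sub_single_mem hx hy)

end Conn

open Classical in
/-- The characteristic function of the component of `x`, extended linearly. -/
noncomputable def component (Hs : List (Set E)) (x : E) : (E →₀ ℚ) →ₗ[ℚ] ℚ :=
  Finsupp.linearCombination ℚ fun y => if Conn Hs y x then (1 : ℚ) else 0

theorem component_single_of_conn {Hs : List (Set E)} {x y : E} (h : Conn Hs y x) :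
    component Hs x (Finsupp.single y 1) = 1 := by simp [component, h]

theorem component_single_of_not_conn {Hs : List (Set E)} {x y : E} (h : ¬ Conn Hs y x) :
    component Hs x (Finsupp.single y 1) = 0 := by simp [component, h]

theorem component_cutSpace (Hs : List (Set E)) (x : E) :
    cutSpace Hs ≤ LinearMap.ker (component Hs x) := by
  refine cutSpace_le fun H hH => zeroSum_le fun y hy z hz => ?_
  have hyz : Conn Hs y z := .of_mem hH hy hz
  rw [LinearMap.mem_ker, map_sub]
  by_cases h : Conn Hs y x
  · rw [component_single_of_conn h, component_single_of_conn (hyz.symm.trans h), sub_self]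
  · rw [component_single_of_not_conn h, component_single_of_not_conn fun h' => h (hyz.trans h'),
      sub_self]

/-- A hyperedge that avoids the component of `x` does not change it: the indicator of this component
still vanishes on the enlarged space, and it separates `x` from `y`. -/
theorem not_conn_cons {Hs : List (Set E)} {H : Set E} {x y : E} (h : ∀ z ∈ H, ¬ Conn Hs z x)
    (hxy : ¬ Conn Hs x y) : ¬ Conn (H :: Hs) x y := by
  intro hc
  have hle : cutSpace (H :: Hs) ≤ LinearMap.ker (component Hs x) := by
    refine sup_le (zeroSum_le fun a ha b hb => ?_) (component_cutSpace Hs x)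
    rw [LinearMap.mem_ker, map_sub, component_single_of_not_conn (h a ha),
      component_single_of_not_conn (h b hb), sub_self]
  have := hle hc
  rw [LinearMap.mem_ker, map_sub, component_single_of_conn (Conn.refl _ _),
    component_single_of_not_conn fun h' => hxy h'.symm] at this
  norm_num at this

/-- The combinatorial meaning of directness: a new hyperedge creates no cycle exactly when its
points lie in distinct components of the others. -/
theorem forest_cons {Hs : List (Set E)} {H : Set E} :
    Forest (H :: Hs) ↔ Forest Hs ∧ ∀ x ∈ H, ∀ y ∈ H, x ≠ y → ¬ Conn Hs x y := by
  constructor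
  · rintro ⟨h1, h2⟩
    refine ⟨h2, fun x hx y hy hxy hc => hxy ?_⟩
    have := Submodule.disjoint_def.1 h1 _ (single_sub_single_mem hx hy) hc
    rw [sub_eq_zero] at this
    exact (Finsupp.single_left_injective one_ne_zero) this
  · rintro ⟨h1, h2⟩
    refine ⟨Submodule.disjoint_def.2 fun z hz hz' => ?_, h1⟩
    ext x
    by_cases hx : x ∈ H
    -- `x` is the only point of `H` in its component, so the indicator of this component reads off
    -- the coefficient of `z` at `x`; it vanishes because `z` lies in `cutSpace Hs`.
    · have h0 := component_cutSpace Hs x hz'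
      rw [LinearMap.mem_ker, component, Finsupp.linearCombination_apply, Finsupp.sum,
        Finset.sum_eq_single x] at h0
      · simpa [Conn.refl] using h0
      · intro y hy hyx
        rw [if_neg (h2 y (hz.1 hy) x hx hyx), smul_zero]
      · intro hx'
        rw [Finsupp.notMem_support_iff.1 hx', zero_smul]
    · by_contra h
      exact hx (hz.1 (Finsupp.mem_support_iff.2 h))

/-- In a forest, two distinct points that a block connects are not connected by the rest. -/
theorem Forest.not_conn {X Hs : List (Set E)} (h : Forest (X ++ Hs)) {x y : E} (hxy : x ≠ y)
    (hX : Conn X x y) : ¬ Conn Hs x y := by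
  intro hc
  have := Submodule.disjoint_def.1 (forest_append.1 h).2.2 _ hX hc
  rw [sub_eq_zero] at this
  exact hxy ((Finsupp.single_left_injective one_ne_zero) this)

theorem not_conn_of_notMem {Hs : List (Set E)} {x y : E} (hxy : x ≠ y)
    (hx : ∀ H ∈ Hs, x ∉ H) : ¬ Conn Hs x y := by
  intro hc
  have h1 := (cutSpace_le_zeroSum Hs hc).1
  have h2 : x ∈ (Finsupp.single x (1 : ℚ) - Finsupp.single y 1).support := by
    rw [Finsupp.mem_support_iff, Finsupp.sub_apply, Finsupp.single_eq_same,
      Finsupp.single_eq_of_ne hxy]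
    norm_num
  obtain ⟨H, hH, hxH⟩ := h1 h2
  exact hx H hH hxH

/-- Pairwise disjoint bunches `A i`, whose points lie in components of their own, may be attached
to points `p i`. -/
theorem Forest.attach {Hs : List (Set E)} (hf : Forest Hs) :
    ∀ (B : List (E × Set E)), B.Pairwise (fun b b' => Disjoint b.2 b'.2) →
    (∀ b ∈ B, ∀ x ∈ b.2, ∀ b' ∈ B, ¬ Conn Hs x b'.1 ∧ ∀ y ∈ b'.2, x ≠ y → ¬ Conn Hs x y) →
    Forest (B.map (fun b => insert b.1 b.2) ++ Hs) := by
  intro B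
  induction B generalizing Hs with
  | nil => intro _ _; exact hf
  | cons b B ih =>
    intro hd h
    rw [List.pairwise_cons] at hd
    have h1 : Forest (insert b.1 b.2 :: Hs) := by
      refine forest_cons.2 ⟨hf, ?_⟩
      rintro x (rfl | hx) y (rfl | hy) hxy
      · exact absurd rfl hxy
      · exact fun hc => (h b (by simp) y hy b (by simp)).1 hc.symm
      · exact (h b (by simp) x hx b (by simp)).1
      · exact (h b (by simp) x hx b (by simp)).2 y hy hxy
    -- The hyperedge just added avoids the components of the points of the remaining bunches, so
    -- their hypotheses survive its addition.
    have h2 := ih h1 hd.2 fun b1 hb1 x hx b2 hb2 => by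
      have hx' := h b1 (by simp [hb1]) x hx
      have hb : ∀ z ∈ insert b.1 b.2, ¬ Conn Hs z x := by
        rintro z (rfl | hz) hc
        · exact (hx' b (by simp)).1 hc.symm
        · refine (hx' b (by simp)).2 z hz ?_ hc.symm
          rintro rfl
          exact Set.disjoint_left.1 (hd.1 b1 hb1) hz hx
      exact ⟨not_conn_cons hb (hx' b2 (by simp [hb2])).1,
        fun y hy hxy => not_conn_cons hb ((hx' b2 (by simp [hb2])).2 y hy hxy)⟩
    exact h2.perm List.perm_middle

theorem map_zeroSum (ρ : E → F) (H : Set E) :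
    (zeroSum H).map (Finsupp.lmapDomain ℚ ℚ ρ) ≤ zeroSum (ρ '' H) := by
  rw [Submodule.map_le_iff_le_comap]
  refine zeroSum_le fun x hx y hy => ?_
  rw [Submodule.mem_comap, map_sub]
  simp only [Finsupp.lmapDomain_apply, Finsupp.mapDomain_single]
  exact single_sub_single_mem ⟨x, hx, rfl⟩ ⟨y, hy, rfl⟩

theorem zeroSum_image_le (ρ : E → F) (H : Set E) :
    zeroSum (ρ '' H) ≤ (zeroSum H).map (Finsupp.lmapDomain ℚ ℚ ρ) := by
  refine zeroSum_le ?_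
  rintro _ ⟨x, hx, rfl⟩ _ ⟨y, hy, rfl⟩
  refine ⟨_, single_sub_single_mem hx hy, ?_⟩
  rw [map_sub]
  simp [Finsupp.lmapDomain_apply, Finsupp.mapDomain_single]

theorem cutSpace_image (ρ : E → F) (Hs : List (Set E)) :
    cutSpace (Hs.map (ρ '' ·)) = (cutSpace Hs).map (Finsupp.lmapDomain ℚ ℚ ρ) := by
  induction Hs with
  | nil => simp [cutSpace]
  | cons H Hs ih =>
    simp only [List.map_cons, cutSpace, ih, Submodule.map_sup]
    rw [le_antisymm (map_zeroSum ρ H) (zeroSum_image_le ρ H)]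

theorem Conn.image {Hs : List (Set E)} {x y : E} (ρ : E → F) (h : Conn Hs x y) :
    Conn (Hs.map (ρ '' ·)) (ρ x) (ρ y) := by
  rw [Conn, cutSpace_image]
  refine ⟨_, h, ?_⟩
  rw [map_sub]
  simp [Finsupp.lmapDomain_apply, Finsupp.mapDomain_single]

/-- Connections are pushed forward by any map. Injectivity on the vertices is needed only to keep
distinct points of a hyperedge distinct. -/
theorem Forest.of_image {Hs : List (Set E)} {ρ : E → F}
    (hρ : Set.InjOn ρ {x | ∃ H ∈ Hs, x ∈ H}) (h : Forest (Hs.map (ρ '' ·))) : Forest Hs := by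
  induction Hs with
  | nil => trivial
  | cons H Hs ih =>
    rw [List.map_cons, forest_cons] at h
    refine forest_cons.2 ⟨ih (hρ.mono (by rintro x ⟨K, hK, hx⟩; exact ⟨K, by simp [hK], hx⟩)) h.1, ?_⟩
    intro x hx y hy hxy hc
    refine h.2 _ ⟨x, hx, rfl⟩ _ ⟨y, hy, rfl⟩ (fun he => hxy ?_) (hc.image ρ)
    exact hρ ⟨H, by simp, hx⟩ ⟨H, by simp, hy⟩ he

/-- Contraction of a block. -/
theorem Forest.contract {T : List (Set E)} {ρ : E → E} (hρ : ∀ x, Conn T x (ρ x)) :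
    ∀ {Hs : List (Set E)}, Forest (Hs ++ T) → Forest (Hs.map (ρ '' ·)) := by
  intro Hs
  induction Hs with
  | nil => intro _; trivial
  | cons H Hs ih =>
    rintro ⟨h1, h2⟩
    refine ⟨Submodule.disjoint_def.2 fun z hz hz' => ?_, ih h2⟩
    rw [cutSpace_image] at hz'
    obtain ⟨z1, hz1, rfl⟩ := zeroSum_image_le ρ H hz
    obtain ⟨z2, hz2, he⟩ := hz'
    -- A vector killed by the contraction `ρ` is a combination of differences of points and their
    -- images, all of which lie in `cutSpace T`.
    have hk : z1 - z2 ∈ cutSpace T := by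
      have := sub_mapDomain_mem (W := cutSpace T) (ρ := ρ) (z := z1 - z2) fun x _ => hρ x
      have h0 : (z1 - z2).mapDomain ρ = 0 := by
        have : Finsupp.lmapDomain ℚ ℚ ρ (z1 - z2) = 0 := by rw [map_sub, he, sub_self]
        simpa [Finsupp.lmapDomain_apply] using this
      rwa [h0, sub_zero] at this
    have h3 : z1 ∈ cutSpace (Hs ++ T) := by
      rw [cutSpace_append]
      have := Submodule.add_mem_sup hz2 hk
      rwa [add_sub_cancel] at this
    rw [Submodule.disjoint_def.1 h1 z1 hz1 h3, map_zero]

/-- A forest `Y` that meets `Z` in `H` only may take the place of the hyperedge `H`. -/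
theorem Forest.expand {H : Set E} {Y Z : List (Set E)} (h : Forest (H :: Z)) (hY : Forest Y)
    (hYZ : ∀ K ∈ Y, ∀ K' ∈ Z, ∀ x ∈ K, x ∈ K' → x ∈ H) : Forest (Y ++ Z) := by
  -- A vector common to the spaces of `Y` and `Z` is supported on shared points, hence on `H`, and
  -- has sum zero.
  refine Forest.replace (X := [H]) h hY ?_
  intro z hz
  have h1 := cutSpace_le_zeroSum Y hz.1
  have h2 := cutSpace_le_zeroSum Z hz.2
  refine zeroSum_le_cutSpace (Hs := [H]) (List.mem_singleton_self H) ⟨fun x hx => ?_, h1.2⟩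
  obtain ⟨K, hK, hxK⟩ := h1.1 hx
  obtain ⟨K', hK', hxK'⟩ := h2.1 hx
  exact hYZ K hK K' hK' x hxK hxK'

end Forest

/-! ### Correctness by forests -/

section Conn

variable {E : Type*}

/-- The indicator of the `r`-class of `x` is a linear form that vanishes on every `zeroSum H`, hence
on the difference of `x` and `y`. -/
theorem Conn.induction {Hs : List (Set E)} {x y : E} (hc : Conn Hs x y) {r : E → E → Prop}
    (hr : Equivalence r) (h : ∀ H ∈ Hs, ∀ a ∈ H, ∀ b ∈ H, r a b) : r x y := by
  classical
  let χ : (E →₀ ℚ) →ₗ[ℚ] ℚ := Finsupp.linearCombination ℚ fun z => if r x z then (1 : ℚ) else 0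
  have hle : cutSpace Hs ≤ LinearMap.ker χ := by
    refine cutSpace_le fun H hH => zeroSum_le fun a ha b hb => ?_
    have hab := h H hH a ha b hb
    rw [LinearMap.mem_ker, map_sub]
    by_cases hx : r x a
    · simp [χ, hx, hr.trans hx hab]
    · simp [χ, hx, show ¬ r x b from fun h' => hx (hr.trans h' (hr.symm hab))]
  have h0 := hle hc
  rw [LinearMap.mem_ker, map_sub] at h0
  by_contra hxy
  simp [χ, hxy, hr.refl x] at h0

end Conn

namespace Link

/-- The links of which a switching keeps one premise only. -/
def Exclusive : Link → Prop
  | .par _ _ _ => True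
  | .why _ _ => True
  | _ => False

/-- `H` consists of edges of the link that some switching keeps. -/
def Sw (l : Link) (H : Set Edge) : Prop :=
  (∀ x ∈ H, x ∈ l.premises ∨ x ∈ l.conclusions) ∧
    (l.Exclusive → ∀ x ∈ l.premises, ∀ y ∈ l.premises, x ∈ H → y ∈ H → x = y)

end Link

/-- The conclusions of the links of a list. -/
def conc (T : List Link) : Multiset Edge := (T.flatMap Link.conclusions : List Edge)

/-- The premises of the links of a list. -/
def prem (T : List Link) : Multiset Edge := (T.flatMap Link.premises : List Edge)

@[simp] theorem conc_cons (l : Link) (T : List Link) :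
    conc (l :: T) = (l.conclusions : Multiset Edge) + conc T := by simp [conc]

@[simp] theorem prem_cons (l : Link) (T : List Link) :
    prem (l :: T) = (l.premises : Multiset Edge) + prem T := by simp [prem]

@[simp] theorem conc_append (T T' : List Link) : conc (T ++ T') = conc T + conc T' := by
  simp [conc]

@[simp] theorem prem_append (T T' : List Link) : prem (T ++ T') = prem T + prem T' := by
  simp [prem]

theorem conc_perm {T T' : List Link} (h : T.Perm T') : conc T = conc T' :=
  Multiset.coe_eq_coe.2 (h.flatMap_right _)

theorem prem_perm {T T' : List Link} (h : T.Perm T') : prem T = prem T' :=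
  Multiset.coe_eq_coe.2 (h.flatMap_right _)

theorem mem_conc {T : List Link} {x : Edge} : x ∈ conc T ↔ ∃ l ∈ T, x ∈ l.conclusions := by
  simp [conc]

theorem mem_prem {T : List Link} {x : Edge} : x ∈ prem T ↔ ∃ l ∈ T, x ∈ l.premises := by
  simp [prem]

/-- Every switching of the links, together with further hyperedges, is a forest. -/
def Correct (T : List Link) (Es : List (Set Edge)) : Prop :=
  ∀ h : Link → Set Edge, (∀ l ∈ T, l.Sw (h l)) → Forest (T.map h ++ Es)

/-- A correct graph of links (with further hyperedges) in which the edges `I` are inputs and the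
edges `O` are outputs. -/
structure IsModule (T : List Link) (Es : List (Set Edge)) (I O : Multiset Edge) : Prop where
  nodup : (conc T + I).Nodup
  bal : conc T + I = prem T + O
  loopless : ∀ l ∈ T, ∀ x ∈ l.premises, x ∉ l.conclusions
  correct : Correct T Es

theorem Correct.perm {T T' : List Link} {Es : List (Set Edge)} (h : T.Perm T')
    (hc : Correct T Es) : Correct T' Es := fun k hk =>
  (hc k fun l hl => hk l (h.mem_iff.1 hl)).perm ((h.map k).append_right _)

theorem IsModule.perm {T T' : List Link} {Es : List (Set Edge)} {I O : Multiset Edge}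
    (h : T.Perm T') (hT : IsModule T Es I O) : IsModule T' Es I O :=
  ⟨by rw [← conc_perm h]; exact hT.nodup, by rw [← conc_perm h, ← prem_perm h]; exact hT.bal,
    fun l hl => hT.loopless l (h.mem_iff.2 hl), hT.correct.perm h⟩

theorem eq_of_mem_conclusions {T : List Link} (hT : (conc T).Nodup) {l l' : Link} {x : Edge}
    (hl : l ∈ T) (hl' : l' ∈ T) (hx : x ∈ l.conclusions) (hx' : x ∈ l'.conclusions) : l = l' := by
  have h1 := (List.nodup_flatMap.1 (Multiset.coe_nodup.1 hT)).2
  by_contra hne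
  have : Std.Symm (Function.onFun List.Disjoint Link.conclusions) := ⟨fun _ _ h => List.Disjoint.symm h⟩
  exact (h1.forall hl hl' hne) hx hx'

theorem eq_of_mem_premises {T : List Link} (hT : (prem T).Nodup) {l l' : Link} {x : Edge}
    (hl : l ∈ T) (hl' : l' ∈ T) (hx : x ∈ l.premises) (hx' : x ∈ l'.premises) : l = l' := by
  have h1 := (List.nodup_flatMap.1 (Multiset.coe_nodup.1 hT)).2
  by_contra hne
  have : Std.Symm (Function.onFun List.Disjoint Link.premises) := ⟨fun _ _ h => List.Disjoint.symm h⟩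
  exact (h1.forall hl hl' hne) hx hx'

/-- Every link has at least one incident edge, and a repeated link would repeat it. -/
theorem nodup_of_conc_prem {T : List Link} (hc : (conc T).Nodup) (hp : (prem T).Nodup) :
    T.Nodup := by
  have h1 := (List.nodup_flatMap.1 (Multiset.coe_nodup.1 hc)).2
  have h2 := (List.nodup_flatMap.1 (Multiset.coe_nodup.1 hp)).2
  refine (h1.and h2).imp ?_
  rintro l l' ⟨h, h'⟩ rfl
  have hc : l.conclusions = [] := List.eq_nil_iff_forall_not_mem.2 fun x hx => h hx hx
  have hp : l.premises = [] := List.eq_nil_iff_forall_not_mem.2 fun x hx => h' hx hx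
  cases l <;> simp [Link.conclusions, Link.premises] at hc hp

namespace IsModule

variable {T : List Link} {Es : List (Set Edge)} {I O : Multiset Edge}

theorem nodup_conc (h : IsModule T Es I O) : (conc T).Nodup :=
  Multiset.nodup_of_le (Multiset.le_add_right _ _) h.nodup

theorem nodup_prem_add (h : IsModule T Es I O) : (prem T + O).Nodup := by
  rw [← h.bal]; exact h.nodup

theorem nodup_prem (h : IsModule T Es I O) : (prem T).Nodup :=
  Multiset.nodup_of_le (Multiset.le_add_right _ _) h.nodup_prem_add

theorem nodup_links (h : IsModule T Es I O) : T.Nodup :=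
  nodup_of_conc_prem h.nodup_conc h.nodup_prem

end IsModule

/-- The conclusions of a structure, logical and structural. -/
def Struct.outputs (S : Struct) : Multiset Edge :=
  (S.concl.map Edge.logical ++ S.aux.map Edge.structural : List Edge)

namespace Struct

/-- `♭`-nets, in terms of forests. -/
inductive Good : Struct → Prop
  | intro (S : Struct) (isModule : IsModule S.links [] 0 S.outputs)
      (boxes : ∀ c L m aux, Link.bang c L m aux ∈ S.links → Good ⟨L, [m], aux⟩) : Good S

theorem Good.isModule {S : Struct} (h : S.Good) : IsModule S.links [] 0 S.outputs := by
  cases h; assumption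

theorem Good.boxes {S : Struct} (h : S.Good) {c L m aux} (hl : Link.bang c L m aux ∈ S.links) :
    Good ⟨L, [m], aux⟩ := by
  cases h with
  | intro _ _ hb => exact hb c L m aux hl

-- Acyclic switching graphs and forests

theorem switchingGraph_adj {S : Struct} {φ : Link → Edge} {l : Link} {x : Edge} :
    (S.switchingGraph φ).Adj (.inl l) (.inr x) ↔
      l ∈ S.links ∧ (x ∈ l.conclusions ∨ x ∈ l.keptPremises φ) := by
  simp [switchingGraph, SimpleGraph.fromRel_adj]

theorem not_switchingGraph_adj_inl {S : Struct} {φ : Link → Edge} {l l' : Link} :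
    ¬ (S.switchingGraph φ).Adj (.inl l) (.inl l') := by
  simp [switchingGraph, SimpleGraph.fromRel_adj]

theorem not_switchingGraph_adj_inr {S : Struct} {φ : Link → Edge} {x x' : Edge} :
    ¬ (S.switchingGraph φ).Adj (.inr x) (.inr x') := by
  simp [switchingGraph, SimpleGraph.fromRel_adj]

/-- In an acyclic graph every edge is a bridge. If two points of `h l` were connected by the other
hyperedges, the edge from `l` to one of them could be bypassed through the other. -/
theorem forest_of_isAcyclic {G : SimpleGraph (Link ⊕ Edge)} (hG : G.IsAcyclic)
    {h : Link → Set Edge} {T : List Link} (hT : T.Nodup)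
    (hadj : ∀ l ∈ T, ∀ x ∈ h l, G.Adj (.inl l) (.inr x)) : Forest (T.map h) := by
  induction T with
  | nil => trivial
  | cons l T ih =>
    rw [List.nodup_cons] at hT
    rw [List.map_cons, forest_cons]
    refine ⟨ih hT.2 fun l' hl' => hadj l' (by simp [hl']), fun x hx y hy hxy hc => ?_⟩
    have hb := SimpleGraph.isAcyclic_iff_forall_adj_isBridge.1 hG (hadj l (by simp) x hx)
    rw [SimpleGraph.isBridge_iff] at hb
    set G' := G.deleteEdges {s(Sum.inl l, Sum.inr x)} with hG'
    have hadj' : ∀ l' z, G.Adj (.inl l') (.inr z) → (l' ≠ l ∨ z ≠ x) →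
        G'.Adj (.inl l') (.inr z) := by
      intro l' z h1 h2
      rw [hG', SimpleGraph.deleteEdges_adj]
      refine ⟨h1, fun h3 => ?_⟩
      simp only [Set.mem_singleton_iff, Sym2.eq_iff, Sum.inl.injEq, Sum.inr.injEq, reduceCtorEq,
        and_false, or_false] at h3
      rcases h2 with h2 | h2
      · exact h2 h3.1
      · exact h2 h3.2
    have hr : G'.Reachable (.inr x) (.inr y) := by
      refine hc.induction (r := fun a b => G'.Reachable (.inr a) (.inr b))
        ⟨fun _ => .refl _, fun h => h.symm, fun h h' => h.trans h'⟩ ?_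
      intro H hH a ha b hb'
      obtain ⟨l', hl', rfl⟩ := List.mem_map.1 hH
      have hne : l' ≠ l := by rintro rfl; exact hT.1 hl'
      exact (hadj' l' a (hadj l' (by simp [hl']) a ha) (.inl hne)).reachable.symm.trans
        (hadj' l' b (hadj l' (by simp [hl']) b hb') (.inl hne)).reachable
    have h2 := hadj' l y (hadj l (by simp) y hy) (.inr hxy.symm)
    exact hb (h2.reachable.trans hr.symm)

theorem correct_of_isAcyclic {S : Struct} (hS : S.links.Nodup)
    (h : ∀ φ, S.IsSwitching φ → (S.switchingGraph φ).IsAcyclic) : Correct S.links [] := by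
  classical
  intro k hk
  rw [List.append_nil]
  -- The switching follows `k` wherever `k l` keeps a premise. Otherwise any premise will do, and
  -- the default `.logical 0` serves only links without premises, where the choice is not used.
  let φ : Link → Edge := fun l =>
    if h : ∃ x ∈ l.premises, x ∈ k l then h.choose else l.premises.headD (.logical 0)
  have hφ : ∀ l ∈ S.links, ∀ x ∈ l.premises, x ∈ k l → l.Exclusive → φ l = x := by
    intro l hl x hx hxk he
    have hex : ∃ x ∈ l.premises, x ∈ k l := ⟨x, hx, hxk⟩
    have : φ l = hex.choose := dif_pos hex
    rw [this]
    exact (hk l hl).2 he _ hex.choose_spec.1 _ hx hex.choose_spec.2 hxk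
  refine forest_of_isAcyclic (h φ ?_) hS ?_
  · intro l _ hne
    by_cases hex : ∃ x ∈ l.premises, x ∈ k l
    · rw [show φ l = hex.choose from dif_pos hex]; exact hex.choose_spec.1
    · rw [show φ l = l.premises.headD (.logical 0) from dif_neg hex]
      cases hp : l.premises with
      | nil => exact absurd hp hne
      | cons a t => simp
  · intro l hl x hx
    rw [switchingGraph_adj]
    refine ⟨hl, ?_⟩
    rcases (hk l hl).1 x hx with hp | hc
    · refine .inr ?_
      have := hφ l hl x hp hx
      cases l with
      | par a b c => simp [Link.keptPremises, this trivial]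
      | why ps c =>
        cases ps with
        | nil => simp [Link.premises] at hp
        | cons p ps => simp [Link.keptPremises, this trivial]
      | _ => exact hp
    · exact .inl hc

/-- Every edge is shown to be a bridge: what is reachable from `l` after deletion of the edge from
`l` to `x` is connected, by the other hyperedges, to a point of `k l` other than `x`. In a forest
`x` is not of this kind. -/
theorem isAcyclic_of_correct {S : Struct} (h : Correct S.links [])
    (hl : ∀ l ∈ S.links, ∀ x ∈ l.premises, x ∉ l.conclusions)
    (φ : Link → Edge) (hφ : S.IsSwitching φ) : (S.switchingGraph φ).IsAcyclic := by
  let k : Link → Set Edge := fun l => {x | x ∈ l.conclusions ∨ x ∈ l.keptPremises φ}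
  have hk : ∀ l ∈ S.links, l.Sw (k l) := by
    intro l hlS
    have hkept : ∀ x ∈ l.keptPremises φ, x ∈ l.premises := by
      have := hφ l hlS
      intro x hx
      cases l with
      | par a b c =>
        simp only [Link.keptPremises, List.mem_singleton] at hx
        rw [hx]; exact this (by simp [Link.premises])
      | why ps c =>
        cases ps with
        | nil => exact hx
        | cons p ps =>
          simp only [Link.keptPremises, List.mem_singleton] at hx
          rw [hx]; exact this (by simp [Link.premises])
      | _ => exact hx
    refine ⟨fun x hx => hx.elim .inr fun h => .inl (hkept x h), fun he x hx y hy hx' hy' => ?_⟩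
    replace hx' := hx'.resolve_left (hl l hlS x hx)
    replace hy' := hy'.resolve_left (hl l hlS y hy)
    cases l with
    | par a b c =>
      simp only [Link.keptPremises, List.mem_singleton] at hx' hy'
      rw [hx', hy']
    | why ps c =>
      cases ps with
      | nil => simp [Link.premises] at hx
      | cons p ps =>
        simp only [Link.keptPremises, List.mem_singleton] at hx' hy'
        rw [hx', hy']
    | _ => exact he.elim
  have hf := h k hk
  rw [List.append_nil] at hf
  rw [SimpleGraph.isAcyclic_iff_forall_adj_isBridge]
  suffices key : ∀ l x, (S.switchingGraph φ).Adj (.inl l) (.inr x) →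
      (S.switchingGraph φ).IsBridge s(.inl l, .inr x) by
    intro v w hvw
    match v, w, hvw with
    | .inl l, .inr x, hvw => exact key l x hvw
    | .inr x, .inl l, hvw => rw [Sym2.eq_swap]; exact key l x hvw.symm
    | .inl _, .inl _, hvw => exact absurd hvw not_switchingGraph_adj_inl
    | .inr _, .inr _, hvw => exact absurd hvw not_switchingGraph_adj_inr
  intro l x hlx
  rw [SimpleGraph.isBridge_iff]
  set G := S.switchingGraph φ with hG
  set G' := G.deleteEdges {s(Sum.inl l, Sum.inr x)} with hG'
  have hlS := (switchingGraph_adj.1 hlx).1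
  obtain ⟨T, hT⟩ : ∃ T, S.links.Perm (l :: T) := by
    classical
    exact ⟨_, List.perm_cons_erase hlS⟩
  have hf' := hf.perm (hT.map k)
  rw [List.map_cons, forest_cons] at hf'
  -- An invariant of walks from `l` that avoid the deleted edge. A link other than `l` satisfies it
  -- when all the edges it keeps do, with a common starting point `z`.
  let P : Link ⊕ Edge → Prop := fun v => match v with
    | .inr y => ∃ z ∈ k l, z ≠ x ∧ Conn (T.map k) z y
    | .inl l' => l' = l ∨ ∃ z ∈ k l, z ≠ x ∧ ∀ y ∈ k l', Conn (T.map k) z y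
  have hadj : ∀ l' y, G'.Adj (.inl l') (.inr y) →
      l' ∈ S.links ∧ y ∈ k l' ∧ (l' = l → y ≠ x) := by
    intro l' y h'
    rw [hG', SimpleGraph.deleteEdges_adj] at h'
    have h1 := switchingGraph_adj.1 h'.1
    refine ⟨h1.1, h1.2, ?_⟩
    rintro rfl rfl
    exact h'.2 rfl
  have hstep : ∀ v w, G'.Adj v w → P v → P w := by
    intro v w hvw hv
    match v, w, hvw, hv with
    | .inl l', .inr y, hvw, hv =>
      obtain ⟨h1, h2, h3⟩ := hadj l' y hvw
      rcases hv with rfl | ⟨z, hz, hzx, hc⟩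
      · exact ⟨y, h2, h3 rfl, .refl _ _⟩
      · exact ⟨z, hz, hzx, hc y h2⟩
    | .inr y, .inl l', hvw, hv =>
      obtain ⟨h1, h2, h3⟩ := hadj l' y hvw.symm
      obtain ⟨z, hz, hzx, hc⟩ := hv
      by_cases hl' : l' = l
      · exact .inl hl'
      · refine .inr ⟨z, hz, hzx, fun y' hy' => hc.trans (Conn.of_mem ?_ h2 hy')⟩
        exact List.mem_map_of_mem ((List.mem_cons.1 (hT.mem_iff.1 h1)).resolve_left hl')
    | .inl _, .inl _, hvw, _ => exact absurd hvw.1 not_switchingGraph_adj_inl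
    | .inr _, .inr _, hvw, _ => exact absurd hvw.1 not_switchingGraph_adj_inr
  rintro ⟨p⟩
  have : ∀ v w, G'.Walk v w → P v → P w := by
    intro v w p
    induction p with
    | nil => exact id
    | cons h _ ih => exact fun hv => ih (hstep _ _ h hv)
  obtain ⟨z, hz, hzx, hc⟩ := this _ _ p (.inl rfl)
  exact hf'.2 z hz x (switchingGraph_adj.1 hlx).2 hzx hc

end Struct

/-- Only axioms and `!`-links can have several conclusions, and they have no premises. -/
theorem Link.eq_of_mem_conclusions {l : Link} {x y z : Edge} (hx : x ∈ l.premises)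
    (hy : y ∈ l.conclusions) (hz : z ∈ l.conclusions) : y = z := by
  cases l <;> simp_all [Link.premises, Link.conclusions]

namespace Struct

/-- A directed cycle enters each link by one premise only, hence survives in a switching. To get a
simple cycle, a predecessor lying on a cycle is chosen for every edge that lies on one; by
finiteness the map so defined has a periodic point, whose orbit closes up in the switching. -/
theorem acyclic_of_isModule {S : Struct} {I O : Multiset Edge} (h : IsModule S.links [] I O)
    (a : Edge) : ¬ Relation.TransGen S.Above a a := by
  classical
  intro ha
  have hpred : ∀ b, Relation.TransGen S.Above b b →
      ∃ a, Relation.TransGen S.Above a a ∧ S.Above a b := by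
    intro b hb
    obtain ⟨a, h1, h2⟩ := Relation.TransGen.tail'_iff.1 hb
    exact ⟨a, Relation.TransGen.head'_iff.2 ⟨b, h2, h1⟩, h2⟩
  choose! pred hpred using hpred
  let X : Set Edge := {b | Relation.TransGen S.Above b b}
  have hX : X.Finite := by
    refine Set.Finite.subset (Multiset.finite_toSet (prem S.links)) fun b hb => ?_
    obtain ⟨c, ⟨l, hl, hb', _⟩, _⟩ := Relation.TransGen.head'_iff.1 hb
    exact mem_prem.2 ⟨l, hl, hb'⟩
  have hit : ∀ i b, b ∈ X → pred^[i] b ∈ X := by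
    intro i
    induction i with
    | zero => exact fun b hb => hb
    | succ i ih => exact fun b hb => ih _ (hpred b hb).1
  obtain ⟨b, hb, hper⟩ : ∃ b ∈ X, b ∈ Function.periodicPts pred := by
    have := hX.to_subtype
    obtain ⟨i, j, hij, he⟩ := Finite.exists_ne_map_eq_of_infinite
      fun i : ℕ => (⟨pred^[i] a, hit i a ha⟩ : X)
    replace he : pred^[i] a = pred^[j] a := congrArg Subtype.val he
    wlog hlt : i < j generalizing i j
    · exact this j i hij.symm he.symm (by omega)
    refine ⟨_, hit i a ha, Function.mk_mem_periodicPts (n := j - i) (by omega) ?_⟩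
    rw [Function.IsPeriodicPt, Function.IsFixedPt, ← Function.iterate_add_apply, he]
    congr 1; omega
  -- Every link keeps a conclusion together with its chosen predecessor. This respects exclusive
  -- links, because a link with premises has a single conclusion.
  let k : Link → Set Edge := fun l =>
    {x | ∃ c ∈ l.conclusions, pred c ∈ l.premises ∧ (x = c ∨ x = pred c)}
  have hk : ∀ l ∈ S.links, l.Sw (k l) := by
    intro l hl
    refine ⟨?_, fun _ x hx y hy hx' hy' => ?_⟩
    · rintro x ⟨c, hc, hp, rfl | rfl⟩
      · exact .inr hc
      · exact .inl hp
    · obtain ⟨c, hc, hp, rfl | rfl⟩ := hx'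
      · exact absurd hc (h.loopless l hl _ hx)
      · obtain ⟨c', hc', _, rfl | rfl⟩ := hy'
        · exact absurd hc' (h.loopless l hl _ hy)
        · rw [Link.eq_of_mem_conclusions hp hc hc']
  have hf := h.correct k hk
  rw [List.append_nil] at hf
  obtain ⟨l, hl, hp, hc⟩ := (hpred b hb).2
  obtain ⟨T, hT⟩ : ∃ T, S.links.Perm (l :: T) := ⟨_, List.perm_cons_erase hl⟩
  replace hf := hf.perm (hT.map k)
  rw [List.map_cons, forest_cons] at hf
  refine hf.2 (pred b) ⟨b, hc, hp, .inr rfl⟩ b ⟨b, hc, hp, .inl rfl⟩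
    (fun h' => h.loopless l hl _ hp (by rw [h']; exact hc)) ?_
  have hmin := Function.minimalPeriod_pos_of_mem_periodicPts hper
  -- The orbit from `pred b` back to `b` avoids the link `l` above `b`: meeting `l` again would mean
  -- a return to `b` before the minimal period.
  have key : ∀ i, i < Function.minimalPeriod pred b →
      Conn (T.map k) (pred b) (pred^[i + 1] b) := by
    intro i
    induction i with
    | zero => exact fun _ => .refl _ _
    | succ i ih =>
      intro hi
      refine (ih (by omega)).trans ?_
      obtain ⟨l', hl', hp', hc'⟩ := (hpred _ (hit (i + 1) b hb)).2
      have hne : l' ≠ l := by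
        rintro rfl
        refine Function.not_isPeriodicPt_of_pos_of_lt_minimalPeriod (n := i + 1) (by omega) hi ?_
        exact (Link.eq_of_mem_conclusions hp hc' hc : pred^[i + 1] b = b)
      rw [Function.iterate_succ_apply' pred (i + 1)]
      exact Conn.of_mem (List.mem_map_of_mem ((List.mem_cons.1 (hT.mem_iff.1 hl')).resolve_left hne))
        ⟨_, hc', hp', .inl rfl⟩ ⟨_, hc', hp', .inr rfl⟩
  have := key (Function.minimalPeriod pred b - 1) (by omega)
  rwa [Nat.sub_add_cancel hmin, Function.iterate_minimalPeriod] at this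

theorem good_of_isFlatNet {S : Struct} (h : S.IsFlatNet) : S.Good := by
  induction h with
  | intro S ground switching boxes ih =>
    refine ⟨S, ?_, ih⟩
    have hbal : conc S.links = prem S.links + S.outputs := by
      have := Multiset.coe_eq_coe.2 ground.perm
      rwa [← Multiset.coe_add] at this
    have hn : (conc S.links).Nodup := Multiset.coe_nodup.2 ground.nodup
    have hp : (prem S.links).Nodup :=
      Multiset.nodup_of_le (by rw [hbal]; exact Multiset.le_add_right _ _) hn
    refine ⟨by simpa using hn, by simpa using hbal, ?_,
      correct_of_isAcyclic (nodup_of_conc_prem hn hp) switching⟩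
    exact fun l hl x hx hx' => ground.acyclic x (.single ⟨l, hl, hx, hx'⟩)

theorem Good.isFlatNet {S : Struct} (h : S.Good) : S.IsFlatNet := by
  induction h with
  | intro S hm boxes ih =>
    refine ⟨S, ⟨?_, ?_, acyclic_of_isModule hm⟩,
      isAcyclic_of_correct hm.correct hm.loopless, ih⟩
    · exact Multiset.coe_nodup.1 hm.nodup_conc
    · have := hm.bal
      rw [add_zero] at this
      rw [← Multiset.coe_eq_coe, ← Multiset.coe_add]
      exact this

end Struct

/-! ### Names and renaming -/

/-- Induction on the nesting of boxes, which replaces the recursor of the nested inductive type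
`Link`. -/
theorem links_induction {P : List Link → Prop}
    (h : ∀ T, (∀ c L m aux, Link.bang c L m aux ∈ T → P L) → P T) (T : List Link) : P T := by
  induction hn : sizeOf T using Nat.strong_induction_on generalizing T with
  | _ n ih =>
    refine h T fun c L m aux hl => ih _ ?_ L rfl
    have := List.sizeOf_lt_of_mem hl
    simp only [Link.bang.sizeOf_spec] at this
    omega

namespace Edge

/-- The name of an edge. -/
def name : Edge → ℕ
  | logical n => n
  | structural n => n

/-- Rename an edge. -/
def map (f : ℕ → ℕ) : Edge → Edge
  | logical n => logical (f n)
  | structural n => structural (f n)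

@[simp] theorem name_map (f : ℕ → ℕ) (x : Edge) : (x.map f).name = f x.name := by
  cases x <;> rfl

theorem map_leftInverse {g f : ℕ → ℕ} (h : Function.LeftInverse g f) :
    Function.LeftInverse (map g) (map f) := by
  intro x
  cases x <;> simp [map, h _]

theorem map_injective {f : ℕ → ℕ} (h : Function.Injective f) : Function.Injective (map f) :=
  (map_leftInverse (Function.leftInverse_invFun h)).injective

end Edge

namespace Link

/-- All names in a link, at every depth. -/
def names : Link → List ℕ
  | .ax a b => [a, b]
  | .cut a b => [a, b]
  | .tens a b c => [a, b, c]
  | .par a b c => [a, b, c]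
  | .one c => [c]
  | .bot c => [c]
  | .flat a s => [a, s]
  | .why ps c => c :: ps
  | .bang c L m aux => c :: m :: (aux ++ L.flatMap fun l => l.names)

theorem name_mem_names {l : Link} {x : Edge} (h : x ∈ l.premises ∨ x ∈ l.conclusions) :
    x.name ∈ l.names := by
  cases l <;> simp only [premises, conclusions, List.mem_cons, List.mem_map, List.not_mem_nil,
    or_false, false_or] at h <;> simp only [names]
  case why => rcases h with ⟨a, h, rfl⟩ | rfl <;> simp [Edge.name, *]
  case bang => rcases h with rfl | ⟨a, h, rfl⟩ <;> simp [Edge.name, *]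
  all_goals (rcases h with h | h | h) <;> simp [Edge.name, *]
  all_goals (rcases h with h | h) <;> simp [*]

theorem premises_rename (f : ℕ → ℕ) (l : Link) :
    (l.rename f).premises = l.premises.map (Edge.map f) := by
  cases l <;> simp [rename, premises, Edge.map, Function.comp_def]

theorem conclusions_rename (f : ℕ → ℕ) (l : Link) :
    (l.rename f).conclusions = l.conclusions.map (Edge.map f) := by
  cases l <;> simp [rename, conclusions, Edge.map, Function.comp_def]

theorem exclusive_rename (f : ℕ → ℕ) (l : Link) : (l.rename f).Exclusive ↔ l.Exclusive := by
  cases l <;> simp [rename, Exclusive]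

theorem names_rename_list (f : ℕ → ℕ) (T : List Link) :
    ∀ l ∈ T, (l.rename f).names = l.names.map f := by
  induction T using links_induction with
  | h T ih =>
    intro l hl
    cases l with
    | bang c L m aux =>
      have := ih c L m aux hl
      simp only [rename, names, List.map_cons, List.map_append, List.map_flatMap, List.flatMap_map]
      congr 3
      exact List.flatMap_congr this
    | _ => simp [rename, names]

theorem names_rename (f : ℕ → ℕ) (l : Link) : (l.rename f).names = l.names.map f :=
  names_rename_list f [l] l (by simp)

end Link

theorem conc_rename (f : ℕ → ℕ) (T : List Link) :
    conc (T.map (Link.rename f)) = (conc T).map (Edge.map f) := by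
  induction T with
  | nil => rfl
  | cons l T ih => simp [ih, Link.conclusions_rename]

theorem prem_rename (f : ℕ → ℕ) (T : List Link) :
    prem (T.map (Link.rename f)) = (prem T).map (Edge.map f) := by
  induction T with
  | nil => rfl
  | cons l T ih => simp [ih, Link.premises_rename]

/-- A switching of the renamed links is pulled back along a left inverse of `f`, which is injective
on the edges that occur. -/
theorem IsModule.rename {T : List Link} {I O : Multiset Edge} {f : ℕ → ℕ}
    (hf : Function.Injective f) (h : IsModule T [] I O) :
    IsModule (T.map (Link.rename f)) [] (I.map (Edge.map f)) (O.map (Edge.map f)) := by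
  refine ⟨?_, ?_, ?_, fun k hk => ?_⟩
  · rw [conc_rename, ← Multiset.map_add]
    exact h.nodup.map (Edge.map_injective hf)
  · rw [conc_rename, prem_rename, ← Multiset.map_add, ← Multiset.map_add, h.bal]
  · rintro l' hl' x hx hx'
    obtain ⟨l, hl, rfl⟩ := List.mem_map.1 hl'
    rw [Link.premises_rename] at hx
    rw [Link.conclusions_rename] at hx'
    obtain ⟨y, hy, rfl⟩ := List.mem_map.1 hx
    obtain ⟨z, hz, he⟩ := List.mem_map.1 hx'
    exact h.loopless l hl y hy (Edge.map_injective hf he ▸ hz)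
  · have hg := Edge.map_leftInverse (Function.leftInverse_invFun hf)
    set g := Edge.map (Function.invFun f) with hgdef
    have hmem : ∀ l ∈ T, ∀ x ∈ k (l.rename f), x = (g x).map f ∧
        ((g x) ∈ l.premises ∧ x ∈ (l.rename f).premises ∨
          (g x) ∈ l.conclusions ∧ x ∈ (l.rename f).conclusions) := by
      intro l hl x hx
      have := (hk _ (List.mem_map_of_mem hl)).1 x hx
      rw [Link.premises_rename, Link.conclusions_rename] at this
      rcases this with hp | hp <;> obtain ⟨y, hy, rfl⟩ := List.mem_map.1 hp
      · rw [hg y, Link.premises_rename]; exact ⟨rfl, .inl ⟨hy, hp⟩⟩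
      · rw [hg y, Link.conclusions_rename]; exact ⟨rfl, .inr ⟨hy, hp⟩⟩
    have hf' := h.correct (fun l => g '' k (l.rename f)) fun l hl => by
      refine ⟨?_, ?_⟩
      · rintro _ ⟨x, hx, rfl⟩
        exact (hmem l hl x hx).2.imp And.left And.left
      · rintro he _ h1 _ h2 ⟨x, hx, rfl⟩ ⟨y, hy, rfl⟩
        have hx' := (hmem l hl x hx).2.resolve_right fun h' => h.loopless l hl _ h1 h'.1
        have hy' := (hmem l hl y hy).2.resolve_right fun h' => h.loopless l hl _ h2 h'.1
        rw [(hk _ (List.mem_map_of_mem hl)).2 ((Link.exclusive_rename f l).2 he) x hx'.2 y hy'.2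
          hx hy]
    rw [List.append_nil] at hf' ⊢
    refine Forest.of_image (ρ := g) ?_ (by
      rw [List.map_map, List.map_map]; exact hf')
    rintro x ⟨H, hH, hx⟩ y ⟨H', hH', hy⟩ he
    simp only [List.map_map, List.mem_map, Function.comp] at hH hH'
    obtain ⟨l, hl, rfl⟩ := hH
    obtain ⟨l', hl', rfl⟩ := hH'
    rw [(hmem l hl x hx).1, (hmem l' hl' y hy).1, he]

namespace Struct

theorem outputs_map (T : List Link) (C aux : List ℕ) (f : ℕ → ℕ) (T' : List Link) :
    outputs ⟨T', C.map f, aux.map f⟩ = (outputs ⟨T, C, aux⟩).map (Edge.map f) := by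
  simp [outputs, Edge.map, Function.comp_def]

theorem Good.rename {f : ℕ → ℕ} (hf : Function.Injective f) {S : Struct} (h : S.Good) :
    Good ⟨S.links.map (Link.rename f), S.concl.map f, S.aux.map f⟩ := by
  induction h with
  | intro S hm boxes ih =>
    refine ⟨_, ?_, ?_⟩
    · rw [outputs_map S.links]
      simpa using hm.rename hf
    · intro c L m aux hl
      obtain ⟨l, hl', he⟩ := List.mem_map.1 hl
      cases l <;> simp only [Link.rename, Link.bang.injEq, reduceCtorEq] at he
      obtain ⟨rfl, rfl, rfl, rfl⟩ := he
      exact ih _ _ _ _ hl'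

end Struct

/-! ### Grafting a box -/

namespace Link

theorem graft_eq_self {p : ℕ} {K : List Link} {m : ℕ} {xs : List ℕ} {l : Link}
    (h : Edge.structural p ∉ l.conclusions) : l.graft p K m xs = [l] := by
  cases l with
  | flat a s =>
    have : s ≠ p := by rintro rfl; simp [conclusions] at h
    simp [graft, this]
  | bang c L n aux =>
    have hp : p ∉ aux := by simpa [conclusions] using h
    have : aux.flatMap (fun s => if s = p then xs else [s]) = aux := by
      have : aux.flatMap (fun s => if s = p then xs else [s]) = aux.flatMap fun s => [s] :=
        List.flatMap_congr fun s hs => by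
          rw [if_neg]; rintro rfl; exact hp hs
      rw [this]; simp
    simp [graft, hp, this]
  | _ => simp [graft]

theorem names_graft_list (p : ℕ) (K : List Link) (m : ℕ) (xs : List ℕ) (T : List Link) :
    ∀ l ∈ T, ∀ l' ∈ l.graft p K m xs, ∀ n ∈ l'.names,
      n ∈ l.names ∨ n = m ∨ n ∈ xs ∨ ∃ k ∈ K, n ∈ k.names := by
  induction T using links_induction with
  | h T ih =>
    intro l hl l' hl' n hn
    by_cases hp : Edge.structural p ∈ l.conclusions
    · cases l with
      | flat a s =>
        obtain rfl : s = p := by simpa [conclusions, eq_comm] using hp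
        simp only [graft, if_true, List.mem_cons] at hl'
        rcases hl' with rfl | hl'
        · simp only [names, List.mem_cons, List.not_mem_nil, or_false] at hn ⊢
          tauto
        · exact .inr (.inr (.inr ⟨l', hl', hn⟩))
      | bang c L b aux =>
        have hp : p ∈ aux := by simpa [conclusions] using hp
        simp only [graft, if_pos hp, List.mem_singleton] at hl'
        subst hl'
        simp only [names, List.mem_cons, List.mem_append, List.mem_flatMap] at hn ⊢
        rcases hn with rfl | rfl | ⟨s, hs, hn⟩ | ⟨l1, ⟨l2, h2, h1⟩, hn⟩
        · simp
        · simp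
        · split_ifs at hn with h
          · exact .inr (.inr (.inl hn))
          · obtain rfl : n = s := by simpa using hn
            simp [hs]
        · have := ih _ _ _ _ hl l2 h2 l1 h1 n hn
          rcases this with h | h
          · exact .inl (.inr (.inr (.inr ⟨l2, h2, h⟩)))
          · exact .inr h
      | _ => simp [conclusions] at hp
    · rw [graft_eq_self hp, List.mem_singleton] at hl'
      exact .inl (hl' ▸ hn)

end Link

theorem flatMap_graft_eq_self {p : ℕ} {K : List Link} {m : ℕ} {xs : List ℕ} {T : List Link}
    (h : Edge.structural p ∉ conc T) : T.flatMap (Link.graft p K m xs) = T := by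
  have : T.flatMap (Link.graft p K m xs) = T.flatMap fun l => [l] :=
    List.flatMap_congr fun l hl => Link.graft_eq_self fun hx => h (mem_conc.2 ⟨l, hl, hx⟩)
  rw [this]; simp

/-- Only the link with conclusion `p` is affected by a graft at `p`. -/
theorem exists_perm_graft {p : ℕ} {T : List Link} (hT : (conc T).Nodup)
    (hp : Edge.structural p ∈ conc T) : ∃ l T₀, T.Perm (l :: T₀) ∧
      Edge.structural p ∈ l.conclusions ∧ Edge.structural p ∉ conc T₀ ∧
      ∀ K m xs, (T.flatMap (Link.graft p K m xs)).Perm (l.graft p K m xs ++ T₀) := by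
  obtain ⟨l, hl, hpl⟩ := mem_conc.1 hp
  obtain ⟨T₀, h0⟩ : ∃ T₀, T.Perm (l :: T₀) := by
    classical exact ⟨_, List.perm_cons_erase hl⟩
  have hn : Edge.structural p ∉ conc T₀ := by
    rw [conc_perm h0, conc_cons, Multiset.nodup_add] at hT
    exact fun h' => Multiset.disjoint_left.1 hT.2.2 hpl h'
  refine ⟨l, T₀, h0, hpl, hn, fun K m xs => ?_⟩
  refine (h0.flatMap_right _).trans ?_
  rw [List.flatMap_cons, flatMap_graft_eq_self hn]

/-- The structural edges named by a list. -/
def strs (xs : List ℕ) : Multiset Edge := (xs.map Edge.structural : List Edge)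

@[simp] theorem mem_strs {xs : List ℕ} {x : Edge} :
    x ∈ strs xs ↔ ∃ n ∈ xs, Edge.structural n = x := by simp [strs]

theorem strs_append (xs ys : List ℕ) : strs (xs ++ ys) = strs xs + strs ys := by simp [strs]

theorem strs_cons (x : ℕ) (ys : List ℕ) : strs (x :: ys) = {Edge.structural x} + strs ys := by
  simp [strs]

theorem Struct.outputs_box (L : List Link) (m : ℕ) (xs : List ℕ) :
    Struct.outputs ⟨L, [m], xs⟩ = {Edge.logical m} + strs xs := by
  simp [Struct.outputs, strs]

/-- The list of links with edges in `N` interferes with `T` at `xs` only. -/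
structure FreshFor (N : Set ℕ) (xs : List ℕ) (T : List Link) : Prop where
  edge : ∀ l ∈ T, ∀ x, x ∈ l.premises ∨ x ∈ l.conclusions → x.name ∈ N → x ∈ strs xs
  box : ∀ c L m aux, Link.bang c L m aux ∈ T → ∀ l ∈ L, ∀ n ∈ l.names, n ∉ N

theorem FreshFor.of_names {N : Set ℕ} {xs : List ℕ} {T : List Link}
    (h : ∀ l ∈ T, ∀ n ∈ l.names, n ∉ N) : FreshFor N xs T := by
  refine ⟨fun l hl x hx hN => absurd hN (h l hl _ (Link.name_mem_names hx)), ?_⟩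
  intro c L m aux hl l hl' n hn
  refine h _ hl n ?_
  simp only [Link.names, List.mem_cons, List.mem_append, List.mem_flatMap]
  exact .inr (.inr (.inr ⟨l, hl', hn⟩))

/-- Grafting one copy leaves room for the others: the new names all lie in `N`, so nothing new meets
the reserved set `N'`. -/
theorem FreshFor.graft {N N' : Set ℕ} {xs' : List ℕ} {T : List Link} (h : FreshFor N' xs' T)
    {p : ℕ} {K : List Link} {m : ℕ} {xs : List ℕ} (hN : Disjoint N N')
    (hK : ∀ l ∈ K, ∀ n ∈ l.names, n ∈ N) (hm : m ∈ N) (hxs : ∀ x ∈ xs, x ∈ N) :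
    FreshFor N' xs' (T.flatMap (Link.graft p K m xs)) := by
  have hK' : ∀ l ∈ K, ∀ n ∈ l.names, n ∉ N' := fun l hl n hn =>
    Set.disjoint_left.1 hN (hK l hl n hn)
  constructor
  · intro l' hl' x hx hxN
    obtain ⟨l, hl, hl'⟩ := List.mem_flatMap.1 hl'
    by_cases hp : Edge.structural p ∈ l.conclusions
    · cases l with
      | flat a s =>
        obtain rfl : s = p := by simpa [Link.conclusions, eq_comm] using hp
        simp only [Link.graft, if_true, List.mem_cons] at hl'
        rcases hl' with rfl | hl'
        · simp only [Link.premises, Link.conclusions, List.mem_cons, List.not_mem_nil,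
            or_false] at hx
          rcases hx with rfl | rfl
          · exact h.edge _ hl _ (by simp [Link.premises]) hxN
          · exact absurd hxN (Set.disjoint_left.1 hN hm)
        · exact absurd hxN (hK' l' hl' _ (Link.name_mem_names hx))
      | bang c L b aux =>
        have hp : p ∈ aux := by simpa [Link.conclusions] using hp
        simp only [Link.graft, if_pos hp, List.mem_singleton] at hl'
        subst hl'
        simp only [Link.premises, Link.conclusions, List.mem_cons, List.not_mem_nil, false_or,
          List.mem_map, List.mem_flatMap] at hx
        rcases hx with rfl | ⟨n, ⟨s, hs, hn⟩, rfl⟩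
        · exact h.edge _ hl _ (by simp [Link.conclusions]) hxN
        · split_ifs at hn with h'
          · exact absurd hxN (Set.disjoint_left.1 hN (hxs n hn))
          · obtain rfl : n = s := by simpa using hn
            exact h.edge _ hl _ (.inr (by simp [Link.conclusions, hs])) hxN
      | _ => simp [Link.conclusions] at hp
    · rw [Link.graft_eq_self hp, List.mem_singleton] at hl'
      exact h.edge l hl x (hl' ▸ hx) hxN
  · intro c' L' m' aux' hl' l1 hl1 n hn
    obtain ⟨l, hl, hl'⟩ := List.mem_flatMap.1 hl'
    by_cases hp : Edge.structural p ∈ l.conclusions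
    · cases l with
      | flat a s =>
        obtain rfl : s = p := by simpa [Link.conclusions, eq_comm] using hp
        simp only [Link.graft, if_true, List.mem_cons, reduceCtorEq, false_or] at hl'
        exact (FreshFor.of_names (xs := xs') hK').box _ _ _ _ hl' l1 hl1 n hn
      | bang c L b aux =>
        have hp : p ∈ aux := by simpa [Link.conclusions] using hp
        simp only [Link.graft, if_pos hp, List.mem_singleton, Link.bang.injEq] at hl'
        obtain ⟨rfl, rfl, rfl, rfl⟩ := hl'
        obtain ⟨l2, h2, h1⟩ := List.mem_flatMap.1 hl1
        rcases Link.names_graft_list p K m xs L l2 h2 l1 h1 n hn with h3 | rfl | h3 | ⟨k, hk, h3⟩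
        · exact h.box _ _ _ _ hl l2 h2 n h3
        · exact Set.disjoint_left.1 hN hm
        · exact Set.disjoint_left.1 hN (hxs n h3)
        · exact hK' k hk n h3
      | _ => simp [Link.conclusions] at hp
    · rw [Link.graft_eq_self hp, List.mem_singleton] at hl'
      exact h.box c' L' m' aux' (hl' ▸ hl) l1 hl1 n hn

/-- The set of the edges `p` and `xs`. -/
def bundle (p : ℕ) (xs : List ℕ) : Set Edge :=
  insert (.structural p) {x | x ∈ strs xs}

theorem Link.Sw.bang {c : ℕ} {L : List Link} {m : ℕ} {aux : List ℕ} {H : Set Edge}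
    (h : (Link.bang c L m aux).Sw H) : H ⊆ insert (.logical c) {x | x ∈ strs aux} := by
  intro x hx
  have := h.1 x hx
  simpa [Link.premises, Link.conclusions] using this

theorem Link.Sw.cut {a b : ℕ} {H : Set Edge}
    (h : (Link.cut a b).Sw H) : H ⊆ {.logical a, .logical b} := by
  intro x hx
  have := h.1 x hx
  simpa [Link.premises, Link.conclusions] using this

theorem map_update_of_notMem {α β : Type*} [DecidableEq α] (h : α → β) {l : α} {T : List α}
    (hl : l ∉ T) (b : β) : T.map (Function.update h l b) = T.map h :=
  List.map_congr_left fun x hx => Function.update_of_ne (by rintro rfl; exact hl hx) _ _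

theorem IsModule.links_mem {T : List Link} {Es : List (Set Edge)} {I O : Multiset Edge}
    (h : IsModule T Es I O) {l : Link} (hl : l ∈ T) {x : Edge}
    (hx : x ∈ l.premises ∨ x ∈ l.conclusions) : x ∈ conc T + I := by
  rcases hx with hx | hx
  · rw [h.bal]; exact Multiset.mem_add.2 (.inl (mem_prem.2 ⟨l, hl, hx⟩))
  · exact Multiset.mem_add.2 (.inl (mem_conc.2 ⟨l, hl, hx⟩))

theorem bundle_conn {p : ℕ} {xs : List ℕ} {H : Set Edge} {a : Edge} (ha : a ∈ H)
    (hp : Edge.structural p ∈ H) {x : Edge} (hx : x ∈ strs xs) :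
    Conn [H, bundle p xs] a x :=
  (Conn.of_mem (H := H) (by simp) ha hp).trans
    (Conn.of_mem (H := bundle p xs) (by simp) (.inl rfl) (.inr hx))

theorem strs_nodup {xs : List ℕ} : (strs xs).Nodup ↔ xs.Nodup := by
  rw [strs, Multiset.coe_nodup, List.nodup_map_iff]
  intro a b h
  simpa using h

theorem strs_subst {aux xs : List ℕ} {p : ℕ} (hn : aux.Nodup) (hp : p ∈ aux) :
    strs aux = {.structural p} + strs (aux.erase p) ∧
    strs (aux.flatMap fun s => if s = p then xs else [s]) = strs xs + strs (aux.erase p) := by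
  have haux := List.perm_cons_erase hp
  have hp0 : p ∉ aux.erase p := (List.nodup_cons.1 (haux.nodup_iff.1 hn)).1
  constructor
  · rw [← strs_cons]; exact Multiset.coe_eq_coe.2 (haux.map _)
  · rw [← strs_append]
    refine Multiset.coe_eq_coe.2 (List.Perm.map _ ?_)
    refine (haux.flatMap_right _).trans ?_
    have : (aux.erase p).flatMap (fun s => if s = p then xs else [s]) =
        (aux.erase p).flatMap fun s => [s] :=
      List.flatMap_congr fun s hs => by rw [if_neg]; rintro rfl; exact hp0 hs
    rw [List.flatMap_cons, this]
    simp

/-- A graft at `p` turns the bundle with root `p` into a copy of a box. -/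
theorem IsModule.graft {T : List Link} {Es : List (Set Edge)} {I O : Multiset Edge}
    {p : ℕ} {K : List Link} {m : ℕ} {xs : List ℕ} {N : Set ℕ}
    (hT : IsModule T (bundle p xs :: Es) (strs xs + I) ({.structural p} + O))
    (hp : Edge.structural p ∈ conc T)
    (hK : IsModule K [] 0 ({.logical m} + strs xs))
    (hKN : ∀ l ∈ K, ∀ n ∈ l.names, n ∈ N) (hTN : FreshFor N xs T)
    (hIN : ∀ x ∈ I, x.name ∉ N) (hEN : ∀ H ∈ Es, ∀ x ∈ H, x.name ∉ N) :
    IsModule (T.flatMap (Link.graft p K m xs)) Es I O := by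
  classical
  obtain ⟨l, T₀, hperm, hpl, hp0, hgr⟩ := exists_perm_graft hT.nodup_conc hp
  refine IsModule.perm (hgr K m xs).symm ?_
  replace hT := hT.perm hperm
  have hlT : l ∉ T₀ := (List.nodup_cons.1 hT.nodup_links).1
  have hF : FreshFor N xs (l :: T₀) :=
    ⟨fun k hk => hTN.edge k (hperm.mem_iff.2 hk),
      fun c L m aux hk => hTN.box c L m aux (hperm.mem_iff.2 hk)⟩
  have hKc : ∀ x ∈ conc K, x.name ∈ N := fun x hx => by
    obtain ⟨k, hk, hx⟩ := mem_conc.1 hx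
    exact hKN k hk _ (Link.name_mem_names (.inr hx))
  have hKbal := hK.bal
  rw [add_zero] at hKbal
  have hmN : m ∈ N := hKc (.logical m) (by rw [hKbal]; simp)
  have hxN : ∀ x ∈ strs xs, x.name ∈ N := fun x hx => hKc x (by rw [hKbal]; simp [mem_strs.1 hx])
  cases l with
  | flat a s =>
    obtain rfl : s = p := by simpa [Link.conclusions, eq_comm] using hpl
    have haN : a ∉ N := fun h => by
      simpa using hF.edge (.flat a s) (by simp) (.logical a) (by simp [Link.premises]) h
    have hgraft : (Link.flat a s).graft s K m xs = .cut a m :: K := by simp [Link.graft]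
    rw [hgraft]
    have hnd := hT.nodup
    have hbal := hT.bal
    simp only [conc_cons, prem_cons, Link.conclusions, Link.premises, Multiset.coe_singleton]
      at hnd hbal
    have hTI : (conc T₀ + I).Nodup := by
      refine Multiset.nodup_of_le ?_ hnd
      rw [show {Edge.structural s} + conc T₀ + (strs xs + I) =
        (conc T₀ + I) + ({Edge.structural s} + strs xs) by abel]
      exact Multiset.le_add_right _ _
    refine ⟨?_, ?_, ?_, ?_⟩
    · simp only [List.cons_append, conc_cons, Link.conclusions, Multiset.coe_nil, zero_add,
        conc_append]
      rw [add_assoc]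
      refine (Multiset.Nodup.add_iff hK.nodup_conc hTI).2 (Multiset.disjoint_left.2 ?_)
      intro x hx hx'
      have hxs : x ∈ strs xs := by
        rcases Multiset.mem_add.1 hx' with h | h
        · obtain ⟨k, hk, h⟩ := mem_conc.1 h
          exact hF.edge k (by simp [hk]) x (.inr h) (hKc x hx)
        · exact absurd (hKc x hx) (hIN x h)
      rw [show {Edge.structural s} + conc T₀ + (strs xs + I) =
        {Edge.structural s} + (strs xs + (conc T₀ + I)) by abel] at hnd
      have := (Multiset.nodup_add.1 (Multiset.nodup_add.1 hnd).2.1).2.2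
      exact Multiset.disjoint_left.1 this hxs hx'
    · simp only [List.cons_append, conc_cons, prem_cons, Link.conclusions, Link.premises,
        Multiset.coe_nil, zero_add, conc_append, prem_append]
      rw [← Multiset.cons_coe, Multiset.coe_singleton, ← Multiset.singleton_add, hKbal]
      have h2 : conc T₀ + (strs xs + I) = {Edge.logical a} + prem T₀ + O := by
        have : {Edge.structural s} + (conc T₀ + (strs xs + I)) =
            {Edge.structural s} + ({Edge.logical a} + prem T₀ + O) := by
          rw [← add_assoc, hbal]; abel
        exact add_left_cancel this
      calc prem K + ({Edge.logical m} + strs xs) + conc T₀ + I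
          = prem K + {Edge.logical m} + (conc T₀ + (strs xs + I)) := by abel
        _ = _ := by rw [h2]; abel
    · intro k hk x hx hx'
      simp only [List.cons_append, List.mem_cons, List.mem_append] at hk
      rcases hk with rfl | hk | hk
      · simp [Link.conclusions] at hx'
      · exact hK.loopless k hk x hx hx'
      · exact hT.loopless k (by simp [hk]) x hx hx'
    · intro h hh
      have h1 := hT.correct
        (Function.update h (.flat a s) {Edge.logical a, Edge.structural s}) fun k hk => by
          rcases List.mem_cons.1 hk with rfl | hk
          · rw [Function.update_self]
            exact ⟨by simp [Link.premises, Link.conclusions], fun h => h.elim⟩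
          · rw [Function.update_of_ne (by rintro rfl; exact hlT hk)]
            exact hh k (by simp [hk])
      rw [List.map_cons, Function.update_self, map_update_of_notMem _ hlT] at h1
      have hsub := (hh (.cut a m) (by simp)).cut
      have hKf := hK.correct h fun k hk => hh k (by simp [hk])
      rw [List.append_nil] at hKf
      set Z := T₀.map h ++ Es with hZ
      have hmZ : ∀ H ∈ Z, ∀ x ∈ H, x.name ∈ N → x ∈ strs xs := by
        intro H hH x hx hxN
        rcases List.mem_append.1 hH with hH | hH
        · obtain ⟨k, hk, rfl⟩ := List.mem_map.1 hH
          exact hF.edge k (by simp [hk]) x ((hh k (by simp [hk])).1 x hx) hxN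
        · exact absurd hxN (hEN H hH x hx)
      have hmZ' : ∀ H ∈ Z, Edge.logical m ∉ H := fun H hH hx => by
        simpa using hmZ H hH _ hx hmN
      -- The copy contracted to one hyperedge on its border. The `♭`-link and the bundle connect `a`
      -- to `xs`; so do the new cut and `B`, through the new point `m`. As `m` does not occur in the
      -- rest, the two blocks may be exchanged.
      let B : Set Edge := insert (.logical m) {x | x ∈ strs xs}
      have h2 : Forest ([{Edge.logical a, Edge.structural s}, bundle s xs] ++ Z) :=
        h1.perm (List.Perm.cons _ (List.perm_middle (l₁ := T₀.map h)))
      have h3 : Forest ([B, {Edge.logical a, Edge.logical m}] ++ Z) := by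
        refine h2.replace ?_ ?_
        · refine forest_cons.2 ⟨⟨by simp [cutSpace], trivial⟩, fun x hx y hy hxy => ?_⟩
          have key : ∀ x ∈ strs xs, ∀ y, x ≠ y →
              ¬ Conn [{Edge.logical a, Edge.logical m}] x y := by
            intro x hx y hxy
            refine not_conn_of_notMem hxy ?_
            obtain ⟨n, _, rfl⟩ := mem_strs.1 hx
            simp
          rcases hx with rfl | hx
          · rcases hy with rfl | hy
            · exact absurd rfl hxy
            · exact fun hc => key y hy _ hxy.symm hc.symm
          · exact key x hx y hxy
        · intro z hz
          have hz1 := cutSpace_le_zeroSum _ hz.1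
          have hz2 := cutSpace_le_zeroSum _ hz.2
          have hz3 : z ∈ zeroSum (insert (Edge.logical a) {x | x ∈ strs xs}) := by
            refine ⟨fun x hx => ?_, hz1.2⟩
            obtain ⟨H, hH, hxH⟩ := hz1.1 hx
            obtain ⟨H', hH', hxH'⟩ := hz2.1 hx
            have hxm : x ≠ .logical m := by rintro rfl; exact hmZ' H' hH' hxH'
            simp only [List.mem_cons, List.not_mem_nil, or_false] at hH
            rcases hH with rfl | rfl
            · exact .inr (hxH.resolve_left hxm)
            · exact .inl (hxH.resolve_right hxm)
          refine zeroSum_le ?_ hz3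
          have key : ∀ x ∈ insert (Edge.logical a) {x | x ∈ strs xs},
              Conn [{Edge.logical a, Edge.structural s}, bundle s xs] (.logical a) x := by
            rintro x (rfl | hx)
            · exact .refl _ _
            · exact bundle_conn (by simp) (by simp) hx
          exact fun x hx y hy => (key x hx).symm.trans (key y hy)
      -- The contracted copy is opened up: by freshness of its names it meets the rest in its border
      -- only.
      have h4 := Forest.expand (H := B) (Y := K.map h) h3 hKf ?_
      · refine Forest.perm (Hs := h (.cut a m) :: (K.map h ++ Z)) ?_ ?_
        · simp [hZ]
        · refine Forest.mono (Hs' := {Edge.logical a, Edge.logical m} :: (K.map h ++ Z))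
            (.cons hsub ?_) (h4.perm (List.perm_middle))
          exact List.forall₂_same.2 fun x _ => subset_rfl
      · intro H hH H' hH' x hx hx'
        obtain ⟨k, hk, rfl⟩ := List.mem_map.1 hH
        have hxN' : x.name ∈ N := hKN k hk _ (Link.name_mem_names ((hh k (by simp [hk])).1 x hx))
        replace hH' : H' ∈ {Edge.logical a, Edge.logical m} :: Z := hH'
        rcases List.mem_cons.1 hH' with rfl | hH'
        · rcases hx' with rfl | rfl
          · exact absurd hxN' haN
          · exact .inl rfl
        · exact .inr (hmZ H' hH' x hx' hxN')
  | bang c L n aux =>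
    have hpa : p ∈ aux := by simpa [Link.conclusions] using hpl
    obtain ⟨L', hgraft⟩ : ∃ L', (Link.bang c L n aux).graft p K m xs =
        [.bang c L' n (aux.flatMap fun s => if s = p then xs else [s])] := by
      simp [Link.graft]
    rw [hgraft]
    have hnd := hT.nodup
    have hbal := hT.bal
    have hcc : ∀ L aux, ((Link.bang c L n aux).conclusions : Multiset Edge) =
        {.logical c} + strs aux := fun L aux => by simp [Link.conclusions, strs]
    have hpp : ∀ L aux, ((Link.bang c L n aux).premises : Multiset Edge) = 0 := fun L aux => rfl
    rw [conc_cons, hcc] at hnd hbal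
    rw [prem_cons, hpp, zero_add] at hbal
    have hauxn : aux.Nodup := by
      rw [add_assoc, Multiset.nodup_add] at hnd
      exact strs_nodup.1 (Multiset.nodup_add.1 hnd.1).2.1
    obtain ⟨hauxc, haux'⟩ := strs_subst (xs := xs) hauxn hpa
    set aux₀ := aux.erase p
    rw [hauxc] at hnd hbal
    have he : {Edge.logical c} + ({Edge.structural p} + strs aux₀) + conc T₀ + (strs xs + I) =
        {Edge.structural p} + ({Edge.logical c} + (strs xs + strs aux₀) + conc T₀ + I) := by abel
    refine ⟨?_, ?_, ?_, ?_⟩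
    · simp only [List.cons_append, conc_cons, hcc, haux', List.nil_append]
      rw [he] at hnd
      exact (Multiset.nodup_add.1 hnd).2.1
    · simp only [List.cons_append, conc_cons, prem_cons, hcc, hpp, haux', List.nil_append]
      rw [he, show prem T₀ + ({Edge.structural p} + O) = {Edge.structural p} + (prem T₀ + O) by
        abel] at hbal
      rw [add_left_cancel hbal, zero_add]
    · intro k hk x hx hx'
      simp only [List.cons_append, List.mem_cons, List.nil_append] at hk
      rcases hk with rfl | hk
      · simp [Link.premises] at hx
      · exact hT.loopless k (by simp [hk]) x hx hx'
    · intro h hh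
      have h1 := hT.correct (Function.update h (.bang c L n aux)
        (insert (.logical c) {x | x ∈ strs aux})) fun k hk => by
          rcases List.mem_cons.1 hk with rfl | hk
          · rw [Function.update_self]
            exact ⟨by simp [Link.premises, Link.conclusions], fun h => h.elim⟩
          · rw [Function.update_of_ne (by rintro rfl; exact hlT hk)]
            exact hh k (by simp [hk])
      rw [List.map_cons, Function.update_self, map_update_of_notMem _ hlT] at h1
      have hsub := (hh _ (List.mem_append_left _ (List.mem_singleton_self _))).bang
      set H0 := insert (.logical c) {x | x ∈ strs aux} with hH0
      have h2 : Forest ([H0, bundle p xs] ++ (T₀.map h ++ Es)) :=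
        h1.perm (List.Perm.cons H0 (List.perm_middle (l₁ := T₀.map h)))
      rw [haux'] at hsub
      -- At depth `0` a graft inside a box only exchanges the auxiliary conclusion `p` for `xs`. The
      -- old hyperedge and the bundle share `p`, so together they already connect all the edges of
      -- the new `!`-link.
      refine h2.replace (Y := [h _]) ⟨by simp [cutSpace], trivial⟩ (inf_le_left.trans ?_)
      refine cutSpace_le fun H hH => ?_
      obtain rfl := List.mem_singleton.1 hH
      refine (zeroSum_mono hsub).trans (zeroSum_le ?_)
      have key : ∀ x ∈ insert (Edge.logical c) {x | x ∈ strs xs + strs aux₀},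
          Conn [H0, bundle p xs] (.logical c) x := by
        rintro x (rfl | hx)
        · exact .refl _ _
        · rcases Multiset.mem_add.1 (show x ∈ strs xs + strs aux₀ from hx) with hx | hx
          · exact bundle_conn (.inl rfl) (.inr (mem_strs.2 ⟨p, hpa, rfl⟩)) hx
          · refine Conn.of_mem (H := H0) (by simp) (.inl rfl) (.inr ?_)
            change x ∈ strs aux
            rw [hauxc]; exact Multiset.mem_add.2 (.inr hx)
      exact fun x hx y hy => (key x hx).symm.trans (key y hy)
  | _ => simp [Link.conclusions] at hpl

/-- A bundle may be added at an output. -/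
theorem IsModule.add_bundle {T : List Link} {O : Multiset Edge} {p : ℕ} {xs : List ℕ}
    (hT : IsModule T [] 0 ({.structural p} + O)) (hxs : (strs xs).Nodup)
    (hx : ∀ x ∈ strs xs, x ∉ conc T) :
    IsModule T [bundle p xs] (strs xs + 0) ({.structural p} + (strs xs + O)) := by
  have hbal := hT.bal
  rw [add_zero] at hbal
  refine ⟨?_, ?_, hT.loopless, fun h hh => ?_⟩
  · rw [add_zero]
    exact (Multiset.Nodup.add_iff hT.nodup_conc hxs).2
      (Multiset.disjoint_left.2 fun {x} h1 h2 => hx x h2 h1)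
  · rw [hbal]; abel
  · refine Forest.perm List.perm_append_comm ?_
    have h1 := hT.correct h hh
    rw [List.append_nil] at h1
    refine forest_cons.2 ⟨h1, fun x hx1 y hy1 hxy => ?_⟩
    have key : ∀ x ∈ strs xs, ∀ y, x ≠ y → ¬ Conn (T.map h) x y := by
      intro x hx' y hxy
      refine not_conn_of_notMem hxy fun H hH hxH => ?_
      obtain ⟨k, hk, rfl⟩ := List.mem_map.1 hH
      refine hx x hx' ?_
      have := hT.links_mem hk ((hh k hk).1 x hxH)
      rwa [add_zero] at this
    rcases hx1 with rfl | hx1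
    · rcases hy1 with rfl | hy1
      · exact absurd rfl hxy
      · exact fun hc => key y hy1 _ hxy.symm hc.symm
    · exact key x hx1 y hxy

/-- All boxes at depth `0` are `♭`-nets. -/
def BoxesGood (T : List Link) : Prop :=
  ∀ c L m aux, Link.bang c L m aux ∈ T → Struct.Good ⟨L, [m], aux⟩

theorem Struct.Good.boxesGood {S : Struct} (h : S.Good) : BoxesGood S.links :=
  fun _ _ _ _ hl => h.boxes hl

theorem boxesGood_graft_of {p : ℕ} {K : List Link} {m : ℕ} {xs : List ℕ} {T : List Link}
    (hT : BoxesGood T) (hK : BoxesGood K)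
    (h : ∀ c L n aux, Link.bang c L n aux ∈ T → p ∈ aux →
      Struct.Good ⟨L.flatMap (Link.graft p K m xs), [n],
        aux.flatMap fun s => if s = p then xs else [s]⟩) :
    BoxesGood (T.flatMap (Link.graft p K m xs)) := by
  intro c L' n aux' hl'
  obtain ⟨l, hl, hl'⟩ := List.mem_flatMap.1 hl'
  by_cases hp : Edge.structural p ∈ l.conclusions
  · cases l with
    | flat a s =>
      obtain rfl : s = p := by simpa [Link.conclusions, eq_comm] using hp
      simp only [Link.graft, if_true, List.mem_cons, reduceCtorEq, false_or] at hl'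
      exact hK _ _ _ _ hl'
    | bang c L b aux =>
      have hp : p ∈ aux := by simpa [Link.conclusions] using hp
      simp only [Link.graft, if_pos hp, List.mem_singleton, Link.bang.injEq] at hl'
      obtain ⟨rfl, rfl, rfl, rfl⟩ := hl'
      exact h _ _ _ _ hl ‹p ∈ aux›
    | _ => simp [Link.conclusions] at hp
  · rw [Link.graft_eq_self hp, List.mem_singleton] at hl'
    exact hT _ _ _ _ (hl' ▸ hl)

theorem Struct.Good.isModule_box {K : List Link} {m : ℕ} {xs : List ℕ}
    (hK : Struct.Good ⟨K, [m], xs⟩) : IsModule K [] 0 ({.logical m} + strs xs) := by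
  have := hK.isModule
  rwa [Struct.outputs_box] at this

theorem Struct.Good.strs_nodup {K : List Link} {C : List ℕ} {xs : List ℕ}
    (hK : Struct.Good ⟨K, C, xs⟩) : (strs xs).Nodup := by
  have := hK.isModule.nodup_prem_add
  refine Multiset.nodup_of_le ?_ this
  rw [Struct.outputs, ← Multiset.coe_add, ← add_assoc]
  exact Multiset.le_add_left _ _

/-- When `p` is a structural conclusion, a bundle towards fresh edges can be attached to it without
creating a cycle (`IsModule.add_bundle`). The graft then exchanges this bundle for the copy. Boxes
are handled by induction on the depth, since there `p` is again a structural conclusion. -/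
theorem Struct.Good.graft {S : Struct} (hS : S.Good) {p : ℕ} {K : List Link} {m : ℕ}
    {xs : List ℕ} {N : Set ℕ} (hp : p ∈ S.aux) (hK : Struct.Good ⟨K, [m], xs⟩)
    (hKN : ∀ l ∈ K, ∀ n ∈ l.names, n ∈ N) (hSN : ∀ l ∈ S.links, ∀ n ∈ l.names, n ∉ N) :
    Struct.Good ⟨S.links.flatMap (Link.graft p K m xs), S.concl,
      S.aux.flatMap fun s => if s = p then xs else [s]⟩ := by
  induction hS with
  | intro S hm boxes ih =>
    have hS : S.Good := ⟨S, hm, boxes⟩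
    have hn : S.aux.Nodup := LLNet.strs_nodup.1 (Struct.Good.strs_nodup (C := S.concl) hS)
    obtain ⟨ha, ha'⟩ := strs_subst (xs := xs) hn hp
    have hout : ∀ T C aux, Struct.outputs ⟨T, C, aux⟩ =
        ((C.map Edge.logical : List Edge) : Multiset Edge) + strs aux := fun T C aux => rfl
    refine ⟨_, ?_, ?_⟩
    · have hO : S.outputs = {.structural p} +
          ((S.concl.map Edge.logical : List Edge) + strs (S.aux.erase p)) := by
        rw [show S.outputs = _ from hout S.links S.concl S.aux, ha]; abel
      rw [hO] at hm
      rw [hout, ha', show ((S.concl.map Edge.logical : List Edge) : Multiset Edge) +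
        (strs xs + strs (S.aux.erase p)) = strs xs +
        ((S.concl.map Edge.logical : List Edge) + strs (S.aux.erase p)) by abel]
      have hpc : Edge.structural p ∈ conc S.links := by
        have := hm.bal
        rw [add_zero] at this
        rw [this]; simp
      have hKm := hK.isModule_box
      refine (hm.add_bundle (xs := xs) hK.strs_nodup fun x hx hx' => ?_).graft (N := N) hpc
        hKm hKN (FreshFor.of_names hSN) (by simp) (by simp)
      have h1 : x ∈ conc K := by
        have := hKm.bal
        rw [add_zero] at this
        rw [this]; exact Multiset.mem_add.2 (.inr (Multiset.mem_add.2 (.inr hx)))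
      obtain ⟨k, hk, h1⟩ := mem_conc.1 h1
      obtain ⟨l, hl, h2⟩ := mem_conc.1 hx'
      exact hSN l hl _ (Link.name_mem_names (.inr h2)) (hKN k hk _ (Link.name_mem_names (.inr h1)))
    · refine boxesGood_graft_of boxes hK.boxesGood fun c L n aux hl hp' => ?_
      refine ih c L n aux hl hp' fun l hl' n hn => hSN _ hl n ?_
      simp only [Link.names, List.mem_cons, List.mem_append, List.mem_flatMap]
      exact .inr (.inr (.inr ⟨l, hl', hn⟩))

theorem BoxesGood.graft {T : List Link} (hT : BoxesGood T) {p : ℕ} {K : List Link} {m : ℕ}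
    {xs : List ℕ} {N : Set ℕ} {ys : List ℕ} (hK : Struct.Good ⟨K, [m], xs⟩)
    (hKN : ∀ l ∈ K, ∀ n ∈ l.names, n ∈ N) (hTN : FreshFor N ys T) :
    BoxesGood (T.flatMap (Link.graft p K m xs)) :=
  boxesGood_graft_of hT hK.boxesGood fun c L n aux hl hp =>
    (hT c L n aux hl).graft hp hK hKN (hTN.box c L n aux hl)

/-! ### Replacing structural edges by copies -/

theorem tag_inj {i j a b : ℕ} : tag i a = tag j b ↔ i = j ∧ a = b := Nat.pair_eq_pair

theorem tag_injective (j : ℕ) : Function.Injective (tag j) := fun _ _ h => (tag_inj.1 h).2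

/-- The edges that replace an edge. -/
def Edge.subst (f : ℕ → ℕ) (σ : ℕ → List ℕ) : Edge → List Edge
  | .logical n => [.logical (f n)]
  | .structural s => (σ s).map .structural

/-- Distinct edges are replaced by distinct edges. -/
structure IsRenaming (f : ℕ → ℕ) (σ : ℕ → List ℕ) : Prop where
  inj : Function.Injective f
  nodup : ∀ s, (σ s).Nodup
  disjoint : ∀ s t, s ≠ t → List.Disjoint (σ s) (σ t)
  fresh : ∀ s t, s ≠ t → f s ∉ σ t

theorem IsRenaming.subst_disjoint {f : ℕ → ℕ} {σ : ℕ → List ℕ} (h : IsRenaming f σ)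
    {x y z : Edge} (hy : x ∈ Edge.subst f σ y) (hz : x ∈ Edge.subst f σ z) : y = z := by
  cases y <;> cases z <;> simp only [Edge.subst, List.mem_singleton, List.mem_map] at hy hz
  · rw [hy] at hz
    rw [h.inj (Edge.logical.inj hz)]
  · obtain ⟨n, _, rfl⟩ := hz; cases hy
  · obtain ⟨n, _, rfl⟩ := hy; cases hz
  · obtain ⟨n, hn, rfl⟩ := hy
    obtain ⟨n', hn', he⟩ := hz
    obtain rfl := Edge.structural.inj he
    by_contra hne
    exact h.disjoint _ _ (fun h' => hne (by rw [h'])) hn hn'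

theorem IsRenaming.subst_nodup {f : ℕ → ℕ} {σ : ℕ → List ℕ} (h : IsRenaming f σ) (x : Edge) :
    (Edge.subst f σ x).Nodup := by
  cases x with
  | logical n => simp [Edge.subst]
  | structural s => exact (h.nodup s).map fun a b h => Edge.structural.inj h

theorem isRenaming_id : IsRenaming id fun s => [s] :=
  ⟨fun _ _ h => h, by simp, by simp [List.Disjoint, eq_comm], by simp⟩

theorem mem_copies {k : ℕ} {aux : List ℕ} {s n : ℕ} : n ∈ Struct.copies k aux s ↔
    (s ∈ aux ∧ ∃ j < k, n = tag (j + 1) s) ∨ (s ∉ aux ∧ n = tag 0 s) := by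
  unfold Struct.copies
  split_ifs with h
  · simp [h, eq_comm]
  · simp [h]

theorem isRenaming_copies (k : ℕ) (aux : List ℕ) :
    IsRenaming (tag 0) (Struct.copies k aux) := by
  refine ⟨tag_injective 0, fun s => ?_, fun s t hst n hs ht => ?_, fun s t hst h => ?_⟩
  · unfold Struct.copies
    split_ifs
    · refine List.nodup_range.map fun i j h => ?_
      simpa using (tag_inj.1 h).1
    · simp
  · rcases mem_copies.1 hs with ⟨_, i, _, rfl⟩ | ⟨_, rfl⟩ <;>
      rcases mem_copies.1 ht with ⟨_, j, _, h⟩ | ⟨_, h⟩ <;> exact hst (tag_inj.1 h).2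
  · rcases mem_copies.1 h with ⟨_, j, _, h⟩ | ⟨_, h⟩ <;> exact hst (tag_inj.1 h).2

/-- Outside a box, edges that are not auxiliary conclusions of it follow `f`. The field `fresh`
prevents them from colliding with the edges produced by `σ`. -/
theorem IsRenaming.extend {f : ℕ → ℕ} {σ : ℕ → List ℕ} (h : IsRenaming f σ) (aux : List ℕ) :
    IsRenaming f fun s => if s ∈ aux then σ s else [f s] := by
  refine ⟨h.inj, fun s => ?_, fun s t hst n hs ht => ?_, fun s t hst h' => ?_⟩
  · split_ifs
    · exact h.nodup s
    · simp
  · split_ifs at hs ht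
    · exact h.disjoint s t hst hs ht
    · exact h.fresh t s hst.symm (List.mem_singleton.1 ht ▸ hs)
    · exact h.fresh s t hst (List.mem_singleton.1 hs ▸ ht)
    · rw [List.mem_singleton] at hs ht
      exact hst (h.inj (hs.symm.trans ht))
  · split_ifs at h'
    · exact h.fresh s t hst h'
    · exact hst (h.inj (List.mem_singleton.1 h'))

theorem Struct.StepWith.isRenaming {f : ℕ → ℕ} {σ : ℕ → List ℕ} {S S' : Struct}
    (h : Struct.StepWith f σ S S') : IsRenaming f σ := by
  induction h with
  | ax => exact isRenaming_id
  | mult => exact isRenaming_id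
  | unit => exact isRenaming_id
  | exp => exact isRenaming_copies _ _
  | box _ _ ih => exact ih.extend _

theorem Struct.StepWith.aux_eq {f : ℕ → ℕ} {σ : ℕ → List ℕ} {S S' : Struct}
    (h : Struct.StepWith f σ S S') : S'.aux = S.aux.flatMap σ := by
  cases h <;> simp

namespace Link

theorem premises_substWhy (f : ℕ → ℕ) (σ : ℕ → List ℕ) (l : Link) :
    (l.substWhy f σ).premises = l.premises.flatMap (Edge.subst f σ) := by
  cases l <;> simp [substWhy, rename, premises, Edge.subst, List.flatMap_map, List.map_flatMap]

theorem conclusions_substWhy (f : ℕ → ℕ) (σ : ℕ → List ℕ) (l : Link) :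
    (l.substWhy f σ).conclusions = l.conclusions.map (Edge.map f) := by
  cases l <;> simp [substWhy, rename, conclusions, Edge.map, Function.comp_def]

theorem exclusive_substWhy (f : ℕ → ℕ) (σ : ℕ → List ℕ) (l : Link) :
    (l.substWhy f σ).Exclusive ↔ l.Exclusive := by
  cases l <;> simp [substWhy, rename, Exclusive]

theorem subst_of_not_exclusive {f : ℕ → ℕ} {σ : ℕ → List ℕ} {l : Link} (h : ¬ l.Exclusive)
    {x : Edge} (hx : x ∈ l.premises) : Edge.subst f σ x = [x.map f] := by
  cases l <;> simp only [premises, Exclusive, not_true_eq_false, List.mem_cons, List.not_mem_nil,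
    or_false] at h hx
  case flat => subst hx; rfl
  all_goals rcases hx with rfl | rfl <;> rfl

end Link

/-- The multiset of edges that replace an edge. -/
def substs (f : ℕ → ℕ) (σ : ℕ → List ℕ) : Edge → Multiset Edge :=
  fun x => (Edge.subst f σ x : List Edge)

theorem coe_bind_substs (f : ℕ → ℕ) (σ : ℕ → List ℕ) (X : List Edge) :
    (X : Multiset Edge).bind (substs f σ) = (X.flatMap (Edge.subst f σ) : List Edge) :=
  Multiset.coe_bind _ _

theorem prem_substWhy (f : ℕ → ℕ) (σ : ℕ → List ℕ) (R : List Link) :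
    prem (R.map (Link.substWhy f σ)) = (prem R).bind (substs f σ) := by
  induction R with
  | nil => rfl
  | cons l R ih =>
    simp only [List.map_cons, prem_cons, ih, Multiset.add_bind, Link.premises_substWhy]
    congr 1
    exact (coe_bind_substs _ _ _).symm

/-- Only premises of `?`-links are multiplied by `Link.substWhy`; the hypothesis makes the
conclusions of the links agree with the same substitution. -/
theorem conc_substWhy {f : ℕ → ℕ} {σ : ℕ → List ℕ} {R : List Link}
    (h : ∀ s, .structural s ∈ conc R → σ s = [f s]) :
    conc (R.map (Link.substWhy f σ)) = (conc R).bind (substs f σ) := by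
  induction R with
  | nil => rfl
  | cons l R ih =>
    simp only [conc_cons, Multiset.mem_add, Multiset.mem_coe] at h
    simp only [List.map_cons, conc_cons, Multiset.add_bind, Link.conclusions_substWhy]
    rw [ih fun s hs => h s (.inr hs)]
    congr 1
    rw [coe_bind_substs]
    refine congrArg _ ?_
    rw [List.map_eq_flatMap]
    refine List.flatMap_congr fun x hx => ?_
    cases x with
    | logical n => rfl
    | structural s => simp [Edge.subst, h s (.inl hx), Edge.map]

theorem strs_bind (f : ℕ → ℕ) (σ : ℕ → List ℕ) (xs : List ℕ) :
    (strs xs).bind (substs f σ) = strs (xs.flatMap σ) := by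
  rw [strs, coe_bind_substs, strs, List.flatMap_map, List.map_flatMap]; rfl

theorem outputs_bind (f : ℕ → ℕ) (σ : ℕ → List ℕ) (S : Struct) (T : List Link) :
    S.outputs.bind (substs f σ) = Struct.outputs ⟨T, S.concl.map f, S.aux.flatMap σ⟩ := by
  rw [Struct.outputs, coe_bind_substs, List.flatMap_append, Struct.outputs,
    List.flatMap_map, List.flatMap_map, List.map_flatMap, List.map_map]
  congr 2
  rw [List.map_eq_flatMap]; rfl

theorem IsRenaming.nodup_bind {f : ℕ → ℕ} {σ : ℕ → List ℕ} (h : IsRenaming f σ)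
    {X : Multiset Edge} (hX : X.Nodup) : (X.bind (substs f σ)).Nodup := by
  induction X using Quotient.inductionOn with
  | h X =>
    change ((X : Multiset Edge).bind _).Nodup
    rw [coe_bind_substs, Multiset.coe_nodup, List.nodup_flatMap]
    refine ⟨fun x _ => h.subst_nodup x, (Multiset.coe_nodup.1 hX).imp ?_⟩
    exact fun hne x hx hy => hne (h.subst_disjoint hx hy)

/-- A switching of the links with replaced edges is, up to a renaming, a switching of the original
links. -/
theorem exists_switching_substWhy {f : ℕ → ℕ} {σ : ℕ → List ℕ} (hr : IsRenaming f σ)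
    {R : List Link} (hp : (prem R).Nodup)
    (hc : ∀ s, .structural s ∈ conc R → σ s = [f s])
    (hl : ∀ l ∈ R, ∀ x ∈ l.premises, x ∉ l.conclusions) {h' : Link → Set Edge}
    (hh' : ∀ l ∈ R.map (Link.substWhy f σ), l.Sw (h' l)) :
    ∃ (ρ : Edge → Edge) (h : Link → Set Edge), (∀ l ∈ R, l.Sw (h l)) ∧
      (∀ x y, x ∈ Edge.subst f σ y → ρ x = y) ∧
      (∀ l ∈ R, h l = ρ '' h' (l.substWhy f σ)) ∧
      Set.InjOn ρ {x | ∃ H ∈ (R.map (Link.substWhy f σ)).map h', x ∈ H} := by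
  classical
  -- `ρ` sends a copy to the edge it comes from, which is unique since distinct edges have disjoint
  -- substitutes.
  let ρ : Edge → Edge := fun x => if h : ∃ y, x ∈ Edge.subst f σ y then h.choose else x
  have hρ : ∀ x y, x ∈ Edge.subst f σ y → ρ x = y := by
    intro x y hy
    have hex : ∃ y, x ∈ Edge.subst f σ y := ⟨y, hy⟩
    rw [show ρ x = hex.choose from dif_pos hex]
    exact hr.subst_disjoint hex.choose_spec hy
  have hsub : ∀ x ∈ conc R, Edge.subst f σ x = [x.map f] := by
    intro x hx
    cases x with
    | logical n => rfl
    | structural s => simp [Edge.subst, hc s hx, Edge.map]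
  have hmem : ∀ l ∈ R, ∀ x ∈ h' (l.substWhy f σ), x ∈ Edge.subst f σ (ρ x) ∧
      (ρ x ∈ l.premises ∧ x ∈ (l.substWhy f σ).premises ∨ ρ x ∈ l.conclusions) := by
    intro l hlR x hx
    rcases (hh' _ (List.mem_map_of_mem hlR)).1 x hx with h1 | h1
    · have h2 := h1
      rw [Link.premises_substWhy] at h1
      obtain ⟨y, hy, hxy⟩ := List.mem_flatMap.1 h1
      rw [hρ x y hxy]
      exact ⟨hxy, .inl ⟨hy, h2⟩⟩
    · rw [Link.conclusions_substWhy] at h1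
      obtain ⟨y, hy, rfl⟩ := List.mem_map.1 h1
      have : y.map f ∈ Edge.subst f σ y := by
        rw [hsub y (mem_conc.2 ⟨l, hlR, hy⟩)]; simp
      rw [hρ _ _ this]
      exact ⟨this, .inr hy⟩
  have hex : ∀ l ∈ R, l.Exclusive → ∀ x ∈ h' (l.substWhy f σ), ∀ y ∈ h' (l.substWhy f σ),
      ρ x ∈ l.premises → ρ y ∈ l.premises → x = y := by
    intro l hlR he x hx y hy hx1 hy1
    have hx2 := (hmem l hlR x hx).2.resolve_right (hl l hlR _ hx1)
    have hy2 := (hmem l hlR y hy).2.resolve_right (hl l hlR _ hy1)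
    exact (hh' _ (List.mem_map_of_mem hlR)).2 ((Link.exclusive_substWhy f σ l).2 he)
      x hx2.2 y hy2.2 hx hy
  refine ⟨ρ, fun l => ρ '' h' (l.substWhy f σ), fun l hlR => ⟨?_, ?_⟩, hρ, fun _ _ => rfl, ?_⟩
  · rintro _ ⟨x, hx, rfl⟩
    exact (hmem l hlR x hx).2.imp_left And.left
  · rintro he _ h1 _ h2 ⟨x, hx, rfl⟩ ⟨y, hy, rfl⟩
    rw [hex l hlR he x hx y hy h1 h2]
  · rintro x ⟨H, hH, hx⟩ y ⟨H', hH', hy⟩ he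
    simp only [List.map_map, List.mem_map, Function.comp] at hH hH'
    obtain ⟨l, hlR, rfl⟩ := hH
    obtain ⟨l', hlR', rfl⟩ := hH'
    have hx1 := hmem l hlR x hx
    have hy1 := hmem l' hlR' y hy
    have single : Edge.subst f σ (ρ x) = [(ρ x).map f] → x = y := by
      intro hs
      rw [← he, hs] at hy1
      rw [hs] at hx1
      rw [List.mem_singleton.1 hx1.1, List.mem_singleton.1 hy1.1]
    by_cases hcx : ρ x ∈ conc R
    · exact single (hsub _ hcx)
    · have hx2 := hx1.2.resolve_right fun h => hcx (mem_conc.2 ⟨l, hlR, h⟩)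
      have hy2 := hy1.2.resolve_right fun h => hcx (he ▸ mem_conc.2 ⟨l', hlR', h⟩)
      obtain rfl := eq_of_mem_premises hp hlR hlR' hx2.1 (he ▸ hy2.1)
      -- Two kept copies of one edge would be premises of one link. A `?`-link keeps a single
      -- premise, and a non-exclusive link has only logical premises, which are not multiplied.
      by_cases hle : l.Exclusive
      · exact hex l hlR hle x hx y hy hx2.1 hy2.1
      · exact single (Link.subst_of_not_exclusive hle hx2.1)

theorem forest_substWhy {f : ℕ → ℕ} {σ : ℕ → List ℕ} {R : List Link} {ρ : Edge → Edge}
    {h h' : Link → Set Edge} (hh : ∀ l ∈ R, h l = ρ '' h' (l.substWhy f σ)) :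
    ((R.map (Link.substWhy f σ)).map h').map (ρ '' ·) = R.map h := by
  rw [List.map_map, List.map_map]
  exact List.map_congr_left fun l hl => (hh l hl).symm

/-- Once the edges kept by `l` are fixed, the link becomes an additional hyperedge. This is how the
links of a redex are isolated from its context. -/
theorem Correct.cons {l : Link} {T : List Link} {Es : List (Set Edge)} (h : Correct (l :: T) Es)
    (hl : l ∉ T) {H : Set Edge} (hH : l.Sw H) : Correct T (H :: Es) := by
  classical
  intro k hk
  have := h (Function.update k l H) fun l' hl' => by
    rcases List.mem_cons.1 hl' with rfl | hl'
    · rwa [Function.update_self]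
    · rw [Function.update_of_ne (ne_of_mem_of_not_mem hl' hl)]
      exact hk l' hl'
  rw [List.map_cons, Function.update_self, map_update_of_notMem _ hl] at this
  exact this.perm (List.perm_middle (l₁ := T.map k)).symm

theorem BoxesGood.substWhy {f : ℕ → ℕ} {σ : ℕ → List ℕ} {R : List Link} (hR : BoxesGood R)
    (hf : Function.Injective f) : BoxesGood (R.map (Link.substWhy f σ)) := by
  intro c L m aux hl
  obtain ⟨l, hl', he⟩ := List.mem_map.1 hl
  cases l <;> simp only [Link.substWhy, Link.rename, Link.bang.injEq, reduceCtorEq] at he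
  obtain ⟨rfl, rfl, rfl, rfl⟩ := he
  exact (hR _ _ _ _ hl').rename hf

theorem loopless_substWhy {f : ℕ → ℕ} {σ : ℕ → List ℕ} (hr : IsRenaming f σ) {R : List Link}
    (hc : ∀ s, .structural s ∈ conc R → σ s = [f s])
    (hl : ∀ l ∈ R, ∀ x ∈ l.premises, x ∉ l.conclusions) :
    ∀ l ∈ R.map (Link.substWhy f σ), ∀ x ∈ l.premises, x ∉ l.conclusions := by
  intro l' hl' x hx hx'
  obtain ⟨l, hlR, rfl⟩ := List.mem_map.1 hl'
  rw [Link.premises_substWhy] at hx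
  rw [Link.conclusions_substWhy] at hx'
  obtain ⟨y, hy, hxy⟩ := List.mem_flatMap.1 hx
  obtain ⟨z, hz, rfl⟩ := List.mem_map.1 hx'
  have : z.map f ∈ Edge.subst f σ z := by
    cases z with
    | logical n => simp [Edge.subst, Edge.map]
    | structural s => simp [Edge.subst, Edge.map, hc s (mem_conc.2 ⟨l, hlR, hz⟩)]
  exact hl l hlR y hy (hr.subst_disjoint hxy this ▸ hz)

/-! ### Cut elimination preserves correctness -/

/-- The names of the copy of a box with index `j`. -/
def copyNames (j : ℕ) : Set ℕ := Set.range (tag (j + 1))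

theorem tag_mem_copyNames {i j n : ℕ} : tag i n ∈ copyNames j ↔ i = j + 1 := by
  constructor
  · rintro ⟨m, h⟩
    exact (tag_inj.1 h).1.symm
  · rintro rfl
    exact ⟨n, rfl⟩

theorem disjoint_copyNames {i j : ℕ} (h : i ≠ j) : Disjoint (copyNames i) (copyNames j) := by
  rw [Set.disjoint_left]
  rintro _ ⟨a, rfl⟩ hb
  exact h (by simpa using tag_mem_copyNames.1 hb)

theorem names_mem_copyNames {L : List Link} {j : ℕ} :
    ∀ l ∈ L.map (Link.rename (tag (j + 1))), ∀ n ∈ l.names, n ∈ copyNames j := by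
  intro l hl n hn
  obtain ⟨l, _, rfl⟩ := List.mem_map.1 hl
  rw [Link.names_rename] at hn
  obtain ⟨m, _, rfl⟩ := List.mem_map.1 hn
  exact ⟨m, rfl⟩

/-- The grafts of copies of a box. -/
def grafts (L : List Link) (m : ℕ) (aux : List ℕ) (qs : List (ℕ × ℕ)) (R : List Link) :
    List Link :=
  qs.foldl (fun K pj => K.flatMap (Link.graft (tag 0 pj.1) (L.map (Link.rename (tag (pj.2 + 1))))
      (tag (pj.2 + 1) m) (aux.map (tag (pj.2 + 1))))) R

theorem fresh_graft_copy {L : List Link} {m : ℕ} {aux : List ℕ} {p i j : ℕ} (hij : i ≠ j)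
    {ys : List ℕ} {R : List Link} (h : FreshFor (copyNames j) ys R) :
    FreshFor (copyNames j) ys (R.flatMap (Link.graft (tag 0 p)
      (L.map (Link.rename (tag (i + 1)))) (tag (i + 1) m) (aux.map (tag (i + 1))))) := by
  refine h.graft (disjoint_copyNames hij) names_mem_copyNames ⟨m, rfl⟩ fun x hx => ?_
  obtain ⟨y, _, rfl⟩ := List.mem_map.1 hx
  exact ⟨y, rfl⟩

/-- The situation before the grafts of copies of a box. -/
structure GraftReady (L : List Link) (m : ℕ) (aux : List ℕ) (O : Multiset Edge)
    (qs : List (ℕ × ℕ)) (R : List Link) : Prop where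
  good : Struct.Good ⟨L, [m], aux⟩
  isModule : IsModule R (qs.map fun q => bundle (tag 0 q.1) (aux.map (tag (q.2 + 1))))
    (strs (qs.flatMap fun q => aux.map (tag (q.2 + 1)))) (strs (qs.map fun q => tag 0 q.1) + O)
  boxes : BoxesGood R
  nodup : (qs.map Prod.snd).Nodup
  fresh : ∀ q ∈ qs, FreshFor (copyNames q.2) (aux.map (tag (q.2 + 1))) R

namespace GraftReady

variable {L : List Link} {m : ℕ} {aux : List ℕ} {O : Multiset Edge} {qs : List (ℕ × ℕ)}
  {R : List Link} {q : ℕ × ℕ}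

theorem mem_conc (h : GraftReady L m aux O (q :: qs) R) : Edge.structural (tag 0 q.1) ∈ conc R := by
  have : Edge.structural (tag 0 q.1) ∈ prem R + (strs ((q :: qs).map fun q => tag 0 q.1) + O) := by
    simp
  rw [← h.isModule.bal] at this
  simpa [tag_inj] using this

theorem notMem_prem (h : GraftReady L m aux O (q :: qs) R) :
    Edge.structural (tag 0 q.1) ∉ prem R := fun hp =>
  Multiset.disjoint_left.1 (Multiset.nodup_add.1 h.isModule.nodup_prem_add).2.2 hp (by simp)

theorem ne_snd (h : GraftReady L m aux O (q :: qs) R) {q' : ℕ × ℕ} (hq' : q' ∈ qs) :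
    q.2 ≠ q'.2 := by
  have := h.nodup
  rw [List.map_cons, List.nodup_cons] at this
  exact fun he => this.1 (List.mem_map.2 ⟨q', hq', he.symm⟩)

theorem ne_fst (h : GraftReady L m aux O (q :: qs) R) {q' : ℕ × ℕ} (hq' : q' ∈ qs) :
    q.1 ≠ q'.1 := by
  intro he
  have := (Multiset.nodup_add.1 (Multiset.nodup_add.1 h.isModule.nodup_prem_add).2.1).1
  rw [List.map_cons, strs_cons] at this
  refine Multiset.disjoint_left.1 (Multiset.nodup_add.1 this).2.2 (Multiset.mem_singleton_self _) ?_
  exact mem_strs.2 ⟨_, List.mem_map.2 ⟨q', hq', rfl⟩, by rw [he]⟩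

/-- Grafting one copy consumes one bundle and its auxiliary edges. The other bundles stay outside
the names of this copy because the indices differ. -/
theorem step (h : GraftReady L m aux O (q :: qs) R) :
    GraftReady L m aux O qs (R.flatMap (Link.graft (tag 0 q.1)
      (L.map (Link.rename (tag (q.2 + 1)))) (tag (q.2 + 1) m) (aux.map (tag (q.2 + 1))))) := by
  have hne := fun q' => h.ne_snd (q' := q')
  have hp := h.mem_conc
  have hR := h.isModule
  have hcopy := h.good.rename (tag_injective (q.2 + 1))
  simp only [List.map_cons, List.flatMap_cons, strs_append, strs_cons] at hR
  rw [add_assoc] at hR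
  refine ⟨h.good, hR.graft hp hcopy.isModule_box names_mem_copyNames (h.fresh q (by simp)) ?_ ?_,
    h.boxes.graft hcopy names_mem_copyNames (h.fresh q (by simp)),
    (List.nodup_cons.1 h.nodup).2, fun q' hq' =>
      fresh_graft_copy (hne q' hq') (h.fresh q' (by simp [hq']))⟩
  · intro x hx
    obtain ⟨n, hn, rfl⟩ := mem_strs.1 hx
    obtain ⟨q', hq', hn⟩ := List.mem_flatMap.1 hn
    obtain ⟨y, _, rfl⟩ := List.mem_map.1 hn
    rw [Edge.name, tag_mem_copyNames]
    have := hne q' hq'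
    omega
  · intro H hH x hx
    obtain ⟨q', hq', rfl⟩ := List.mem_map.1 hH
    have := hne q' hq'
    rcases hx with rfl | hx
    · rw [Edge.name, tag_mem_copyNames]; omega
    · obtain ⟨n, hn, rfl⟩ := mem_strs.1 hx
      obtain ⟨y, _, rfl⟩ := List.mem_map.1 hn
      rw [Edge.name, tag_mem_copyNames]
      omega

theorem grafts (h : GraftReady L m aux O qs R) : GraftReady L m aux O [] (grafts L m aux qs R) := by
  induction qs generalizing R with
  | nil => exact h
  | cons q qs ih => exact ih h.step

end GraftReady

/-- All original names carry the tag `0`. A name with tag `j + 1` can arise only where a `?`-link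
has received the copies of an edge of `aux`. -/
theorem fresh_substWhy_copies (k : ℕ) (aux : List ℕ) (R : List Link) (j : ℕ) :
    FreshFor (copyNames j) (aux.map (tag (j + 1)))
      (R.map (Link.substWhy (tag 0) (Struct.copies k aux))) := by
  constructor
  · intro l' hl' x hx hN
    obtain ⟨l, _, rfl⟩ := List.mem_map.1 hl'
    rw [Link.premises_substWhy, Link.conclusions_substWhy] at hx
    rcases hx with hx | hx
    · obtain ⟨y, _, hx⟩ := List.mem_flatMap.1 hx
      cases y with
      | logical n =>
        obtain rfl : x = _ := by simpa [Edge.subst] using hx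
        rw [Edge.name, tag_mem_copyNames] at hN
        omega
      | structural s =>
        obtain ⟨n, hn, rfl⟩ := List.mem_map.1 hx
        rw [Edge.name] at hN
        rcases mem_copies.1 hn with ⟨hs, i, _, rfl⟩ | ⟨_, rfl⟩ <;> rw [tag_mem_copyNames] at hN
        · rw [hN]; exact mem_strs.2 ⟨_, List.mem_map_of_mem hs, rfl⟩
        · omega
    · obtain ⟨y, _, rfl⟩ := List.mem_map.1 hx
      rw [Edge.name_map, tag_mem_copyNames] at hN
      omega
  · intro c L m aux' hl l1 hl1 n hn
    obtain ⟨l, _, he⟩ := List.mem_map.1 hl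
    cases l <;> simp only [Link.substWhy, Link.rename, Link.bang.injEq, reduceCtorEq] at he
    obtain ⟨rfl, rfl, rfl, rfl⟩ := he
    obtain ⟨l2, _, rfl⟩ := List.mem_map.1 hl1
    rw [Link.names_rename] at hn
    obtain ⟨y, _, rfl⟩ := List.mem_map.1 hn
    rw [tag_mem_copyNames]
    omega

/-- The copied auxiliary edges form a doubly indexed family; bundles enumerate it by copies of the
box, substitution by auxiliary conclusions. -/
theorem flatMap_copies (k : ℕ) (aux ps : List ℕ) (hk : k = ps.length) :
    (ps.zipIdx.flatMap fun q => aux.map (tag (q.2 + 1))).Perm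
      (aux.flatMap (Struct.copies k aux)) := by
  have h1 : (ps.zipIdx.flatMap fun q => aux.map (tag (q.2 + 1))) =
      (List.range k).flatMap fun j => aux.map (tag (j + 1)) := by
    rw [hk, List.range_eq_range', ← List.zipIdx_map_snd 0 ps, List.flatMap_map]
  have h2 : aux.flatMap (Struct.copies k aux) =
      aux.flatMap fun s => (List.range k).map fun j => tag (j + 1) s :=
    List.flatMap_congr fun s hs => by simp [Struct.copies, hs]
  rw [h1, h2, ← Multiset.coe_eq_coe]
  have := Multiset.bind_bind (List.range k : Multiset ℕ) (aux : Multiset ℕ)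
    (f := fun j s => ({tag (j + 1) s} : Multiset ℕ))
  simp only [Multiset.bind_singleton, Multiset.map_coe] at this
  rwa [Multiset.coe_bind, Multiset.coe_bind] at this

-- Correctness for exponential cuts

theorem coe_conclusions_bang (c : ℕ) (L : List Link) (m : ℕ) (aux : List ℕ) :
    ((Link.bang c L m aux).conclusions : Multiset Edge) = {.logical c} + strs aux := by
  simp [Link.conclusions, strs]

theorem coe_premises_why (ps : List ℕ) (c : ℕ) :
    ((Link.why ps c).premises : Multiset Edge) = strs ps := rfl

theorem Correct.tail {l : Link} {T : List Link} {Es : List (Set Edge)} (h : Correct (l :: T) Es)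
    (hl : l ∉ T) : Correct T Es := fun k hk =>
  (forest_cons.1 ((h.cons hl (H := ∅) ⟨by simp, by simp⟩ k hk).perm
    (List.perm_middle (l₁ := T.map k)))).1

/-- The situation of a cut between a `!`-link and a `?`-link. -/
theorem IsModule.exp_cut {c w m : ℕ} {L R : List Link} {aux ps : List ℕ} {t : Link}
    {O : Multiset Edge} (ht : t = .cut c w ∨ t = .cut w c)
    (h : IsModule (.bang c L m aux :: .why ps w :: t :: R) [] 0 O) :
    strs aux + conc R = strs ps + (prem R + O) ∧ (∀ s ∈ aux, s ∉ ps) ∧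
    (∀ s, Edge.structural s ∈ conc R → s ∉ aux) ∧
    Edge.logical c ≠ .logical w ∧ Correct R [] ∧ ∀ p ∈ ps, Correct R
      [{.logical c, .logical w}, {.structural p, .logical w},
        insert (.logical c) {x | x ∈ strs aux}] := by
  have hnd := h.nodup
  have hbal := h.bal
  have htp : (t.premises : Multiset Edge) = {.logical c} + {.logical w} := by
    rcases ht with rfl | rfl
    · rfl
    · rw [add_comm]; rfl
  have htc : (t.conclusions : Multiset Edge) = 0 := by
    rcases ht with rfl | rfl <;> rfl
  have hwc : ((Link.why ps w).conclusions : Multiset Edge) = {.logical w} := rfl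
  have hbp : ((Link.bang c L m aux).premises : Multiset Edge) = 0 := rfl
  simp only [conc_cons, prem_cons, htp, htc, hwc, hbp, coe_conclusions_bang, coe_premises_why,
    zero_add, add_zero] at hnd hbal
  have hn1 := h.nodup_links
  simp only [List.nodup_cons, List.mem_cons, not_or] at hn1
  have hcw : Edge.logical c ≠ .logical w := by
    intro he
    rw [he, show {Edge.logical w} + strs aux + ({Edge.logical w} + conc R) =
      {Edge.logical w} + ({Edge.logical w} + (strs aux + conc R)) by abel] at hnd
    exact Multiset.disjoint_left.1 (Multiset.nodup_add.1 hnd).2.2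
      (Multiset.mem_singleton_self _) (by simp)
  have hcorr : ∀ p ∈ ps, Correct R [{.logical c, .logical w}, {.structural p, .logical w},
        insert (.logical c) {x | x ∈ strs aux}] := by
    intro p hp
    refine ((h.correct.cons (by simp [hn1]) ?_).cons (by simp [hn1]) ?_).cons (by simp [hn1]) ?_
    · exact ⟨by simp [Link.premises, Link.conclusions], fun h => h.elim⟩
    · refine ⟨by simp [Link.premises, Link.conclusions, hp], fun _ x hx y hy hx' hy' => ?_⟩
      obtain ⟨x, _, rfl⟩ := List.mem_map.1 hx
      obtain ⟨y, _, rfl⟩ := List.mem_map.1 hy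
      simp only [Set.mem_insert_iff, Set.mem_singleton_iff, reduceCtorEq, or_false] at hx' hy'
      rw [hx', hy']
    · rcases ht with rfl | rfl
      · exact ⟨by simp [Link.premises, Link.conclusions], fun h => h.elim⟩
      · exact ⟨by simp [Link.premises, Link.conclusions], fun h => h.elim⟩
  refine ⟨?_, fun s hs hp => ?_, fun s hs hsa => ?_, hcw,
    ((h.correct.tail (by simp [hn1])).tail (by simp [hn1])).tail (by simp [hn1]), hcorr⟩
  · have : ({Edge.logical c} + {.logical w}) + (strs aux + conc R) =
        ({Edge.logical c} + {.logical w}) + (strs ps + (prem R + O)) := by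
      calc _ = {Edge.logical c} + strs aux + ({Edge.logical w} + conc R) := by abel
        _ = _ := hbal
        _ = _ := by abel
    exact add_left_cancel this
  -- With all other links switched off, an edge leading directly from the `!`-link to the `?`-link
  -- would close a cycle with the cut.
  · have h1 := (forest_append.1 (hcorr s hp (fun _ => ∅) fun l _ => ⟨by simp, by simp⟩)).2.1
    refine (forest_cons.1 h1).2 _ (by simp) _ (by simp) hcw ?_
    refine Conn.trans (y := .structural s) ?_ ?_
    · exact Conn.of_mem (H := insert (.logical c) {x | x ∈ strs aux}) (by simp) (.inl rfl)
        (.inr (mem_strs.2 ⟨s, hs, rfl⟩))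
    · exact Conn.of_mem (H := {.structural s, .logical w}) (by simp) (by simp) (by simp)
  · rw [show {Edge.logical c} + strs aux + ({Edge.logical w} + conc R) =
      {Edge.logical c} + ({Edge.logical w} + (strs aux + conc R)) by abel] at hnd
    have := (Multiset.nodup_add.1 (Multiset.nodup_add.1 (Multiset.nodup_add.1 hnd).2.1).2.1).2.2
    exact Multiset.disjoint_left.1 this (mem_strs.2 ⟨s, hsa, rfl⟩) hs

/-- Removing the three links of the redex leaves the auxiliary edges in components distinct from one
another and from those of the premises of the `?`-link, since the removed links connected them.
Hence each premise may receive its bundle of copied auxiliary edges. Up to the identification of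
copies, a switching after the duplication is one before it. -/
theorem isModule_exp {c w m : ℕ} {L R : List Link} {aux ps : List ℕ} {t : Link}
    {O : Multiset Edge} (ht : t = .cut c w ∨ t = .cut w c)
    (h : IsModule (.bang c L m aux :: .why ps w :: t :: R) [] 0 O) :
    IsModule (R.map (Link.substWhy (tag 0) (Struct.copies ps.length aux)))
      (ps.zipIdx.map fun q => bundle (tag 0 q.1) (aux.map (tag (q.2 + 1))))
      (strs (ps.zipIdx.flatMap fun q => aux.map (tag (q.2 + 1))))
      (strs (ps.zipIdx.map fun q => tag 0 q.1) +
        O.bind (substs (tag 0) (Struct.copies ps.length aux))) := by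
  obtain ⟨hbal, hap, hca, hcw, hcR, hcorr⟩ := h.exp_cut ht
  set k := ps.length with hk
  have hr := isRenaming_copies k aux
  have hc : ∀ s, Edge.structural s ∈ conc R → Struct.copies k aux s = [tag 0 s] := fun s hs => by
    simp [Struct.copies, hca s hs]
  have hlR : ∀ l ∈ R, ∀ x ∈ l.premises, x ∉ l.conclusions := fun l hl =>
    h.loopless l (by simp [hl])
  have hpR : (prem R).Nodup := by
    have := h.nodup_prem
    simp only [prem_cons, ← add_assoc] at this
    exact (Multiset.nodup_add.1 this).2.1
  have hnR : (strs aux + conc R).Nodup := by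
    have := h.nodup_conc
    simp only [conc_cons, coe_conclusions_bang] at this
    refine Multiset.nodup_of_le ?_ this
    rw [add_assoc]
    refine (add_le_add_right ?_ _).trans (Multiset.le_add_left _ _)
    rw [← add_assoc]
    exact Multiset.le_add_left _ _
  have hI : strs (ps.zipIdx.flatMap fun q => aux.map (tag (q.2 + 1))) =
      (strs aux).bind (substs (tag 0) (Struct.copies k aux)) := by
    rw [strs_bind]
    exact Multiset.coe_eq_coe.2 ((flatMap_copies k aux ps hk).map _)
  have hps : strs (ps.zipIdx.map fun q => tag 0 q.1) =
      (strs ps).bind (substs (tag 0) (Struct.copies k aux)) := by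
    rw [strs_bind]
    have h1 : ps.flatMap (Struct.copies k aux) = ps.map (tag 0) := by
      rw [List.map_eq_flatMap]
      exact List.flatMap_congr fun s hs => by
        simp [Struct.copies, show s ∉ aux from fun h => hap s h hs]
    have h2 : (ps.zipIdx.map fun q => tag 0 q.1) = ps.map (tag 0) := by
      conv_rhs => rw [← List.zipIdx_map_fst 0 ps]
      rw [List.map_map]; rfl
    rw [h1, h2]
  refine ⟨?_, ?_, loopless_substWhy hr hc hlR, fun h' hh' => ?_⟩
  · rw [conc_substWhy hc, hI, ← Multiset.add_bind, add_comm]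
    exact hr.nodup_bind hnR
  · rw [conc_substWhy hc, prem_substWhy, hI, hps, ← Multiset.add_bind, ← Multiset.add_bind,
      ← Multiset.add_bind, add_comm, hbal]
    congr 1
    abel
  · obtain ⟨ρ, g, hg, hρ, hgρ, hinj⟩ := exists_switching_substWhy hr hpR hc hlR hh'
    have himg := forest_substWhy hgρ
    set Hs := (R.map (Link.substWhy (tag 0) (Struct.copies k aux))).map h' with hHs
    refine Forest.perm List.perm_append_comm ?_
    have hF : Forest Hs := Forest.of_image (ρ := ρ) hinj (by
      rw [himg]
      have := hcR g hg
      rwa [List.append_nil] at this)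
    have hconn : ∀ x y, x ≠ y → Conn Hs x y → ρ x ≠ ρ y ∧ Conn (R.map g) (ρ x) (ρ y) := by
      intro x y hxy hcon
      have hmem : ∀ x y, x ≠ y → Conn Hs x y → ∃ H ∈ Hs, x ∈ H := by
        intro x y hxy hcon
        by_contra hcontra
        push Not at hcontra
        exact not_conn_of_notMem hxy hcontra hcon
      refine ⟨fun he => hxy (hinj (hmem x y hxy hcon) (hmem y x hxy.symm hcon.symm) he), ?_⟩
      rw [← himg]
      exact hcon.image ρ
    -- The redex connects `s` to every other auxiliary edge through the `!`-link, and to every `p`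
    -- through the `!`-link, the cut and the `?`-link. A second connection in the context is
    -- therefore impossible.
    have hnot : ∀ s ∈ aux, ∀ p ∈ ps, ∀ y, Edge.structural s ≠ y → (y ∈ strs aux ∨ y ∈ strs ps) →
        ¬ Conn (R.map g) (.structural s) y := by
      intro s hs p hp y hsy hy
      have hx := mem_strs.2 ⟨s, hs, rfl⟩
      rcases hy with hy | hy
      · refine Forest.not_conn ((hcorr p hp g hg).perm List.perm_append_comm) hsy ?_
        exact Conn.of_mem (H := insert (.logical c) {x | x ∈ strs aux}) (by simp) (.inr hx) (.inr hy)
      · obtain ⟨p, hp, rfl⟩ := mem_strs.1 hy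
        refine Forest.not_conn ((hcorr p hp g hg).perm List.perm_append_comm) hsy ?_
        refine Conn.trans (y := .logical c) ?_ (Conn.trans (y := .logical w) ?_ ?_)
        · exact Conn.of_mem (H := insert (.logical c) {x | x ∈ strs aux}) (by simp) (.inr hx)
            (.inl rfl)
        · exact Conn.of_mem (H := {.logical c, .logical w}) (by simp) (by simp) (by simp)
        · exact Conn.of_mem (H := {.structural p, .logical w}) (by simp) (by simp) (by simp)
    -- The bunches have pairwise distinct tags. A connection between points to be attached would
    -- project along `ρ` to one that `hnot` forbids.
    have hatt := hF.attach (ps.zipIdx.map fun q =>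
      (Edge.structural (tag 0 q.1), {x | x ∈ strs (aux.map (tag (q.2 + 1)))})) ?_ ?_
    · rw [List.map_map] at hatt
      exact hatt
    · rw [List.pairwise_map]
      have hnd : (ps.zipIdx.map Prod.snd).Nodup := by
        rw [List.zipIdx_map_snd]; exact List.nodup_range'
      rw [List.Nodup, List.pairwise_map] at hnd
      refine hnd.imp fun hne => Set.disjoint_left.2 fun x hx hy => hne ?_
      obtain ⟨n, hn, rfl⟩ := mem_strs.1 hx
      obtain ⟨n', hn', he⟩ := mem_strs.1 hy
      obtain rfl := Edge.structural.inj he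
      obtain ⟨a, _, rfl⟩ := List.mem_map.1 hn
      obtain ⟨b, _, he⟩ := List.mem_map.1 hn'
      have := (tag_inj.1 he).1
      omega
    · have hcopy : ∀ q ∈ ps.zipIdx, ∀ n ∈ aux.map (tag (q.2 + 1)), ∃ s ∈ aux,
          n = tag (q.2 + 1) s ∧ ρ (.structural n) = .structural s := by
        intro q hq n hn
        obtain ⟨s, hs, rfl⟩ := List.mem_map.1 hn
        refine ⟨s, hs, rfl, hρ _ _ (List.mem_map_of_mem (mem_copies.2 (.inl ⟨hs, q.2, ?_, rfl⟩)))⟩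
        have := List.snd_lt_add_of_mem_zipIdx hq
        omega
      intro b hb x hx b' hb'
      obtain ⟨q, hq, rfl⟩ := List.mem_map.1 hb
      obtain ⟨q', hq', rfl⟩ := List.mem_map.1 hb'
      obtain ⟨n, hn, rfl⟩ := mem_strs.1 hx
      obtain ⟨s, hs, rfl, hρs⟩ := hcopy q hq n hn
      have hp : q'.1 ∈ ps := List.fst_mem_of_mem_zipIdx hq'
      constructor
      · intro hcon
        have hρp : ρ (.structural (tag 0 q'.1)) = .structural q'.1 := hρ _ _
          (List.mem_map_of_mem (mem_copies.2 (.inr ⟨fun h => hap _ h hp, rfl⟩)))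
        have := hconn _ _ (by simp [tag_inj]) hcon
        rw [hρs, hρp] at this
        exact hnot s hs _ hp _ this.1 (.inr (mem_strs.2 ⟨_, hp, rfl⟩)) this.2
      · intro y hy hne hcon
        obtain ⟨n', hn', rfl⟩ := mem_strs.1 hy
        obtain ⟨s', hs', rfl, hρs'⟩ := hcopy q' hq' n' hn'
        have := hconn _ _ hne hcon
        rw [hρs, hρs'] at this
        exact hnot s hs _ hp _ this.1 (.inl (mem_strs.2 ⟨_, hs', rfl⟩)) this.2

theorem BoxesGood.perm {T T' : List Link} (h : BoxesGood T) (hp : T.Perm T') : BoxesGood T' :=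
  fun c L m aux hl => h c L m aux (hp.mem_iff.2 hl)

theorem Struct.Good.of_boxesGood {T : List Link} {C aux : List ℕ}
    (h : IsModule T [] 0 (Struct.outputs ⟨T, C, aux⟩)) (hb : BoxesGood T) :
    Struct.Good ⟨T, C, aux⟩ := ⟨_, h, hb⟩

theorem Struct.graftReady {S : Struct} (hS : S.Good) {c w m : ℕ} {L : List Link} {aux ps : List ℕ}
    {t : Link} {R : List Link} (ht : t = .cut c w ∨ t = .cut w c)
    (h : S.links.Perm (.bang c L m aux :: .why ps w :: t :: R)) :
    GraftReady L m aux (S.outputs.bind (substs (tag 0) (Struct.copies ps.length aux))) ps.zipIdx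
      (R.map (Link.substWhy (tag 0) (Struct.copies ps.length aux))) := by
  have hb := hS.boxesGood.perm h
  have hR : BoxesGood R := fun c L m aux hl => hb c L m aux (by simp [hl])
  exact ⟨hb c L m aux (by simp), isModule_exp ht (hS.isModule.perm h),
    hR.substWhy (tag_injective 0), by rw [List.zipIdx_map_snd]; exact List.nodup_range',
    fun q _ => fresh_substWhy_copies _ _ _ _⟩

theorem Struct.good_exp {S : Struct} (hS : S.Good) {c w m : ℕ} {L : List Link} {aux ps : List ℕ}
    {t : Link} {R : List Link} (ht : t = .cut c w ∨ t = .cut w c)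
    (h : S.links.Perm (.bang c L m aux :: .why ps w :: t :: R)) :
    Struct.Good ⟨Struct.dispatch L m aux ps R, S.concl.map (tag 0),
      S.aux.flatMap (Struct.copies ps.length aux)⟩ := by
  have := (Struct.graftReady hS ht h).grafts
  refine Struct.Good.of_boxesGood ?_ this.boxes
  rw [← outputs_bind]
  have hm := this.isModule
  simp only [List.map_nil, List.flatMap_nil, show strs [] = 0 from rfl, zero_add] at hm
  exact hm

/-- At the level of the surrounding links, a step inside a box only changes the family of auxiliary
conclusions. A kept auxiliary edge is sent back to its origin, so that no more connections arise
than the old `!`-link allowed. -/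
theorem IsModule.box {c m m' : ℕ} {L L' R : List Link} {aux aux' : List ℕ} {f : ℕ → ℕ}
    {σ : ℕ → List ℕ} {O : Multiset Edge} (hr : IsRenaming f σ)
    (hσ : ∀ s, s ∉ aux → σ s = [f s]) (haux : aux' = aux.flatMap σ)
    (h : IsModule (.bang c L m aux :: R) [] 0 O) :
    IsModule (.bang (f c) L' m' aux' :: R.map (Link.substWhy f σ)) [] 0
      (O.bind (substs f σ)) := by
  have hnd := h.nodup
  have hbal := h.bal
  have hlB := (List.nodup_cons.1 h.nodup_links).1
  have hbp : ∀ c L m aux, ((Link.bang c L m aux).premises : Multiset Edge) = 0 :=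
    fun _ _ _ _ => rfl
  simp only [conc_cons, prem_cons, hbp, coe_conclusions_bang, zero_add, add_zero] at hnd hbal
  have hca : ∀ s, Edge.structural s ∈ conc R → σ s = [f s] := by
    intro s hs
    refine hσ s fun hsa => ?_
    rw [add_assoc] at hnd
    exact Multiset.disjoint_left.1 (Multiset.nodup_add.1 (Multiset.nodup_add.1 hnd).2.1).2.2
      (mem_strs.2 ⟨s, hsa, rfl⟩) hs
  have hpR : (prem R).Nodup := by
    have := h.nodup_prem
    rwa [prem_cons, hbp, zero_add] at this
  have hlR : ∀ l ∈ R, ∀ x ∈ l.premises, x ∉ l.conclusions := fun l hl =>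
    h.loopless l (by simp [hl])
  have hcc : {Edge.logical (f c)} + strs aux' + conc (R.map (Link.substWhy f σ)) =
      ({Edge.logical c} + strs aux + conc R).bind (substs f σ) := by
    rw [conc_substWhy hca, Multiset.add_bind, Multiset.add_bind, strs_bind, haux]
    rfl
  refine ⟨?_, ?_, ?_, fun h' hh' => ?_⟩
  · rw [conc_cons, coe_conclusions_bang, add_zero, hcc]
    exact hr.nodup_bind hnd
  · rw [conc_cons, coe_conclusions_bang, add_zero, hcc, prem_cons, hbp, zero_add, prem_substWhy,
      ← Multiset.add_bind, hbal]
  · intro l hl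
    rcases List.mem_cons.1 hl with rfl | hl
    · simp [Link.premises]
    · exact loopless_substWhy hr hca hlR l hl
  · obtain ⟨ρ, g, hg, hρ, hgρ, hinj⟩ := exists_switching_substWhy hr hpR hca hlR
      fun l hl => hh' l (by simp [hl])
    have himg := forest_substWhy hgρ
    rw [List.append_nil, List.map_cons]
    have hH := (hh' _ List.mem_cons_self).bang
    set H := h' (.bang (f c) L' m' aux')
    set Hs := (R.map (Link.substWhy f σ)).map h' with hHs
    have hf := h.correct.cons hlB (H := insert (.logical c) {x | x ∈ strs aux})
      ⟨by simp [Link.premises, Link.conclusions], fun h => h.elim⟩ g hg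
    have hf' := forest_cons.1 (hf.perm List.perm_append_comm)
    rw [← himg] at hf'
    have hρH : ∀ x ∈ H, ρ x ∈ insert (Edge.logical c) {x | x ∈ strs aux} := by
      intro x hx
      rcases hH hx with rfl | hx
      · rw [hρ _ (.logical c) (by simp [Edge.subst])]; exact .inl rfl
      · obtain ⟨n, hn, rfl⟩ := mem_strs.1 hx
        rw [haux] at hn
        obtain ⟨s, hs, hn⟩ := List.mem_flatMap.1 hn
        rw [hρ _ (.structural s) (List.mem_map_of_mem hn)]
        exact .inr (mem_strs.2 ⟨s, hs, rfl⟩)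
    refine forest_cons.2 ⟨Forest.of_image hinj hf'.1, fun x hx y hy hxy hcon => ?_⟩
    have hmem : ∀ x y, x ≠ y → Conn Hs x y → ∃ H ∈ Hs, x ∈ H := by
      intro x y hxy hcon
      by_contra hcontra
      push Not at hcontra
      exact not_conn_of_notMem hxy hcontra hcon
    exact hf'.2 _ (hρH x hx) _ (hρH y hy)
      (fun he => hxy (hinj (hmem x y hxy hcon) (hmem y x hxy.symm hcon.symm) he)) (hcon.image ρ)

-- Correctness for the other cuts and for arbitrary steps

theorem coe_premises_cut {a b : ℕ} {t : Link} (ht : t = .cut a b ∨ t = .cut b a) :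
    (t.premises : Multiset Edge) = {.logical a} + {.logical b} := by
  rcases ht with rfl | rfl
  · rfl
  · rw [add_comm]; rfl

theorem coe_conclusions_cut {a b : ℕ} {t : Link} (ht : t = .cut a b ∨ t = .cut b a) :
    (t.conclusions : Multiset Edge) = 0 := by
  rcases ht with rfl | rfl <;> rfl

theorem sw_cut {a b : ℕ} {t : Link} (ht : t = .cut a b ∨ t = .cut b a) :
    t.Sw {.logical a, .logical b} := by
  rcases ht with rfl | rfl
  · exact ⟨by simp [Link.premises, Link.conclusions], fun h => h.elim⟩
  · exact ⟨by simp [Link.premises, Link.conclusions], fun h => h.elim⟩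

/-- The two choices for the `⅋`-link show that neither `a` nor `b` is connected in the context to
`a'` or `b'`, and the `⊗`-link separates `a` from `b`. The edges `a'` and `b'` may be connected, but
the two new cuts still close no cycle. -/
theorem IsModule.mult {a b c a' b' c' : ℕ} {t : Link} {R : List Link} {O : Multiset Edge}
    (ht : t = .cut c c' ∨ t = .cut c' c)
    (h : IsModule (.tens a b c :: .par a' b' c' :: t :: R) [] 0 O) :
    IsModule (.cut a a' :: .cut b b' :: R) [] 0 O := by
  have hnd := h.nodup
  have hbal := h.bal
  have hn1 := h.nodup_links
  have hnp := h.nodup_prem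
  simp only [List.nodup_cons, List.mem_cons, not_or] at hn1
  have h1 : ((Link.tens a b c).premises : Multiset Edge) = {.logical a} + {.logical b} := rfl
  have h2 : ((Link.par a' b' c').premises : Multiset Edge) = {.logical a'} + {.logical b'} := rfl
  have h3 : ((Link.tens a b c).conclusions : Multiset Edge) = {.logical c} := rfl
  have h4 : ((Link.par a' b' c').conclusions : Multiset Edge) = {.logical c'} := rfl
  have h5 : ∀ a b, ((Link.cut a b).conclusions : Multiset Edge) = 0 := fun _ _ => rfl
  have h6 : ∀ a b, ((Link.cut a b).premises : Multiset Edge) = {.logical a} + {.logical b} :=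
    fun _ _ => rfl
  simp only [conc_cons, prem_cons, coe_premises_cut ht, coe_conclusions_cut ht, h1, h2, h3, h4,
    zero_add, add_zero] at hnd hbal hnp
  have key : conc R = {Edge.logical a} + {Edge.logical a'} +
      ({Edge.logical b} + {Edge.logical b'}) + prem R + O := by
    have : ({Edge.logical c} + {.logical c'}) + conc R = ({Edge.logical c} + {.logical c'}) +
        ({Edge.logical a} + {Edge.logical a'} +
          ({Edge.logical b} + {Edge.logical b'}) + prem R + O) := by
      rw [add_assoc, hbal]; abel
    exact add_left_cancel this
  refine ⟨?_, ?_, fun l hl => ?_, fun k hk => ?_⟩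
  · simp only [conc_cons, h5, zero_add, add_zero]
    rw [← add_assoc] at hnd
    exact (Multiset.nodup_add.1 hnd).2.1
  · simp only [conc_cons, prem_cons, h5, h6, zero_add, add_zero]
    rw [key]; abel
  · rcases List.mem_cons.1 hl with rfl | hl
    · simp [Link.conclusions]
    rcases List.mem_cons.1 hl with rfl | hl
    · simp [Link.conclusions]
    · exact h.loopless l (by simp [hl])
  · have hcorr : ∀ x, x = Edge.logical a' ∨ x = .logical b' →
        Forest ([{.logical c, .logical c'}, {x, .logical c'},
          {.logical a, .logical b, .logical c}] ++ R.map k) := by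
      intro x hx
      have := ((h.correct.cons (by simp [hn1]) (H := {.logical a, .logical b, .logical c}) ?_).cons
        (by simp [hn1]) (H := {x, .logical c'}) ?_).cons (by simp [hn1]) (sw_cut ht)
      · exact (this k fun l hl => hk l (by simp [hl])).perm List.perm_append_comm
      · exact ⟨by simp [Link.premises, Link.conclusions], fun h => h.elim⟩
      · constructor
        · rintro y (rfl | rfl)
          · rcases hx with rfl | rfl <;> simp [Link.premises]
          · exact .inr (by simp [Link.conclusions])
        · intro _ y hy z hz hy' hz'
          have hl := h.loopless (.par a' b' c') (by simp)
          have : ∀ y ∈ (Link.par a' b' c').premises, y ∈ ({x, .logical c'} : Set Edge) → y = x := by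
            rintro y hy (rfl | rfl)
            · rfl
            · exact absurd (by simp [Link.conclusions]) (hl _ hy)
          rw [this y hy hy', this z hz hz']
    have hne : Edge.logical a ≠ .logical b ∧ Edge.logical a ≠ .logical a' ∧
        Edge.logical a ≠ .logical b' ∧ Edge.logical b ≠ .logical a' ∧
        Edge.logical b ≠ .logical b' := by
      have : ([Edge.logical a, .logical b, .logical a', .logical b'] : List Edge).Nodup := by
        rw [← Multiset.coe_nodup]
        refine Multiset.nodup_of_le ?_ hnp
        rw [← add_assoc]
        exact Multiset.le_add_right _ _
      simp only [List.nodup_cons, List.mem_cons, not_or, List.not_mem_nil, or_false] at this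
      tauto
    have hab : ¬ Conn (R.map k) (.logical a) (.logical b) :=
      (hcorr (.logical a') (.inl rfl)).not_conn hne.1
        (Conn.of_mem (H := {.logical a, .logical b, .logical c}) (by simp) (by simp) (by simp))
    have hx : ∀ y, y = Edge.logical a ∨ y = .logical b → ∀ x, x = Edge.logical a' ∨ x = .logical b' →
        y ≠ x → ¬ Conn (R.map k) y x := by
      intro y hy x hx hyx
      refine (hcorr x hx).not_conn hyx ?_
      refine Conn.trans (y := .logical c) ?_ (Conn.trans (y := .logical c') ?_ ?_)
      · refine Conn.of_mem (H := {.logical a, .logical b, .logical c}) (by simp) ?_ (by simp)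
        rcases hy with rfl | rfl <;> simp
      · exact Conn.of_mem (H := {.logical c, .logical c'}) (by simp) (by simp) (by simp)
      · exact Conn.of_mem (H := {x, .logical c'}) (by simp) (by simp) (by simp)
    have haa := hx (.logical a) (.inl rfl) (.logical a') (.inl rfl) hne.2.1
    have hab' := hx (.logical a) (.inl rfl) (.logical b') (.inr rfl) hne.2.2.1
    have hbb := hx (.logical b) (.inr rfl) (.logical b') (.inr rfl) hne.2.2.2.2
    have hf : Forest ({.logical a, .logical a'} :: {.logical b, .logical b'} :: R.map k) := by
      have h1 : Forest ({.logical b, .logical b'} :: R.map k) := by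
        refine forest_cons.2 ⟨(forest_append.1 (hcorr _ (.inl rfl))).2.1, ?_⟩
        rintro x (rfl | rfl) y (rfl | rfl) hxy
        · exact absurd rfl hxy
        · exact hbb
        · exact fun h => hbb h.symm
        · exact absurd rfl hxy
      -- The cut between `b` and `b'` avoids the component of `a`, so it does not create the
      -- connection.
      have h2 : ¬ Conn ({.logical b, .logical b'} :: R.map k) (.logical a) (.logical a') := by
        refine not_conn_cons ?_ haa
        rintro z (rfl | rfl) hc
        · exact hab hc.symm
        · exact hab' hc.symm
      refine forest_cons.2 ⟨h1, ?_⟩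
      rintro x (rfl | rfl) y (rfl | rfl) hxy
      · exact absurd rfl hxy
      · exact h2
      · exact fun h => h2 h.symm
      · exact absurd rfl hxy
    rw [List.append_nil, List.map_cons, List.map_cons]
    exact hf.mono (.cons (hk _ (by simp)).cut (.cons (hk _ (by simp)).cut
      (List.forall₂_same.2 fun x _ => subset_rfl)))

theorem IsModule.unit {c c' : ℕ} {t : Link} {R : List Link} {O : Multiset Edge}
    (ht : t = .cut c c' ∨ t = .cut c' c)
    (h : IsModule (.one c :: .bot c' :: t :: R) [] 0 O) : IsModule R [] 0 O := by
  have hnd := h.nodup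
  have hbal := h.bal
  have hn1 := h.nodup_links
  simp only [List.nodup_cons, List.mem_cons, not_or] at hn1
  have h1 : ((Link.one c).premises : Multiset Edge) = 0 := rfl
  have h2 : ((Link.bot c').premises : Multiset Edge) = 0 := rfl
  have h3 : ((Link.one c).conclusions : Multiset Edge) = {.logical c} := rfl
  have h4 : ((Link.bot c').conclusions : Multiset Edge) = {.logical c'} := rfl
  simp only [conc_cons, prem_cons, coe_premises_cut ht, coe_conclusions_cut ht, h1, h2, h3, h4,
    zero_add, add_zero] at hnd hbal
  refine ⟨?_, ?_, fun l hl => h.loopless l (by simp [hl]),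
    ((h.correct.tail (by simp [hn1])).tail (by simp [hn1])).tail (by simp [hn1])⟩
  · rw [← add_assoc] at hnd
    rw [add_zero]
    exact (Multiset.nodup_add.1 hnd).2.1
  · rw [← add_assoc, add_assoc ({Edge.logical c} + {Edge.logical c'})] at hbal
    rw [add_zero]
    exact add_left_cancel hbal

namespace Link

theorem premises_renamePremises (f : ℕ → ℕ) (l : Link) :
    (l.renamePremises f).premises = l.premises.map fun x => match x with
      | .logical n => .logical (f n)
      | .structural s => .structural s := by
  cases l <;> simp [renamePremises, premises]

theorem conclusions_renamePremises (f : ℕ → ℕ) (l : Link) :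
    (l.renamePremises f).conclusions = l.conclusions := by
  cases l <;> simp [renamePremises, conclusions]

theorem exclusive_renamePremises (f : ℕ → ℕ) (l : Link) :
    (l.renamePremises f).Exclusive ↔ l.Exclusive := by
  cases l <;> simp [renamePremises, Exclusive]

end Link

theorem prem_renamePremises (f : ℕ → ℕ) (R : List Link) :
    prem (R.map (Link.renamePremises f)) = (prem R).map fun x => match x with
      | .logical n => .logical (f n)
      | .structural s => .structural s := by
  induction R with
  | nil => rfl
  | cons l R ih => simp [ih, Link.premises_renamePremises]

theorem conc_renamePremises (f : ℕ → ℕ) (R : List Link) :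
    conc (R.map (Link.renamePremises f)) = conc R := by
  induction R with
  | nil => rfl
  | cons l R ih => simp [ih, Link.conclusions_renamePremises]

/-- The axiom and the cut form a path from `a` to `c`. Eliminating them contracts this path, as the
map `ρ` sending `a` to `c` does. -/
theorem IsModule.ax {a b c : ℕ} {l t : Link} {R : List Link} {O : Multiset Edge}
    (hl : l = .ax a b ∨ l = .ax b a) (ht : t = .cut b c ∨ t = .cut c b)
    (h : IsModule (l :: t :: R) [] 0 O) :
    IsModule (R.map (Link.renamePremises fun n => if n = a then c else n)) [] 0
      (O.map fun x => match x with
        | .logical n => .logical (if n = a then c else n)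
        | .structural s => .structural s) := by
  have hnd := h.nodup
  have hbal := h.bal
  have hnp := h.nodup_prem_add
  have hn1 := h.nodup_links
  simp only [List.nodup_cons, List.mem_cons, not_or] at hn1
  have hlc : (l.conclusions : Multiset Edge) = {.logical a} + {.logical b} := by
    rcases hl with rfl | rfl
    · rfl
    · rw [add_comm]; rfl
  have hlp : (l.premises : Multiset Edge) = 0 := by rcases hl with rfl | rfl <;> rfl
  simp only [conc_cons, prem_cons, coe_premises_cut ht, coe_conclusions_cut ht, hlc, hlp,
    zero_add, add_zero] at hnd hbal hnp
  have hsl : l.Sw {.logical a, .logical b} := by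
    rcases hl with rfl | rfl
    · exact ⟨by simp [Link.premises, Link.conclusions], fun h => h.elim⟩
    · exact ⟨by simp [Link.premises, Link.conclusions], fun h => h.elim⟩
  have hcorr : Correct R [{.logical b, .logical c}, {.logical a, .logical b}] :=
    (h.correct.cons (by simp [hn1]) hsl).cons (by simp [hn1]) (sw_cut ht)
  have hab : Edge.logical a ≠ .logical b := by
    have := (Multiset.nodup_add.1 (Multiset.nodup_add.1 hnd).1).2.2
    simpa [eq_comm] using this
  have hconn : Conn [{.logical b, .logical c}, {.logical a, .logical b}]
      (Edge.logical a) (.logical c) :=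
    (Conn.of_mem (H := {.logical a, .logical b}) (by simp) (by simp) (by simp)).trans
      (y := .logical b) (Conn.of_mem (H := {.logical b, .logical c}) (by simp) (by simp) (by simp))
  have hac : Edge.logical a ≠ .logical c := by
    intro he
    have h1 := (forest_append.1 (hcorr (fun _ => ∅) fun _ _ => ⟨by simp, by simp⟩)).2.1
    refine (forest_cons.1 h1).2 (.logical b) (by simp) (.logical c) (by simp) ?_ ?_
    · rw [← he]; exact hab.symm
    · rw [← he]
      exact Conn.of_mem (H := {.logical a, .logical b}) (by simp) (by simp) (by simp)
  have hbR : ∀ l ∈ R, Edge.logical b ∉ l.premises := by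
    intro l hl hb
    rw [show {Edge.logical b} + {Edge.logical c} + prem R + O =
      {Edge.logical b} + ({Edge.logical c} + prem R + O) by abel] at hnp
    refine Multiset.disjoint_left.1 (Multiset.nodup_add.1 hnp).2.2
      (Multiset.mem_singleton_self _) ?_
    simp [mem_prem.2 ⟨l, hl, hb⟩]
  have hcR : ∀ l ∈ R, Edge.logical c ∉ l.premises := by
    intro l hl hb
    rw [show {Edge.logical b} + {Edge.logical c} + prem R + O =
      {Edge.logical c} + ({Edge.logical b} + prem R + O) by abel] at hnp
    refine Multiset.disjoint_left.1 (Multiset.nodup_add.1 hnp).2.2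
      (Multiset.mem_singleton_self _) ?_
    simp [mem_prem.2 ⟨l, hl, hb⟩]
  have hcc : ∀ l ∈ R, Edge.logical a ∉ l.conclusions ∧ Edge.logical b ∉ l.conclusions := by
    intro l hl
    have := (Multiset.nodup_add.1 hnd).2.2
    constructor <;> exact fun hb => Multiset.disjoint_left.1 this (by simp)
      (mem_conc.2 ⟨l, hl, hb⟩)
  set f : ℕ → ℕ := fun n => if n = a then c else n with hf
  let ρ : Edge → Edge := fun x => match x with
    | .logical n => .logical (f n)
    | .structural s => .structural s
  have hρa : ρ (.logical a) = .logical c := by simp [ρ, hf]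
  have hρ : ∀ x, x ≠ .logical a → ρ x = x := by
    intro x hx
    cases x with
    | logical n =>
      have : n ≠ a := fun h => hx (by rw [h])
      simp [ρ, hf, this]
    | structural s => rfl
  have hprem : ∀ l : Link, (l.renamePremises f).premises = l.premises.map ρ :=
    Link.premises_renamePremises f
  refine ⟨?_, ?_, ?_, fun k hk => ?_⟩
  · rw [conc_renamePremises, add_zero]
    exact (Multiset.nodup_add.1 hnd).2.1
  · rw [conc_renamePremises, prem_renamePremises, add_zero]
    change conc R = (prem R).map ρ + O.map ρ
    have h1 : {Edge.logical a} + conc R = {Edge.logical c} + (prem R + O) := by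
      have : {Edge.logical b} + ({Edge.logical a} + conc R) =
          {Edge.logical b} + ({Edge.logical c} + (prem R + O)) := by
        rw [← add_assoc, add_comm {Edge.logical b}, hbal]; abel
      exact add_left_cancel this
    have h2 : Edge.logical a ∈ prem R + O := by
      have : Edge.logical a ∈ {Edge.logical c} + (prem R + O) := by rw [← h1]; simp
      exact (Multiset.mem_add.1 this).resolve_left (by simpa using hac)
    obtain ⟨Q, hQ⟩ := Multiset.exists_cons_of_mem h2
    rw [← Multiset.map_add, hQ, Multiset.map_cons, hρa]
    rw [hQ, ← Multiset.singleton_add, ← add_assoc, add_comm {Edge.logical c}, add_assoc] at h1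
    have h3 := add_left_cancel h1
    rw [h3, Multiset.singleton_add]
    congr 1
    conv_lhs => rw [← Multiset.map_id' Q]
    refine Multiset.map_congr rfl fun x hx => (hρ x ?_).symm
    rintro rfl
    obtain ⟨l', hl', hx'⟩ := mem_conc.1 (show Edge.logical a ∈ conc R by rw [h3]; simp [hx])
    exact (hcc l' hl').1 hx'
  · intro l' hl' x hx hx'
    obtain ⟨l', hlR, rfl⟩ := List.mem_map.1 hl'
    rw [Link.conclusions_renamePremises] at hx'
    rw [hprem] at hx
    obtain ⟨y, hy, rfl⟩ := List.mem_map.1 hx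
    by_cases hya : y = .logical a
    · subst hya
      rw [hρa] at hx'
      classical
      -- A link with premise `a` and conclusion `c` would become a loop; together with the path
      -- through `b` it was already a cycle.
      have h1 := hcorr (Function.update (fun _ => ∅) l' {.logical a, .logical c}) fun l1 _ => by
        by_cases he : l1 = l'
        · subst he
          rw [Function.update_self]
          refine ⟨?_, fun _ x hx y hy hx' hy' => ?_⟩
          · rintro x (rfl | rfl)
            · exact .inl hy
            · exact .inr hx'
          · have : ∀ x ∈ l1.premises, x ∈ ({.logical a, .logical c} : Set Edge) →
                x = .logical a := by
              rintro x hx (rfl | rfl)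
              · rfl
              · exact absurd hx (hcR l1 hlR)
            rw [this x hx hx', this y hy hy']
        · rw [Function.update_of_ne he]
          exact ⟨by simp, by simp⟩
      refine (h1.perm List.perm_append_comm).not_conn hac hconn ?_
      exact Conn.of_mem (H := {.logical a, .logical c})
        (List.mem_map.2 ⟨l', hlR, Function.update_self ..⟩) (by simp) (by simp)
    · rw [hρ y hya] at hx'
      exact h.loopless l' (by simp [hlR]) y hy hx'
  · let k' : Link → Set Edge := fun l => {x | (x ∈ l.premises ∨ x ∈ l.conclusions) ∧
      ρ x ∈ k (l.renamePremises f)}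
    have hk' : ∀ l ∈ R, l.Sw (k' l) := by
      refine fun l hlR => ⟨fun x hx => hx.1, fun he x hx y hy hx' hy' => ?_⟩
      have := (hk _ (List.mem_map_of_mem hlR)).2 ((Link.exclusive_renamePremises f l).2 he)
        (ρ x) (by rw [hprem]; exact List.mem_map_of_mem hx)
        (ρ y) (by rw [hprem]; exact List.mem_map_of_mem hy) hx'.2 hy'.2
      by_cases hxa : x = .logical a <;> by_cases hya : y = .logical a
      · rw [hxa, hya]
      · rw [hxa, hρa, hρ y hya] at this
        exact absurd (this ▸ hy) (hcR l hlR)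
      · rw [hya, hρa, hρ x hxa] at this
        exact absurd (this ▸ hx) (hcR l hlR)
      · rwa [hρ x hxa, hρ y hya] at this
    have h1 := Forest.contract (ρ := ρ) (fun x => ?_) (hcorr k' hk')
    · rw [List.append_nil, List.map_map]
      refine h1.mono ?_
      rw [List.map_map, List.forall₂_map_left_iff, List.forall₂_map_right_iff]
      refine List.forall₂_same.2 fun l hlR x hx => ?_
      rcases (hk _ (List.mem_map_of_mem hlR)).1 x hx with hx' | hx'
      · rw [hprem] at hx'
        obtain ⟨y, hy, rfl⟩ := List.mem_map.1 hx'
        exact ⟨y, ⟨.inl hy, hx⟩, rfl⟩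
      · rw [Link.conclusions_renamePremises] at hx'
        have : ρ x = x := hρ x (by rintro rfl; exact (hcc l hlR).1 hx')
        exact ⟨x, ⟨.inr hx', by rw [this]; exact hx⟩, this⟩
    · by_cases hxa : x = .logical a
      · rw [hxa, hρa]; exact hconn
      · rw [hρ x hxa]; exact .refl _ _

namespace Struct

theorem StepWith.good {f : ℕ → ℕ} {σ : ℕ → List ℕ} {S S' : Struct}
    (h : StepWith f σ S S') (hS : S.Good) : S'.Good := by
  induction h with
  | @ax S a b c l t R hl ht h =>
    have hm := (hS.isModule.perm h).ax hl ht
    refine Good.of_boxesGood ?_ ?_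
    · have : Struct.outputs ⟨R.map (Link.renamePremises fun n => if n = a then c else n),
          S.concl.map (fun n => if n = a then c else n), S.aux⟩ =
          S.outputs.map fun x => match x with
            | .logical n => .logical (if n = a then c else n)
            | .structural s => .structural s := by
        simp [Struct.outputs, Function.comp_def]
      rw [this]; exact hm
    · intro c' L m aux hl'
      obtain ⟨l', hl1, he⟩ := List.mem_map.1 hl'
      cases l' <;> simp only [Link.renamePremises, Link.bang.injEq, reduceCtorEq] at he
      obtain ⟨rfl, rfl, rfl, rfl⟩ := he
      exact hS.boxes (h.mem_iff.2 (List.mem_cons_of_mem _ (List.mem_cons_of_mem _ hl1)))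
  | @mult S a b c a' b' c' t R ht h =>
    refine Good.of_boxesGood ((hS.isModule.perm h).mult ht) fun c L m aux hl => ?_
    refine hS.boxes (h.mem_iff.2 ?_) (c := c)
    simp only [List.mem_cons, reduceCtorEq, false_or] at hl
    simp [hl]
  | @unit S c c' t R ht h =>
    refine Good.of_boxesGood ((hS.isModule.perm h).unit ht) fun c L m aux hl => ?_
    exact hS.boxes (h.mem_iff.2 (by simp [hl])) (c := c)
  | exp ht h => exact good_exp hS ht h
  | @box f σ S c m m' L L' R aux aux' h step ih =>
    have hm := (hS.isModule.perm h).box (L' := L') (m' := m') (aux' := aux')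
      (step.isRenaming.extend aux) (fun s hs => if_neg hs) ?_
    · refine Good.of_boxesGood ?_ ?_
      · rw [← outputs_bind]; exact hm
      · have hb := hS.boxesGood.perm h
        intro c1 L1 m1 aux1 hl
        rcases List.mem_cons.1 hl with he | hl
        · simp only [Link.bang.injEq] at he
          obtain ⟨rfl, rfl, rfl, rfl⟩ := he
          exact ih (hb c L m aux (by simp))
        · have hR : BoxesGood R := fun c L m aux hl => hb c L m aux (by simp [hl])
          exact hR.substWhy step.isRenaming.inj _ _ _ _ hl
    · have := step.aux_eq
      dsimp only at this
      rw [this]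
      exact List.flatMap_congr fun s hs => by rw [if_pos hs]

end Struct

/-! ### Points -/

theorem Sign.flip_flip (p : Sign) : p.flip.flip = p := by cases p <;> rfl

theorem PreD.dual_dual {A : Type u} : (x : PreD A) → x.dual.dual = x
  | .atom p o => by simp only [PreD.dual, Sign.flip_flip]
  | .pair p x y => by simp only [PreD.dual, Sign.flip_flip, dual_dual x, dual_dual y]
  | .bag p l => by
    simp only [PreD.dual, Sign.flip_flip, List.map_map]
    congr 1
    conv_rhs => rw [← List.map_id l]
    exact List.map_congr_left fun x _ => dual_dual x

namespace D

variable {A : Type u}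

@[simp] theorem dual_dual (x : D A) : x.dual.dual = x := by
  rw [← mk_out x, dual_mk, dual_mk, PreD.dual_dual]

theorem dual_eq_iff {x y : D A} : x = y.dual ↔ y = x.dual := by
  constructor <;> rintro rfl <;> simp

theorem bag_inj {p q : Sign} {m m' : Multiset (D A)} (h : bag p m = bag q m') : p = q ∧ m = m' := by
  have := congrArg view h
  simpa using this

theorem pair_inj {p q : Sign} {x y x' y' : D A} (h : pair p x y = pair q x' y') :
    p = q ∧ x = x' ∧ y = y' := by
  have := congrArg view h
  simpa using this

end D

/-! ### Resource semantics

The values of an experiment are given by a pair of functions. If `strict` holds, the semantics is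
that of experiments; otherwise, the value of every `?`-link may exceed the sum of its premises. The
number counts the links, with the multiplicities given by the experiment, except for the cuts. -/

/-- Values of the logical and of the structural edges. -/
abbrev Valuation (A : Type u) : Type u := (ℕ → D A) × (ℕ → Multiset (D A))

mutual

/-- A valuation satisfies the condition of a link, with the given size. -/
def Link.Sem {A : Type u} (strict : Prop) : Link → Valuation A → ℕ → Prop
  | .ax a b, e, n => e.1 a = (e.1 b).dual ∧ n = 1
  | .cut a b, e, n => e.1 a = (e.1 b).dual ∧ n = 0
  | .tens a b c, e, n => e.1 c = D.pair .pos (e.1 a) (e.1 b) ∧ n = 1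
  | .par a b c, e, n => e.1 c = D.pair .neg (e.1 a) (e.1 b) ∧ n = 1
  | .one c, e, n => e.1 c = D.star .pos ∧ n = 1
  | .bot c, e, n => e.1 c = D.star .neg ∧ n = 1
  | .flat a s, e, n => e.2 s = {e.1 a} ∧ n = 1
  | .why ps c, e, n => (∃ μ : Multiset (D A), e.1 c = D.bag .neg μ ∧ (ps.map e.2).sum ≤ μ ∧
      (strict → ps ≠ [] → (ps.map e.2).sum = μ)) ∧ n = 1
  | .bang c L m aux, e, n => ∃ es : List (Valuation A × ℕ), es ≠ [] ∧
      (∀ k ∈ es, Links.Sem strict L k.1 k.2) ∧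
      e.1 c = D.bag .pos (es.map fun k => k.1.1 m : List (D A)) ∧
      (∀ s ∈ aux, e.2 s = (es.map fun k => k.1.2 s).sum) ∧ n = 1 + (es.map Prod.snd).sum

/-- A valuation satisfies the conditions of a list of links, with the given size. -/
def Links.Sem {A : Type u} (strict : Prop) : List Link → Valuation A → ℕ → Prop
  | [], _, n => n = 0
  | l :: T, e, n => ∃ i j, n = i + j ∧ Link.Sem strict l e i ∧ Links.Sem strict T e j

end

/-- Two valuations agree on an edge. -/
def Agree {A : Type u} (e e' : Valuation A) : Edge → Prop
  | .logical n => e.1 n = e'.1 n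
  | .structural s => e.2 s = e'.2 s

section Sem

variable {A : Type u} {strict : Prop}

theorem Link.Sem.congr {l : Link} {e e' : Valuation A} {n : ℕ}
    (h : ∀ x, x ∈ l.premises ∨ x ∈ l.conclusions → Agree e e' x) (hl : l.Sem strict e n) :
    l.Sem strict e' n := by
  cases l with
  | why ps c =>
    have h1 : ps.map e.2 = ps.map e'.2 := List.map_congr_left fun s hs =>
      h (.structural s) (by simp [premises, hs])
    have h2 := h (.logical c) (by simp [conclusions])
    simp only [Agree] at h2
    simpa only [Link.Sem, h1, h2] using hl
  | bang c L m aux =>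
    have h1 : ∀ s ∈ aux, e.2 s = e'.2 s := fun s hs =>
      h (.structural s) (by simp [conclusions, hs])
    have h2 := h (.logical c) (by simp [conclusions])
    simp only [Agree] at h2
    simp only [Link.Sem] at hl ⊢
    obtain ⟨es, h3, h4, h5, h6, h7⟩ := hl
    exact ⟨es, h3, h4, h2 ▸ h5, fun s hs => h1 s hs ▸ h6 s hs, h7⟩
  | _ =>
    simp only [premises, conclusions, List.mem_cons, List.not_mem_nil, or_false, false_or] at h
    simp only [Link.Sem] at hl ⊢
    have hc := fun n hx => show e.1 n = e'.1 n from h (.logical n) hx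
    have hs := fun n hx => show e.2 n = e'.2 n from h (.structural n) hx
    simp only [Edge.logical.injEq, Edge.structural.injEq, reduceCtorEq, or_false, false_or] at hc hs
    simp_all

namespace Links.Sem

theorem nil_iff {e : Valuation A} {n : ℕ} : Links.Sem strict [] e n ↔ n = 0 := by
  simp only [Links.Sem]

theorem cons_iff {l : Link} {T : List Link} {e : Valuation A} {n : ℕ} :
    Links.Sem strict (l :: T) e n ↔
      ∃ i j, n = i + j ∧ l.Sem strict e i ∧ Links.Sem strict T e j := by
  simp only [Links.Sem]

theorem append_iff {T T' : List Link} {e : Valuation A} {n : ℕ} :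
    Links.Sem strict (T ++ T') e n ↔
      ∃ i j, n = i + j ∧ Links.Sem strict T e i ∧ Links.Sem strict T' e j := by
  induction T generalizing n with
  | nil => simp [nil_iff]
  | cons l T ih =>
    simp only [List.cons_append, cons_iff, ih]
    constructor
    · rintro ⟨i, _, rfl, h1, j, k, rfl, h2, h3⟩
      exact ⟨i + j, k, by omega, ⟨i, j, rfl, h1, h2⟩, h3⟩
    · rintro ⟨_, k, rfl, ⟨i, j, rfl, h1, h2⟩, h3⟩
      exact ⟨i, j + k, by omega, h1, j, k, rfl, h2, h3⟩

theorem perm {T T' : List Link} (h : T.Perm T') {e : Valuation A} {n : ℕ}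
    (hT : Links.Sem strict T e n) : Links.Sem strict T' e n := by
  induction h generalizing n with
  | nil => exact hT
  | cons l _ ih =>
    obtain ⟨i, j, rfl, h1, h2⟩ := cons_iff.1 hT
    exact cons_iff.2 ⟨i, j, rfl, h1, ih h2⟩
  | swap l l' T =>
    obtain ⟨i, _, rfl, h1, h2⟩ := cons_iff.1 hT
    obtain ⟨j, k, rfl, h2, h3⟩ := cons_iff.1 h2
    exact cons_iff.2 ⟨j, i + k, by omega, h2, cons_iff.2 ⟨i, k, rfl, h1, h3⟩⟩
  | trans _ _ ih ih' => exact ih' (ih hT)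

theorem of_mem {T : List Link} {e : Valuation A} {n : ℕ} (hT : Links.Sem strict T e n) {l : Link}
    (hl : l ∈ T) : ∃ i ≤ n, l.Sem strict e i := by
  induction T generalizing n with
  | nil => simp at hl
  | cons k T ih =>
    obtain ⟨i, j, rfl, h1, h2⟩ := cons_iff.1 hT
    rcases List.mem_cons.1 hl with rfl | hl
    · exact ⟨i, by omega, h1⟩
    · obtain ⟨i', h3, h4⟩ := ih h2 hl
      exact ⟨i', by omega, h4⟩

theorem of_forall {T : List Link} {e : Valuation A} (h : ∀ l ∈ T, ∃ n, l.Sem strict e n) :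
    ∃ n, Links.Sem strict T e n := by
  induction T with
  | nil => exact ⟨0, nil_iff.2 rfl⟩
  | cons l T ih =>
    obtain ⟨i, hi⟩ := h l (by simp)
    obtain ⟨j, hj⟩ := ih fun l hl => h l (by simp [hl])
    exact ⟨i + j, cons_iff.2 ⟨i, j, rfl, hi, hj⟩⟩

theorem map {T : List Link} {φ : Link → Link} {strict' : Prop} {e e' : Valuation A} {n : ℕ}
    (hT : Links.Sem strict T e n)
    (h : ∀ l ∈ T, ∀ i, l.Sem strict e i → (φ l).Sem strict' e' i) :
    Links.Sem strict' (T.map φ) e' n := by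
  induction T generalizing n with
  | nil => exact hT
  | cons l T ih =>
    obtain ⟨i, j, rfl, h1, h2⟩ := cons_iff.1 hT
    exact cons_iff.2 ⟨i, j, rfl, h l (by simp) i h1, ih h2 fun l hl => h l (by simp [hl])⟩

theorem of_map {T : List Link} {φ : Link → Link} {strict' : Prop} {e e' : Valuation A} {n : ℕ}
    (hT : Links.Sem strict (T.map φ) e n)
    (h : ∀ l ∈ T, ∀ i, (φ l).Sem strict e i → l.Sem strict' e' i) :
    Links.Sem strict' T e' n := by
  induction T generalizing n with
  | nil => exact hT
  | cons l T ih =>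
    obtain ⟨i, j, rfl, h1, h2⟩ := cons_iff.1 hT
    exact cons_iff.2 ⟨i, j, rfl, h l (by simp) i h1, ih h2 fun l hl => h l (by simp [hl])⟩

theorem congr {T : List Link} {e e' : Valuation A} {n : ℕ} (hT : Links.Sem strict T e n)
    (h : ∀ l ∈ T, ∀ x, x ∈ l.premises ∨ x ∈ l.conclusions → Agree e e' x) :
    Links.Sem strict T e' n := by
  have := hT.map (φ := id) (e' := e') fun l hl i hi => hi.congr (h l hl)
  rwa [List.map_id] at this

end Links.Sem

/-- The valuation of the edges before a renaming. -/
def Valuation.comap (f : ℕ → ℕ) (e : Valuation A) : Valuation A := (e.1 ∘ f, e.2 ∘ f)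

theorem sem_rename_list {f : ℕ → ℕ} (hf : Function.Injective f) (T : List Link) :
    ∀ l ∈ T, ∀ (e : Valuation A) (n : ℕ), (l.rename f).Sem strict e n ↔ l.Sem strict (e.comap f) n := by
  induction T using links_induction with
  | h T ih =>
    intro l hl e n
    cases l with
    | bang c L m aux =>
      have ih' := ih c L m aux hl
      simp only [Link.rename, Link.Sem]
      constructor
      · rintro ⟨es, h1, h2, h3, h4, h5⟩
        refine ⟨es.map fun k => (k.1.comap f, k.2), by simpa using h1, ?_, ?_, ?_, ?_⟩
        · intro k hk
          obtain ⟨k, hk', rfl⟩ := List.mem_map.1 hk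
          exact (h2 k hk').of_map fun l hl i hi => (ih' l hl _ _).1 hi
        · simpa [Valuation.comap, Function.comp_def] using h3
        · intro s hs
          simpa [Valuation.comap, Function.comp_def] using h4 (f s) (List.mem_map_of_mem hs)
        · simpa [Function.comp_def] using h5
      · rintro ⟨es, h1, h2, h3, h4, h5⟩
        have hg := Function.leftInverse_invFun hf
        refine ⟨es.map fun k => (k.1.comap (Function.invFun f), k.2), by simpa using h1,
          ?_, ?_, ?_, ?_⟩
        · intro k hk
          obtain ⟨k, hk', rfl⟩ := List.mem_map.1 hk
          refine (h2 k hk').map fun l hl i hi => (ih' l hl _ _).2 ?_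
          convert hi using 1
          ext x <;> simp [Valuation.comap, hg x]
        · simpa [Valuation.comap, Function.comp_def, hg m] using h3
        · intro s hs
          obtain ⟨s, hs', rfl⟩ := List.mem_map.1 hs
          simpa [Valuation.comap, Function.comp_def, hg s] using h4 s hs'
        · simpa [Function.comp_def] using h5
    | _ => simp [Link.rename, Link.Sem, Valuation.comap, Function.comp_def]

theorem Link.sem_rename {f : ℕ → ℕ} (hf : Function.Injective f) (l : Link) (e : Valuation A)
    (n : ℕ) : (l.rename f).Sem strict e n ↔ l.Sem strict (e.comap f) n :=
  sem_rename_list hf [l] l (by simp) e n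

theorem Links.sem_rename {f : ℕ → ℕ} (hf : Function.Injective f) (T : List Link) (e : Valuation A)
    (n : ℕ) : Links.Sem strict (T.map (Link.rename f)) e n ↔ Links.Sem strict T (e.comap f) n :=
  ⟨fun h => h.of_map fun l _ _ hi => (l.sem_rename hf _ _).1 hi,
    fun h => h.map fun l _ _ hi => (l.sem_rename hf _ _).2 hi⟩

end Sem

/-! ### Semantics of grafts -/

section Partition

variable {α β : Type*}

theorem exists_split (g : α → β) (m m' : Multiset β) (ks : List α)
    (h : ((ks.map g : List β) : Multiset β) = m + m') :
    ∃ k k' : List α, ((k.map g : List β) : Multiset β) = m ∧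
      ((k'.map g : List β) : Multiset β) = m' ∧ (k ++ k').Perm ks := by
  classical
  induction ks generalizing m m' with
  | nil =>
    have h0 : m + m' = 0 := by rw [← h]; rfl
    obtain ⟨rfl, rfl⟩ := add_eq_zero.1 h0
    exact ⟨[], [], rfl, rfl, .refl _⟩
  | cons x ks ih =>
    rw [List.map_cons, ← Multiset.cons_coe] at h
    have hx : g x ∈ m + m' := by rw [← h]; simp
    rcases Multiset.mem_add.1 hx with hx | hx
    · obtain ⟨m1, rfl⟩ := Multiset.exists_cons_of_mem hx
      rw [Multiset.cons_add] at h
      obtain ⟨k, k', h1, h2, h3⟩ := ih _ _ (Multiset.cons_inj_right _ |>.1 h)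
      exact ⟨x :: k, k', by rw [List.map_cons, ← Multiset.cons_coe, h1], h2, h3.cons x⟩
    · obtain ⟨m1, rfl⟩ := Multiset.exists_cons_of_mem hx
      rw [Multiset.add_cons] at h
      obtain ⟨k, k', h1, h2, h3⟩ := ih _ _ (Multiset.cons_inj_right _ |>.1 h)
      exact ⟨k, x :: k', h1, by rw [List.map_cons, ← Multiset.cons_coe, h2],
        List.perm_middle.trans (h3.cons x)⟩

/-- A list is distributed according to a decomposition of the multiset of its values. -/
theorem exists_distribution {γ : Type*} (g : α → β) (r : γ → Multiset β) (es : List γ)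
    (ks : List α) (h : ((ks.map g : List β) : Multiset β) = (es.map r).sum) :
    ∃ ws : List (γ × List α), ws.map Prod.fst = es ∧
      (∀ w ∈ ws, ((w.2.map g : List β) : Multiset β) = r w.1) ∧ (ws.flatMap Prod.snd).Perm ks := by
  induction es generalizing ks with
  | nil =>
    have : ks = [] := by simpa using h
    subst this
    exact ⟨[], rfl, by simp, .refl _⟩
  | cons c es ih =>
    rw [List.map_cons, List.sum_cons] at h
    obtain ⟨k, k', h1, h2, h3⟩ := exists_split g _ _ ks h
    obtain ⟨ws, rfl, h5, h6⟩ := ih k' h2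
    refine ⟨(c, k) :: ws, rfl, ?_, ?_⟩
    · intro w hw
      rcases List.mem_cons.1 hw with rfl | hw
      · exact h1
      · exact h5 w hw
    · rw [List.flatMap_cons]
      exact (h6.append_left k).trans h3

theorem sum_map_perm {M : Type*} [AddCommMonoid M] {l l' : List α} (h : l.Perm l') (g : α → M) :
    (l.map g).sum = (l'.map g).sum := (h.map g).sum_eq

theorem sum_map_flatMap {γ M : Type*} [AddCommMonoid M] (l : List α) (k : α → List γ) (g : γ → M) :
    ((l.flatMap k).map g).sum = (l.map fun a => ((k a).map g).sum).sum := by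
  induction l with
  | nil => rfl
  | cons a l ih => simp [ih]

theorem coe_map_flatMap {γ : Type*} (l : List α) (k : α → List γ) (g : γ → β) :
    (((l.flatMap k).map g : List β) : Multiset β) =
      (l.map fun a => (((k a).map g : List β) : Multiset β)).sum := by
  induction l with
  | nil => rfl
  | cons a l ih => simp [← ih]

end Partition

section Graft

variable {A : Type u} {strict : Prop}

theorem Struct.Good.graft_box {L : List Link} {n : ℕ} {aux : List ℕ}
    (h : Struct.Good ⟨L, [n], aux⟩) :
    (conc L).Nodup ∧ (∀ p ∈ aux, .structural p ∈ conc L ∧ .structural p ∉ prem L) ∧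
      .logical n ∈ conc L := by
  have hm := h.isModule_box
  have hb := hm.bal
  rw [add_zero] at hb
  refine ⟨hm.nodup_conc, fun p hp => ⟨?_, fun hp' => ?_⟩, ?_⟩
  · rw [hb]; simp [hp]
  · exact Multiset.disjoint_left.1 (Multiset.nodup_add.1 hm.nodup_prem_add).2.2 hp' (by simp [hp])
  · rw [hb]; simp

/-- The valuations `ks` of the copy are exactly those demanded by the content of `p`. At a `♭`-link
this content is a singleton and one valuation is used; at a box it is a sum over the valuations of
the box, and the list is distributed accordingly. No valuation is duplicated, whence the bound on
the size. -/
theorem Links.Sem.graft {p : ℕ} {K : List Link} {m : ℕ} {xs : List ℕ} {N : Set ℕ}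
    (hKN : ∀ l ∈ K, ∀ n ∈ l.names, n ∈ N) (hmN : m ∈ N) (hxN : ∀ x ∈ xs, x ∈ N)
    (T : List Link) :
    BoxesGood T → (conc T).Nodup → .structural p ∈ conc T → FreshFor N xs T →
    ∀ (e : Valuation A) (n : ℕ) (ks : List (Valuation A × ℕ)), Links.Sem strict T e n →
    (∀ k ∈ ks, Links.Sem strict K k.1 k.2) →
    ((ks.map fun k => (k.1.1 m).dual : List (D A)) : Multiset (D A)) = e.2 p →
    (∀ x ∈ xs, e.2 x = (ks.map fun k => k.1.2 x).sum) →
    ∃ e' n', Links.Sem strict (T.flatMap (Link.graft p K m xs)) e' n' ∧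
      n' ≤ n + (ks.map Prod.snd).sum ∧ (∀ i, i ∉ N → e'.1 i = e.1 i) ∧
      ∀ i, i ∉ N ∨ i ∈ xs → e'.2 i = e.2 i := by
  induction T using links_induction with
  | h T ih =>
    intro hB hnd hp hF e n ks hT hks hp1 hx1
    obtain ⟨l, T₀, hperm, hpl, hp0, hgr⟩ := exists_perm_graft hnd hp
    have hlT : l ∈ T := hperm.mem_iff.2 (by simp)
    have hT₀ : ∀ k ∈ T₀, k ∈ T := fun k hk => hperm.mem_iff.2 (by simp [hk])
    obtain ⟨i, j, rfl, hl, hT0⟩ := cons_iff.1 (hT.perm hperm)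
    classical
    cases l with
    | flat a s =>
      obtain rfl : s = p := by simpa [Link.conclusions, eq_comm] using hpl
      simp only [Link.Sem] at hl
      obtain ⟨hl, rfl⟩ := hl
      obtain ⟨k, rfl⟩ : ∃ k, ks = [k] := by
        have := congrArg Multiset.card (hp1.trans hl)
        simp only [Multiset.coe_card, List.length_map, Multiset.card_singleton] at this
        exact List.length_eq_one_iff.1 this
      have hka : (k.1.1 m).dual = e.1 a := by
        have := hp1.trans hl
        simpa using this
      have haN : a ∉ N := fun h => by
        simpa using hF.edge _ hlT (.logical a) (by simp [Link.premises]) h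
      -- The two valuations are glued along `N`; they overlap only on `xs`, where they agree by
      -- hypothesis.
      let e' : Valuation A := (fun i => if i ∈ N then k.1.1 i else e.1 i,
        fun i => if i ∈ N then k.1.2 i else e.2 i)
      have hex : ∀ x ∈ xs, e'.2 x = e.2 x := fun x hx => by
        simp [e', hxN x hx, hx1 x hx]
      have hK : Links.Sem strict K e' k.2 := by
        refine (hks k (by simp)).congr fun l hl x hx => ?_
        have hxN' := hKN l hl _ (Link.name_mem_names hx)
        cases x with
        | logical x => exact (if_pos (show x ∈ N from hxN')).symm
        | structural x => exact (if_pos (show x ∈ N from hxN')).symm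
      have hT1 : Links.Sem strict T₀ e' j := by
        refine hT0.congr fun l hl x hx => ?_
        have h1 := hF.edge l (hT₀ l hl) x hx
        cases x with
        | logical x =>
          refine (if_neg fun h => ?_).symm
          simpa using h1 h
        | structural x =>
          by_cases hxN' : x ∈ N
          · have := h1 hxN'
            simp only [mem_strs, Edge.structural.injEq, exists_eq_right] at this
            exact (hex x this).symm
          · exact (if_neg hxN').symm
      refine ⟨e', k.2 + j, ?_, ?_, ?_, ?_⟩
      · refine Links.Sem.perm (hgr K m xs).symm ?_
        have hgraft : (Link.flat a s).graft s K m xs = .cut a m :: K := by simp [Link.graft]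
        rw [hgraft]
        refine append_iff.2 ⟨k.2, j, rfl, cons_iff.2 ⟨0, k.2, by omega, ?_, hK⟩, hT1⟩
        simp only [Link.Sem, and_true]
        simp [e', haN, hmN, hka]
      · simp; omega
      · intro i hi; simp [e', hi]
      · rintro i (hi | hi)
        · simp [e', hi]
        · exact hex i hi
    | bang c L b aux =>
      have hpa : p ∈ aux := by simpa [Link.conclusions] using hpl
      obtain ⟨hLnd, hLp, hLb⟩ := (hB c L b aux hlT).graft_box
      have hLN := hF.box c L b aux hlT
      have hLc : ∀ x ∈ conc L, x.name ∉ N := fun x hx => by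
        obtain ⟨k, hk, hx⟩ := mem_conc.1 hx
        exact hLN k hk _ (Link.name_mem_names (.inr hx))
      simp only [Link.Sem] at hl
      obtain ⟨es, hne, hes, hc, haux, rfl⟩ := hl
      obtain ⟨ws, rfl, hws, hwp⟩ := exists_distribution (fun k : Valuation A × ℕ => (k.1.1 m).dual)
        (fun k : Valuation A × ℕ => k.1.2 p) es ks (by rw [hp1, haux p hpa])
      have hstep : ∀ w ∈ ws, ∃ k' : Valuation A × ℕ,
          Links.Sem strict (L.flatMap (Link.graft p K m xs)) k'.1 k'.2 ∧
          k'.2 ≤ w.1.2 + (w.2.map Prod.snd).sum ∧ (∀ i, i ∉ N → k'.1.1 i = w.1.1.1 i) ∧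
          (∀ i, i ∉ N → k'.1.2 i = w.1.1.2 i) ∧
          ∀ x ∈ xs, k'.1.2 x = (w.2.map fun k => k.1.2 x).sum := by
        intro w hw
        -- Before recursion into the box, the values of `xs` are set to what its share of the copies
        -- yields. This is harmless, since the names of `xs` do not occur in the box.
        let e1 : Valuation A := (w.1.1.1, fun x =>
          if x ∈ xs then (w.2.map fun k => k.1.2 x).sum else w.1.1.2 x)
        have hxs : ∀ i, i ∉ N → e1.2 i = w.1.1.2 i := fun i hi =>
          if_neg fun h => hi (hxN i h)
        have hsem : Links.Sem strict L e1 w.1.2 := by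
          refine (hes w.1 (List.mem_map_of_mem hw)).congr fun l hl x hx => ?_
          have := hLN l hl _ (Link.name_mem_names hx)
          cases x with
          | logical x => rfl
          | structural x => exact (hxs x this).symm
        obtain ⟨e', n', h1, h2, h3, h4⟩ := ih c L b aux hlT (hB c L b aux hlT).boxesGood hLnd
          (hLp p hpa).1 (FreshFor.of_names hLN) e1 w.1.2 w.2 hsem
          (fun k hk => hks k (hwp.mem_iff.1 (List.mem_flatMap.2 ⟨w, hw, hk⟩)))
          (by rw [hws w hw, hxs p (hLc _ (hLp p hpa).1)]) (fun x hx => if_pos hx)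
        exact ⟨(e', n'), h1, h2, h3, fun i hi => (h4 i (.inl hi)).trans (hxs i hi),
          fun x hx => (h4 x (.inr hx)).trans (if_pos hx)⟩
      have : Nonempty (Valuation A × ℕ) := ⟨(e, 0)⟩
      choose! φ hφ using hstep
      refine ⟨e, 1 + ((ws.map φ).map Prod.snd).sum + j, ?_, ?_, fun _ _ => rfl, fun _ _ => rfl⟩
      · refine Links.Sem.perm (hgr K m xs).symm ?_
        have hgraft : (Link.bang c L b aux).graft p K m xs =
            [.bang c (L.flatMap fun l => l.graft p K m xs) b
              (aux.flatMap fun s => if s = p then xs else [s])] := by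
          simp [Link.graft, hpa]
        rw [hgraft]
        refine cons_iff.2 ⟨_, _, rfl, ?_, hT0⟩
        simp only [Link.Sem]
        refine ⟨ws.map φ, by simpa using hne, ?_, ?_, ?_, rfl⟩
        · intro k hk
          obtain ⟨w, hw, rfl⟩ := List.mem_map.1 hk
          exact (hφ w hw).1
        · rw [hc, List.map_map, List.map_map]
          congr 2
          exact List.map_congr_left fun w hw => ((hφ w hw).2.2.1 b (hLc _ hLb)).symm
        · intro s hs
          obtain ⟨s', hs', hs⟩ := List.mem_flatMap.1 hs
          split_ifs at hs with h
          · rw [hx1 s hs, ← sum_map_perm hwp, sum_map_flatMap, List.map_map]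
            congr 1
            exact List.map_congr_left fun w hw => ((hφ w hw).2.2.2.2 s hs).symm
          · obtain rfl : s = s' := by simpa using hs
            rw [haux s hs', List.map_map, List.map_map]
            congr 1
            exact List.map_congr_left fun w hw =>
              ((hφ w hw).2.2.2.1 s (hLc _ (hLp s hs').1)).symm
      · rw [← sum_map_perm hwp, sum_map_flatMap, List.map_map, List.map_map]
        have : (ws.map (Prod.snd ∘ φ)).sum ≤ (ws.map (Prod.snd ∘ Prod.fst)).sum +
            (ws.map fun a => (a.2.map Prod.snd).sum).sum := by
          rw [← List.sum_map_add]
          exact List.sum_le_sum fun w hw => (hφ w hw).2.1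
        omega
    | _ => simp [Link.conclusions] at hpl

/-- Conversely, the valuations of all occurrences of the copy are collected, and their duals are
taken as the content of `p`. At least one is found because every `!`-link on the way carries a
non-empty list of valuations. -/
theorem Links.Sem.of_graft {p : ℕ} {K : List Link} {m : ℕ} {xs : List ℕ} (T : List Link) :
    BoxesGood T → (conc T).Nodup → .structural p ∈ conc T → .structural p ∉ prem T →
    ∀ (e' : Valuation A) (n' : ℕ), Links.Sem strict (T.flatMap (Link.graft p K m xs)) e' n' →
    ∃ (e : Valuation A) (n : ℕ) (ks : List (Valuation A × ℕ)), Links.Sem strict T e n ∧ ks ≠ [] ∧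
      (∀ k ∈ ks, Links.Sem strict K k.1 k.2) ∧
      ((ks.map fun k => (k.1.1 m).dual : List (D A)) : Multiset (D A)) = e.2 p ∧
      (∀ x ∈ xs, e'.2 x = (ks.map fun k => k.1.2 x).sum) ∧
      e.1 = e'.1 ∧ ∀ i, i ≠ p → e.2 i = e'.2 i := by
  classical
  induction T using links_induction with
  | h T ih =>
    intro hB hnd hp hpp e' n' hT
    obtain ⟨l, T₀, hperm, hpl, hp0, hgr⟩ := exists_perm_graft hnd hp
    have hlT : l ∈ T := hperm.mem_iff.2 (by simp)
    obtain ⟨i, j, rfl, hl, hT0⟩ := append_iff.1 (hT.perm (hgr K m xs))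
    -- The edge `p` touches none of the other links, so its value may be redefined freely.
    have hrest : ∀ μ : Multiset (D A), Links.Sem strict T₀ (e'.1, Function.update e'.2 p μ) j := by
      intro μ
      refine hT0.congr fun l1 hl1 x hx => ?_
      cases x with
      | logical x => rfl
      | structural x =>
        refine (Function.update_of_ne ?_ _ _).symm
        rintro rfl
        rcases hx with hx | hx
        · exact hpp (mem_prem.2 ⟨l1, hperm.mem_iff.2 (by simp [hl1]), hx⟩)
        · exact hp0 (mem_conc.2 ⟨l1, hl1, hx⟩)
    cases l with
    | flat a s =>
      obtain rfl : s = p := by simpa [Link.conclusions, eq_comm] using hpl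
      have hgraft : (Link.flat a s).graft s K m xs = .cut a m :: K := by simp [Link.graft]
      rw [hgraft] at hl
      obtain ⟨i1, i2, rfl, h1, h2⟩ := cons_iff.1 hl
      simp only [Link.Sem] at h1
      refine ⟨(e'.1, Function.update e'.2 s {e'.1 a}), 1 + j, [(e', i2)], ?_, by simp,
        by simpa using h2, ?_, by simp, rfl, fun i hi => Function.update_of_ne hi _ _⟩
      · refine Links.Sem.perm hperm.symm (cons_iff.2 ⟨_, _, rfl, ?_, hrest _⟩)
        simp [Link.Sem]
      · simp [h1.1]
    | bang c L b aux =>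
      have hpa : p ∈ aux := by simpa [Link.conclusions] using hpl
      obtain ⟨hLnd, hLp, hLb⟩ := (hB c L b aux hlT).graft_box
      have hgraft : (Link.bang c L b aux).graft p K m xs =
          [.bang c (L.flatMap fun l => l.graft p K m xs) b
            (aux.flatMap fun s => if s = p then xs else [s])] := by
        simp [Link.graft, hpa]
      rw [hgraft] at hl
      obtain ⟨i1, i2, rfl, hl, h2⟩ := cons_iff.1 hl
      simp only [Link.Sem] at hl
      obtain ⟨es, hne, hes, hc, haux, rfl⟩ := hl
      have hstep : ∀ k' ∈ es, ∃ w : (Valuation A × ℕ) × List (Valuation A × ℕ),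
          Links.Sem strict L w.1.1 w.1.2 ∧ w.2 ≠ [] ∧ (∀ k ∈ w.2, Links.Sem strict K k.1 k.2) ∧
          ((w.2.map fun k => (k.1.1 m).dual : List (D A)) : Multiset (D A)) = w.1.1.2 p ∧
          (∀ x ∈ xs, k'.1.2 x = (w.2.map fun k => k.1.2 x).sum) ∧
          w.1.1.1 = k'.1.1 ∧ ∀ i, i ≠ p → w.1.1.2 i = k'.1.2 i := by
        intro k' hk'
        obtain ⟨e, n, ks, h⟩ := ih c L b aux hlT (hB c L b aux hlT).boxesGood hLnd
          (hLp p hpa).1 (hLp p hpa).2 k'.1 k'.2 (hes k' hk')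
        exact ⟨((e, n), ks), h⟩
      have : Nonempty ((Valuation A × ℕ) × List (Valuation A × ℕ)) := ⟨((e', 0), [])⟩
      choose! φ hφ using hstep
      have hmem : ∀ s ∈ aux, s ≠ p → s ∈ aux.flatMap fun s => if s = p then xs else [s] :=
        fun s hs hsp => List.mem_flatMap.2 ⟨s, hs, by simp [hsp]⟩
      refine ⟨(e'.1, Function.update e'.2 p (es.map fun k => (φ k).1.1.2 p).sum),
        1 + ((es.map fun k => (φ k).1).map Prod.snd).sum + j, es.flatMap fun k => (φ k).2,
        ?_, ?_, ?_, ?_, ?_, rfl, fun i hi => Function.update_of_ne hi _ _⟩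
      · refine Links.Sem.perm hperm.symm (cons_iff.2 ⟨_, _, rfl, ?_, hrest _⟩)
        simp only [Link.Sem]
        refine ⟨es.map fun k => (φ k).1, by simpa using hne, ?_, ?_, ?_, rfl⟩
        · intro k hk
          obtain ⟨k', hk', rfl⟩ := List.mem_map.1 hk
          exact (hφ k' hk').1
        · rw [hc, List.map_map]
          congr 2
          exact List.map_congr_left fun k hk => by simp [(hφ k hk).2.2.2.2.2.1]
        · intro s hs
          by_cases hsp : s = p
          · subst hsp
            simp [Function.comp_def]
          · simp only [Function.update_of_ne hsp]
            rw [haux s (hmem s hs hsp), List.map_map]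
            congr 1
            exact List.map_congr_left fun k hk => ((hφ k hk).2.2.2.2.2.2 s hsp).symm
      · obtain ⟨k, hk⟩ := List.exists_mem_of_ne_nil _ hne
        intro h
        rw [List.flatMap_eq_nil_iff] at h
        exact (hφ k hk).2.1 (h k hk)
      · intro k hk
        obtain ⟨k', hk', hk⟩ := List.mem_flatMap.1 hk
        exact (hφ k' hk').2.2.1 k hk
      · simp only [Function.update_self]
        rw [coe_map_flatMap]
        congr 1
        exact List.map_congr_left fun k hk => (hφ k hk).2.2.2.1
      · intro x hx
        rw [haux x (List.mem_flatMap.2 ⟨p, hpa, by simp [hx]⟩), sum_map_flatMap]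
        congr 1
        exact List.map_congr_left fun k hk => (hφ k hk).2.2.2.2.1 x hx
    | _ => simp [Link.conclusions] at hpl

end Graft

-- Semantics of simultaneous grafts and of duplicated edges

variable {A : Type u} {strict : Prop}

/-- A list is distributed according to a decomposition of the multiset of its values. -/
theorem exists_distribution_of_nodup {α β γ : Type*} (g : α → β) (r : γ → Multiset β)
    {cs : List γ} (hcs : cs.Nodup) (ks : List α)
    (h : ((ks.map g : List β) : Multiset β) = (cs.map r).sum) :
    ∃ w : γ → List α, (∀ c ∈ cs, (((w c).map g : List β) : Multiset β) = r c) ∧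
      (cs.flatMap w).Perm ks := by
  classical
  induction cs generalizing ks with
  | nil =>
    have : ks = [] := by simpa using h
    subst this
    exact ⟨fun _ => [], by simp, .refl _⟩
  | cons c cs ih =>
    rw [List.map_cons, List.sum_cons] at h
    obtain ⟨hc, hcs⟩ := List.nodup_cons.1 hcs
    obtain ⟨k, k', h1, h2, h3⟩ := exists_split g _ _ ks h
    obtain ⟨w, h5, h6⟩ := ih hcs k' h2
    have hw : ∀ d ∈ cs, Function.update w c k d = w d := fun d hd =>
      Function.update_of_ne (fun h : d = c => hc (h ▸ hd)) _ _
    refine ⟨Function.update w c k, ?_, ?_⟩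
    · intro d hd
      rcases List.mem_cons.1 hd with rfl | hd
      · rw [Function.update_self, h1]
      · rw [hw d hd, h5 d hd]
    · rw [List.flatMap_cons, Function.update_self, List.flatMap_congr hw]
      exact (h6.append_left k).trans h3

theorem Valuation.comap_comap_invFun {f : ℕ → ℕ} (hf : Function.Injective f) (e : Valuation A) :
    (e.comap (Function.invFun f)).comap f = e := by
  ext x <;> simp [Valuation.comap, Function.leftInverse_invFun hf x]

theorem zero_notMem_copyNames {i j : ℕ} : tag 0 i ∉ copyNames j := by
  rw [tag_mem_copyNames]; omega

/-- Valuations of a structure and of the copies of a box give a valuation of the result of the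
grafts. -/
theorem GraftReady.sem {L : List Link} {m : ℕ} {aux : List ℕ} {O : Multiset Edge}
    {qs : List (ℕ × ℕ)} {R : List Link} (h : GraftReady L m aux O qs R)
    {w : ℕ → List (Valuation A × ℕ)} {e : Valuation A} {n : ℕ} (hR : Links.Sem strict R e n)
    (hw : ∀ q ∈ qs, ∀ k ∈ w q.1, Links.Sem strict L k.1 k.2)
    (hp : ∀ q ∈ qs, (((w q.1).map fun k => (k.1.1 m).dual : List (D A)) : Multiset (D A)) =
      e.2 (tag 0 q.1))
    (hx : ∀ q ∈ qs, ∀ s ∈ aux, e.2 (tag (q.2 + 1) s) = ((w q.1).map fun k => k.1.2 s).sum) :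
    ∃ e' n', Links.Sem strict (LLNet.grafts L m aux qs R) e' n' ∧
      n' ≤ n + (qs.map fun q => ((w q.1).map Prod.snd).sum).sum ∧
      (∀ i, e'.1 (tag 0 i) = e.1 (tag 0 i)) ∧ (∀ i, e'.2 (tag 0 i) = e.2 (tag 0 i)) ∧
      ∀ j, ∀ s ∈ aux, e'.2 (tag j s) = e.2 (tag j s) := by
  induction qs generalizing R e n with
  | nil => exact ⟨e, n, hR, by simp, fun _ => rfl, fun _ => rfl, fun _ _ _ => rfl⟩
  | cons q qs ih =>
    have hinj := tag_injective (q.2 + 1)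
    have hinv := Function.leftInverse_invFun hinj
    obtain ⟨e1, n1, h1, h2, h3, h4⟩ := Links.Sem.graft (N := copyNames q.2)
      (xs := aux.map (tag (q.2 + 1))) names_mem_copyNames ⟨m, rfl⟩
      (fun x hx => by obtain ⟨s, _, rfl⟩ := List.mem_map.1 hx; exact ⟨s, rfl⟩) R h.boxes
      h.isModule.nodup_conc h.mem_conc (h.fresh q (by simp)) e n
      ((w q.1).map fun k => (k.1.comap (Function.invFun (tag (q.2 + 1))), k.2)) hR
      (fun k hk => by
        obtain ⟨k, hk', rfl⟩ := List.mem_map.1 hk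
        rw [Links.sem_rename hinj, Valuation.comap_comap_invFun hinj]
        exact hw q (by simp) k hk')
      (by
        rw [← hp q (by simp), List.map_map]
        simp [Valuation.comap, Function.comp_def, hinv m])
      (fun x hx' => by
        obtain ⟨s, hs, rfl⟩ := List.mem_map.1 hx'
        rw [hx q (by simp) s hs, List.map_map]
        simp [Valuation.comap, Function.comp_def, hinv s])
    have h5 : ∀ i, e1.2 (tag 0 i) = e.2 (tag 0 i) := fun i => h4 _ (.inl zero_notMem_copyNames)
    have h6 : ∀ j, ∀ s ∈ aux, e1.2 (tag j s) = e.2 (tag j s) := by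
      intro j s hs
      refine h4 _ ?_
      rw [tag_mem_copyNames]
      by_cases hj : j = q.2 + 1
      · exact .inr (hj ▸ List.mem_map_of_mem hs)
      · exact .inl hj
    obtain ⟨e', n', h7, h8, h9, h10, h11⟩ := ih h.step h1 (fun q hq => hw q (by simp [hq]))
      (fun q hq => by rw [hp q (by simp [hq]), h5])
      (fun q hq s hs => by rw [h6 _ s hs, hx q (by simp [hq]) s hs])
    refine ⟨e', n', h7, ?_, fun i => (h9 i).trans (h3 _ zero_notMem_copyNames),
      fun i => (h10 i).trans (h5 i), fun j s hs => (h11 j s hs).trans (h6 j s hs)⟩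
    rw [List.map_cons, List.sum_cons]
    simp only [List.map_map, Function.comp_def] at h2
    have : (fun x : Valuation A × ℕ => x.2) = Prod.snd := rfl
    rw [this] at h2
    omega

/-- A valuation of the result of the grafts gives valuations of the structure and of the copies
of the box. -/
theorem GraftReady.of_sem {L : List Link} {m : ℕ} {aux : List ℕ} {O : Multiset Edge}
    {qs : List (ℕ × ℕ)} {R : List Link} (h : GraftReady L m aux O qs R)
    {e' : Valuation A} {n' : ℕ} (hR : Links.Sem strict (LLNet.grafts L m aux qs R) e' n') :
    ∃ (e : Valuation A) (n : ℕ) (w : ℕ → List (Valuation A × ℕ)), Links.Sem strict R e n ∧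
      (∀ q ∈ qs, w q.1 ≠ [] ∧ (∀ k ∈ w q.1, Links.Sem strict L k.1 k.2) ∧
        (((w q.1).map fun k => (k.1.1 m).dual : List (D A)) : Multiset (D A)) = e.2 (tag 0 q.1) ∧
        ∀ s ∈ aux, e.2 (tag (q.2 + 1) s) = ((w q.1).map fun k => k.1.2 s).sum) ∧
      e.1 = e'.1 ∧ ∀ i, (∀ q ∈ qs, i ≠ tag 0 q.1) → e.2 i = e'.2 i := by
  induction qs generalizing R with
  | nil => exact ⟨e', n', fun _ => [], hR, by simp, rfl, fun _ _ => rfl⟩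
  | cons q qs ih =>
    have hinj := tag_injective (q.2 + 1)
    obtain ⟨e1, n1, w, h1, h2, h3, h4⟩ := ih h.step hR
    obtain ⟨e, n, ks, h5, h6, h7, h8, h9, h10, h11⟩ := Links.Sem.of_graft R h.boxes
      h.isModule.nodup_conc h.mem_conc h.notMem_prem e1 n1 h1
    have hw : ∀ q' ∈ qs, Function.update w q.1
        (ks.map fun k => (k.1.comap (tag (q.2 + 1)), k.2)) q'.1 = w q'.1 := fun q' hq' =>
      Function.update_of_ne (h.ne_fst hq').symm _ _
    refine ⟨e, n, Function.update w q.1 (ks.map fun k => (k.1.comap (tag (q.2 + 1)), k.2)),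
      h5, ?_, h10.trans h3, fun i hi => ?_⟩
    · intro q' hq'
      rcases List.mem_cons.1 hq' with rfl | hq'
      · rw [Function.update_self]
        refine ⟨by simpa using h6, ?_, ?_, ?_⟩
        · intro k hk
          obtain ⟨k, hk', rfl⟩ := List.mem_map.1 hk
          exact (Links.sem_rename hinj _ _ _).1 (h7 k hk')
        · rw [← h8, List.map_map]; rfl
        · intro s hs
          rw [h11 _ (by simp [tag_inj]), h9 _ (List.mem_map_of_mem hs), List.map_map]; rfl
      · rw [hw q' hq']
        obtain ⟨h12, h13, h14, h15⟩ := h2 q' hq'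
        refine ⟨h12, h13, ?_, fun s hs => ?_⟩
        · rw [h14, h11 _ fun h' => h.ne_fst hq' (tag_inj.1 h').2.symm]
        · rw [← h15 s hs, h11 _ (by simp [tag_inj])]
    · rw [h11 i (hi q (by simp)), h4 i fun q' hq' => hi q' (by simp [hq'])]

theorem Link.substWhy_eq_rename {f : ℕ → ℕ} {σ : ℕ → List ℕ} {l : Link}
    (h : ∀ ps c, l ≠ .why ps c) : l.substWhy f σ = l.rename f := by
  cases l <;> simp_all [substWhy]

theorem Link.structural_mem_premises {l : Link} {s : ℕ} (h : Edge.structural s ∈ l.premises) :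
    ∃ ps c, l = .why ps c ∧ s ∈ ps := by
  cases l <;> simp_all [premises]

theorem Link.agree_comap {f : ℕ → ℕ} {e e' : Valuation A} {l : Link} (hl : ∀ ps c, l ≠ .why ps c)
    (h1 : ∀ i, (.logical i ∈ l.premises ∨ .logical i ∈ l.conclusions) → e'.1 (f i) = e.1 i)
    (h2 : ∀ s, .structural s ∈ l.conclusions → e'.2 (f s) = e.2 s) :
    ∀ x, x ∈ l.premises ∨ x ∈ l.conclusions → Agree e (e'.comap f) x := by
  intro x hx
  cases x with
  | logical i => exact (h1 i hx).symm
  | structural s =>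
    rcases hx with hx | hx
    · obtain ⟨ps, c, rfl, _⟩ := structural_mem_premises hx
      exact absurd rfl (hl ps c)
    · exact (h2 s hx).symm

/-- The copies of an edge may carry less than the edge did. Lax `?`-links tolerate this deficit,
which is how erasing is accommodated. -/
theorem Links.Sem.substWhy {f : ℕ → ℕ} (hf : Function.Injective f) {σ : ℕ → List ℕ}
    {e e' : Valuation A} {R : List Link} {n : ℕ} (h1 : ∀ i, e'.1 (f i) = e.1 i)
    (h2 : ∀ s, .structural s ∈ conc R → e'.2 (f s) = e.2 s)
    (h3 : ∀ s, ((σ s).map e'.2).sum ≤ e.2 s) (hR : Links.Sem False R e n) :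
    Links.Sem False (R.map (Link.substWhy f σ)) e' n := by
  refine hR.map fun l hl i hi => ?_
  by_cases hw : ∃ ps c, l = .why ps c
  · obtain ⟨ps, c, rfl⟩ := hw
    simp only [Link.Sem, Link.substWhy, false_imp_iff, and_true] at hi ⊢
    obtain ⟨⟨μ, hc, hμ⟩, rfl⟩ := hi
    refine ⟨⟨μ, by rw [h1, hc], le_trans ?_ hμ⟩, rfl⟩
    rw [sum_map_flatMap]
    exact List.sum_le_sum fun s _ => h3 s
  · push Not at hw
    rw [Link.substWhy_eq_rename hw, Link.sem_rename hf]
    exact hi.congr (Link.agree_comap hw (fun i _ => h1 i)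
      fun s hs => h2 s (mem_conc.2 ⟨l, hl, hs⟩))

/-- The condition `σ s ≠ []` prevents a `?`-link with premises from losing them all. Otherwise it
would become one with a free value, and its strict equation could not be recovered. -/
theorem Links.Sem.of_substWhy {f : ℕ → ℕ} (hf : Function.Injective f) {σ : ℕ → List ℕ}
    {e e' : Valuation A} {R : List Link} {n : ℕ}
    (h1 : ∀ i, (.logical i ∈ prem R ∨ .logical i ∈ conc R) → e'.1 (f i) = e.1 i)
    (h2 : ∀ s, .structural s ∈ conc R → e'.2 (f s) = e.2 s)
    (h3 : ∀ s, .structural s ∈ prem R → σ s ≠ [] ∧ ((σ s).map e'.2).sum = e.2 s)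
    (hR : Links.Sem True (R.map (Link.substWhy f σ)) e' n) : Links.Sem True R e n := by
  refine hR.of_map fun l hl i hi => ?_
  by_cases hw : ∃ ps c, l = .why ps c
  · obtain ⟨ps, c, rfl⟩ := hw
    have hs : ∀ s ∈ ps, σ s ≠ [] ∧ ((σ s).map e'.2).sum = e.2 s := fun s hs =>
      h3 s (mem_prem.2 ⟨_, hl, by simp [Link.premises, hs]⟩)
    have hsum : ((ps.flatMap σ).map e'.2).sum = (ps.map e.2).sum := by
      rw [sum_map_flatMap]
      exact congrArg _ (List.map_congr_left fun s h => (hs s h).2)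
    simp only [Link.Sem, Link.substWhy, true_imp_iff, hsum] at hi ⊢
    obtain ⟨⟨μ, hc, hμ, hμ'⟩, rfl⟩ := hi
    refine ⟨⟨μ, ?_, hμ, fun hps => hμ' fun h => ?_⟩, rfl⟩
    · rw [← h1 c (.inr (mem_conc.2 ⟨_, hl, by simp [Link.conclusions]⟩)), hc]
    · obtain ⟨s, hs'⟩ := List.exists_mem_of_ne_nil _ hps
      exact (hs s hs').1 (List.flatMap_eq_nil_iff.1 h s hs')
  · push Not at hw
    rw [Link.substWhy_eq_rename hw, Link.sem_rename hf] at hi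
    refine hi.congr fun x hx => ?_
    have := Link.agree_comap (e := e) (e' := e') hw
      (fun i hi => h1 i (hi.imp (fun h => mem_prem.2 ⟨l, hl, h⟩) fun h => mem_conc.2 ⟨l, hl, h⟩))
      (fun s hs => h2 s (mem_conc.2 ⟨l, hl, hs⟩)) x hx
    cases x <;> exact this.symm

/-! ### Reduction decreases the size of lax valuations -/

variable {A : Type u}

theorem Struct.copies_eq {ps aux : List ℕ} {s : ℕ} (hs : s ∈ aux) :
    copies ps.length aux s = ps.zipIdx.map fun q => tag (q.2 + 1) s := by
  rw [copies, if_pos hs, List.range_eq_range', ← List.zipIdx_map_snd 0 ps, List.map_map]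
  rfl

theorem map_fst_zipIdx {M : Type*} (ps : List ℕ) (g : ℕ → M) :
    (ps.zipIdx.map fun q => g q.1) = ps.map g := by
  conv_rhs => rw [← List.zipIdx_map_fst 0 ps, List.map_map]
  rfl

theorem Link.sem_cut {strict : Prop} {a b : ℕ} {t : Link} (ht : t = .cut a b ∨ t = .cut b a)
    {e : Valuation A} {n : ℕ} : t.Sem strict e n ↔ e.1 a = (e.1 b).dual ∧ n = 0 := by
  rcases ht with rfl | rfl
  · simp [Link.Sem]
  · simp only [Link.Sem]
    rw [D.dual_eq_iff]

theorem Link.sem_ax {strict : Prop} {a b : ℕ} {t : Link} (ht : t = .ax a b ∨ t = .ax b a)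
    {e : Valuation A} {n : ℕ} : t.Sem strict e n ↔ e.1 a = (e.1 b).dual ∧ n = 1 := by
  rcases ht with rfl | rfl
  · simp [Link.Sem]
  · simp only [Link.Sem]
    rw [D.dual_eq_iff]

theorem Link.Sem.renamePremises {strict : Prop} {f : ℕ → ℕ} {e e' : Valuation A} {l : Link} {n : ℕ}
    (h1 : ∀ i, .logical i ∈ l.premises → e'.1 (f i) = e.1 i)
    (h2 : ∀ i, .logical i ∈ l.conclusions → e'.1 i = e.1 i) (h3 : e'.2 = e.2) :
    (l.renamePremises f).Sem strict e' n ↔ l.Sem strict e n := by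
  cases l <;> simp_all [Link.Sem, Link.renamePremises, premises, conclusions]

theorem sum_map_sum_comm {α β M : Type*} [AddCommMonoid M] (l : List α) (k : List β)
    (g : α → β → M) : (l.map fun a => (k.map fun b => g a b).sum).sum =
      (k.map fun b => (l.map fun a => g a b).sum).sum := by
  induction l with
  | nil => simp
  | cons a l ih => simp [ih, List.sum_map_add]

/-- Every step at depth `0` removes links of positive size and distributes the valuations of a
duplicated box without repetition. The inequality on structural conclusions lets the induction pass
through the border of a box. -/
theorem Struct.StepWith.sem_decreasing {f : ℕ → ℕ} {σ : ℕ → List ℕ} {S S' : Struct}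
    (h : StepWith f σ S S') : S.Good → ∀ (e : Valuation A) (n : ℕ), Links.Sem False S.links e n →
    ∃ e' n', n' < n ∧ Links.Sem False S'.links e' n' ∧ S'.concl.map e'.1 = S.concl.map e.1 ∧
      ∀ s ∈ S.aux, ((σ s).map e'.2).sum ≤ e.2 s := by
  induction h with
  | @ax S a b c l t R hl ht h =>
    intro hS e n hn
    obtain ⟨i, _, rfl, hi, hn'⟩ := Links.Sem.cons_iff.1 (hn.perm h)
    obtain ⟨j, k, rfl, hj, h3⟩ := Links.Sem.cons_iff.1 hn'
    obtain ⟨h1, rfl⟩ := (Link.sem_ax hl).1 hi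
    obtain ⟨h2, rfl⟩ := (Link.sem_cut ht).1 hj
    have hac : ∀ i, e.1 (if i = a then c else i) = e.1 i := by
      intro i
      split_ifs with hi
      · rw [hi, h1, h2, D.dual_dual]
      · rfl
    refine ⟨e, k, by omega, ?_, ?_, by simp⟩
    · exact h3.map fun l hl i hi =>
        (Link.Sem.renamePremises (fun i _ => hac i) (fun _ _ => rfl) rfl).2 hi
    · simp [hac]
  | @mult S a b c a' b' c' t R ht h =>
    intro hS e n hn
    obtain ⟨i, _, rfl, h1, hn1⟩ := Links.Sem.cons_iff.1 (hn.perm h)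
    obtain ⟨j, _, rfl, h2, hn2⟩ := Links.Sem.cons_iff.1 hn1
    obtain ⟨k, r, rfl, hk, h4⟩ := Links.Sem.cons_iff.1 hn2
    obtain ⟨h3, rfl⟩ := (Link.sem_cut ht).1 hk
    simp only [Link.Sem] at h1 h2
    rw [h1.1, h2.1, D.dual_pair] at h3
    obtain ⟨-, h5, h6⟩ := D.pair_inj h3
    refine ⟨e, r, by omega, ?_, rfl, by simp⟩
    refine Links.Sem.cons_iff.2 ⟨0, r, by simp, by simpa [Link.Sem] using h5, ?_⟩
    exact Links.Sem.cons_iff.2 ⟨0, r, by simp, by simpa [Link.Sem] using h6, h4⟩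
  | @unit S c c' t R ht h =>
    intro hS e n hn
    obtain ⟨i, _, rfl, h1, hn1⟩ := Links.Sem.cons_iff.1 (hn.perm h)
    obtain ⟨j, _, rfl, h2, hn2⟩ := Links.Sem.cons_iff.1 hn1
    obtain ⟨k, r, rfl, -, h4⟩ := Links.Sem.cons_iff.1 hn2
    simp only [Link.Sem] at h1 h2
    exact ⟨e, r, by omega, h4, rfl, by simp⟩
  | @exp S c w m L aux ps t R ht h =>
    intro hS e n hn
    obtain ⟨i, _, rfl, h1, hn1⟩ := Links.Sem.cons_iff.1 (hn.perm h)
    obtain ⟨j, _, rfl, h2, hn2⟩ := Links.Sem.cons_iff.1 hn1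
    obtain ⟨k, r, rfl, hk, h4⟩ := Links.Sem.cons_iff.1 hn2
    obtain ⟨h3, rfl⟩ := (Link.sem_cut ht).1 hk
    simp only [Link.Sem, false_imp_iff, and_true] at h1 h2
    obtain ⟨es, hne, hes, hc, haux, rfl⟩ := h1
    obtain ⟨⟨μ, hw, hμ⟩, rfl⟩ := h2
    have hμe : ((es.map fun k => (k.1.1 m).dual : List (D A)) : Multiset (D A)) = μ := by
      rw [hc, hw, D.dual_bag] at h3
      have := (D.bag_inj h3).2
      rw [← Multiset.map_id μ, ← show D.dual ∘ D.dual = (id : D A → D A) from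
        funext D.dual_dual, ← Multiset.map_map, ← this]
      simp [Function.comp_def]
    -- `μ'` is the excess of the lax `?`-link. The valuations `ks'` of the box that correspond to it
    -- are discarded; the others, `ks`, are shared among the premises.
    obtain ⟨μ', rfl⟩ := Multiset.le_iff_exists_add.1 hμ
    obtain ⟨ks, ks', h5, -, h6⟩ := exists_split _ _ _ _ hμe
    have hps : ps.Nodup := by
      have := (hS.isModule.perm h).nodup_prem
      simp only [prem_cons, coe_premises_why] at this
      have := (Multiset.nodup_add.1 (Multiset.nodup_add.1 this).2.1).1
      exact (Multiset.coe_nodup.1 this).of_map _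
    obtain ⟨v, h7, h8⟩ := exists_distribution_of_nodup _ _ hps ks h5
    have hves : (ps.flatMap v ++ ks').Perm es := (h8.append_right ks').trans h6
    have hmem : ∀ q ∈ ps.zipIdx, ps.getD q.2 0 = q.1 := fun q hq => by
      rw [List.getD_eq_getElem?_getD, List.mem_zipIdx_iff_getElem?.1 hq]; rfl
    have hca := (hS.isModule.perm h).exp_cut ht
    -- Tag `0` marks uncopied edges and keeps their values. Tag `j + 1` marks the copy for the
    -- premise of index `j`, which receives the contributions of the valuations `v` assigned to that
    -- premise; the default of `getD` matters only beyond the length of `ps`.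
    let e0 : Valuation A := (fun x => e.1 x.unpair.2, fun x => match x.unpair.1 with
      | 0 => e.2 x.unpair.2
      | j + 1 => ((v (ps.getD j 0)).map fun k => k.1.2 x.unpair.2).sum)
    have h01 : ∀ i, e0.1 (tag 0 i) = e.1 i := fun i => by simp [e0, tag]
    have h02 : ∀ i, e0.2 (tag 0 i) = e.2 i := fun i => by simp [e0, tag]
    have h03 : ∀ q ∈ ps.zipIdx, ∀ s, e0.2 (tag (q.2 + 1) s) =
        ((v q.1).map fun k => k.1.2 s).sum := fun q hq s => by
      rw [← hmem q hq]; simp [e0, tag]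
    have h04 : ∀ s, ((copies ps.length aux s).map e0.2).sum ≤ e.2 s := by
      intro s
      by_cases hs : s ∈ aux
      · rw [copies_eq hs, List.map_map, haux s hs, ← sum_map_perm hves, List.map_append,
          List.sum_append, sum_map_flatMap, ← map_fst_zipIdx]
        refine le_trans (le_of_eq ?_) (Multiset.le_add_right _ _)
        exact congrArg _ (List.map_congr_left fun q hq => h03 q hq s)
      · simp [copies, hs, h02]
    have hR := h4.substWhy (tag_injective 0) h01 (fun s _ => h02 s) h04
    obtain ⟨e', n', h9, h10, h11, h12, h13⟩ := (Struct.graftReady hS ht h).sem (w := v) hR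
      (fun q hq k hk => hes k (hves.mem_iff.1 (List.mem_append_left _
        (List.mem_flatMap.2 ⟨_, List.fst_mem_of_mem_zipIdx hq, hk⟩))))
      (fun q hq => by rw [h02, h7 _ (List.fst_mem_of_mem_zipIdx hq)])
      (fun q hq s _ => h03 q hq s)
    refine ⟨e', n', ?_, h9, ?_, fun s hs => le_trans (le_of_eq ?_) (h04 s)⟩
    · rw [map_fst_zipIdx ps fun p => ((v p).map Prod.snd).sum, ← sum_map_flatMap] at h10
      rw [← sum_map_perm hves, List.map_append, List.sum_append]
      omega
    · simp [Function.comp_def, h11, h01]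
    · refine congrArg _ (List.map_congr_left fun x hx => ?_)
      rcases mem_copies.1 hx with ⟨hs, j, _, rfl⟩ | ⟨_, rfl⟩
      · exact h13 _ s hs
      · exact h12 s
  | @box f σ S c m m' L L' R aux aux' h step ih =>
    intro hS e n hn
    have hm := hS.isModule.perm h
    have hr := step.isRenaming
    have hinv := Function.leftInverse_invFun hr.inj
    have haux' : aux' = aux.flatMap σ := step.aux_eq
    obtain ⟨i, r, rfl, h1, h2⟩ := Links.Sem.cons_iff.1 (hn.perm h)
    simp only [Link.Sem] at h1
    obtain ⟨es, hne, hes, hc, haux, rfl⟩ := h1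
    have hstep : ∀ k ∈ es, ∃ k' : Valuation A × ℕ, k'.2 < k.2 ∧ Links.Sem False L' k'.1 k'.2 ∧
        k'.1.1 m' = k.1.1 m ∧ ∀ s ∈ aux, ((σ s).map k'.1.2).sum ≤ k.1.2 s := by
      intro k hk
      obtain ⟨e', n', h3, h4, h5, h6⟩ := ih (hS.boxes (h.mem_iff.2 List.mem_cons_self)) k.1 k.2
        (hes k hk)
      exact ⟨(e', n'), h3, h4, by simpa using h5, h6⟩
    have : Nonempty (Valuation A × ℕ) := ⟨(e, 0)⟩
    choose! φ hφ using hstep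
    classical
    -- The new auxiliary conclusions receive the sums over the reduced valuations of the box; all
    -- other edges keep their values under the renaming.
    let e0 : Valuation A := (fun x => e.1 (Function.invFun f x), fun x =>
      if x ∈ aux' then (es.map fun k => (φ k).1.2 x).sum else e.2 (Function.invFun f x))
    have h01 : ∀ i, e0.1 (f i) = e.1 i := fun i => by simp [e0, hinv i]
    have h02 : ∀ s, s ∉ aux → e0.2 (f s) = e.2 s := by
      intro s hs
      have : f s ∉ aux' := by
        rw [haux', List.mem_flatMap]
        rintro ⟨s', hs', hf⟩
        exact hr.fresh s s' (fun h => hs (h ▸ hs')) hf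
      simp [e0, this, hinv s]
    have h03 : ∀ x ∈ aux', e0.2 x = (es.map fun k => (φ k).1.2 x).sum := fun x hx => if_pos hx
    have h04 : ∀ s, ((if s ∈ aux then σ s else [f s]).map e0.2).sum ≤ e.2 s := by
      intro s
      split_ifs with hs
      · rw [haux s hs]
        have : (σ s).map e0.2 = (σ s).map fun x => (es.map fun k => (φ k).1.2 x).sum :=
          List.map_congr_left fun x hx => h03 x (haux' ▸ List.mem_flatMap.2 ⟨s, hs, hx⟩)
        rw [this, sum_map_sum_comm]
        exact List.sum_le_sum fun k hk => (hφ k hk).2.2.2 s hs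
      · simp [h02 s hs]
    have hnd := hm.nodup
    simp only [conc_cons, coe_conclusions_bang] at hnd
    have hR := h2.substWhy hr.inj (σ := fun s => if s ∈ aux then σ s else [f s]) h01
      (fun s hs => h02 s fun hsa => Multiset.disjoint_left.1
        (Multiset.nodup_add.1 (Multiset.nodup_add.1 hnd).1).2.2
          (show Edge.structural s ∈ _ by simp [hsa]) hs) h04
    refine ⟨e0, 1 + ((es.map φ).map Prod.snd).sum + r, ?_, Links.Sem.cons_iff.2 ⟨_, _, rfl, ?_, hR⟩,
      by simp [Function.comp_def, h01], fun s _ => h04 s⟩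
    -- Strictness needs at least one valuation of the box.
    · have : ((es.map φ).map Prod.snd).sum < (es.map Prod.snd).sum := by
        rw [List.map_map]
        exact List.sum_lt_sum_of_ne_nil hne _ _ fun k hk => (hφ k hk).1
      omega
    · simp only [Link.Sem]
      refine ⟨es.map φ, by simpa using hne, ?_, ?_, ?_, rfl⟩
      · intro k hk
        obtain ⟨k', hk', rfl⟩ := List.mem_map.1 hk
        exact (hφ k' hk').2.1
      · rw [h01, hc, List.map_map]
        congr 2
        exact List.map_congr_left fun k hk => (hφ k hk).2.2.1.symm
      · intro s hs
        rw [h03 s hs, List.map_map]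
        rfl

/-! ### Non-erasing steps reflect strict valuations -/

variable {A : Type u}

namespace Struct

/-- The steps that do not eliminate a cut between a `!`-link and a `?`-link without premises. -/
inductive NonErasing : (ℕ → ℕ) → (ℕ → List ℕ) → Struct → Struct → Prop
  | ax {S : Struct} {a b c : ℕ} {l t : Link} {R : List Link}
      (hl : l = .ax a b ∨ l = .ax b a) (ht : t = .cut b c ∨ t = .cut c b)
      (h : S.links.Perm (l :: t :: R)) :
      NonErasing id (fun s => [s]) S
        ⟨R.map (Link.renamePremises fun n => if n = a then c else n),
          S.concl.map (fun n => if n = a then c else n), S.aux⟩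
  | mult {S : Struct} {a b c a' b' c' : ℕ} {t : Link} {R : List Link}
      (ht : t = .cut c c' ∨ t = .cut c' c)
      (h : S.links.Perm (.tens a b c :: .par a' b' c' :: t :: R)) :
      NonErasing id (fun s => [s]) S ⟨.cut a a' :: .cut b b' :: R, S.concl, S.aux⟩
  | unit {S : Struct} {c c' : ℕ} {t : Link} {R : List Link}
      (ht : t = .cut c c' ∨ t = .cut c' c)
      (h : S.links.Perm (.one c :: .bot c' :: t :: R)) :
      NonErasing id (fun s => [s]) S ⟨R, S.concl, S.aux⟩
  | exp {S : Struct} {c w m : ℕ} {L : List Link} {aux ps : List ℕ} {t : Link} {R : List Link}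
      (hps : ps ≠ []) (ht : t = .cut c w ∨ t = .cut w c)
      (h : S.links.Perm (.bang c L m aux :: .why ps w :: t :: R)) :
      NonErasing (tag 0) (copies ps.length aux) S
        ⟨dispatch L m aux ps R, S.concl.map (tag 0), S.aux.flatMap (copies ps.length aux)⟩
  | box {f : ℕ → ℕ} {σ : ℕ → List ℕ} {S : Struct} {c m m' : ℕ} {L L' R : List Link}
      {aux aux' : List ℕ} (h : S.links.Perm (.bang c L m aux :: R))
      (step : NonErasing f σ ⟨L, [m], aux⟩ ⟨L', [m'], aux'⟩) :
      NonErasing f (fun s => if s ∈ aux then σ s else [f s]) S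
        ⟨.bang (f c) L' m' aux' ::
            R.map (Link.substWhy f fun s => if s ∈ aux then σ s else [f s]),
          S.concl.map f, S.aux.flatMap fun s => if s ∈ aux then σ s else [f s]⟩

theorem NonErasing.stepWith {f : ℕ → ℕ} {σ : ℕ → List ℕ} {S S' : Struct}
    (h : NonErasing f σ S S') : StepWith f σ S S' := by
  induction h with
  | ax hl ht h => exact .ax hl ht h
  | mult ht h => exact .mult ht h
  | unit ht h => exact .unit ht h
  | exp _ ht h => exact .exp ht h
  | box h _ ih => exact .box h ih

end Struct

theorem notMem_conc_of_cons {l : Link} {T : List Link} (h : (conc (l :: T)).Nodup) {x : Edge}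
    (hx : x ∈ l.conclusions) : x ∉ conc T := by
  rw [conc_cons] at h
  exact Multiset.disjoint_left.1 (Multiset.nodup_add.1 h).2.2 hx

theorem nodup_conc_of_cons {l : Link} {T : List Link} (h : (conc (l :: T)).Nodup) :
    (conc T).Nodup := by
  rw [conc_cons] at h
  exact (Multiset.nodup_add.1 h).2.1

theorem Struct.mem_outputs_logical {S : Struct} {i : ℕ} :
    Edge.logical i ∈ S.outputs ↔ i ∈ S.concl := by
  simp [Struct.outputs]

/-- The premises of a cut occur neither as other premises nor as conclusions of the structure, so
values can be assigned to them when the cut is restored. -/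
theorem Struct.Good.cut_fresh {S : Struct} (hS : S.Good) {a b : ℕ} {t : Link} {T : List Link}
    (ht : t = .cut a b ∨ t = .cut b a) (h : S.links.Perm (t :: T)) :
    a ≠ b ∧ (.logical a ∉ prem T ∧ a ∉ S.concl) ∧ (.logical b ∉ prem T ∧ b ∉ S.concl) := by
  have hm := (hS.isModule.perm h).nodup_prem_add
  rw [prem_cons, coe_premises_cut ht, add_assoc] at hm
  have h1 := Multiset.nodup_add.1 hm
  have h2 := (Multiset.nodup_add.1 h1.1).2.2
  have h3 : ∀ x, x = Edge.logical a ∨ x = .logical b → x ∉ prem T + S.outputs := fun x hx =>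
    Multiset.disjoint_left.1 h1.2.2 (by simpa using hx)
  refine ⟨by simpa [eq_comm] using h2, ?_, ?_⟩
  · have := h3 _ (.inl rfl)
    rwa [Multiset.mem_add, not_or, mem_outputs_logical] at this
  · have := h3 _ (.inr rfl)
    rwa [Multiset.mem_add, not_or, mem_outputs_logical] at this

theorem Links.Sem.congr_prem_conc {strict : Prop} {T : List Link} {e e' : Valuation A} {n : ℕ}
    (hT : Links.Sem strict T e n) (h : ∀ x, x ∈ prem T ∨ x ∈ conc T → Agree e e' x) :
    Links.Sem strict T e' n :=
  hT.congr fun l hl x hx => h x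
    (hx.imp (fun h => mem_prem.2 ⟨l, hl, h⟩) fun h => mem_conc.2 ⟨l, hl, h⟩)

/-- A cut between the two conclusions of one axiom would be a cycle. -/
theorem IsModule.ax_ne {a b c : ℕ} {l t : Link} {R : List Link} {O : Multiset Edge}
    (hl : l = .ax a b ∨ l = .ax b a) (ht : t = .cut b c ∨ t = .cut c b)
    (h : IsModule (l :: t :: R) [] 0 O) : c ≠ a := by
  rintro rfl
  have hn1 := h.nodup_links
  simp only [List.nodup_cons, List.mem_cons, not_or] at hn1
  have hcb : Edge.logical b ≠ .logical c := by
    have := (Multiset.nodup_add.1 h.nodup_prem_add).1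
    rw [prem_cons, prem_cons, coe_premises_cut ht] at this
    have := (Multiset.nodup_add.1 (Multiset.nodup_add.1 this).2.1).1
    simpa [eq_comm] using this
  have hsl : l.Sw {.logical c, .logical b} := by
    rcases hl with rfl | rfl
    · exact ⟨by simp [Link.premises, Link.conclusions], fun h => h.elim⟩
    · exact ⟨by simp [Link.premises, Link.conclusions], fun h => h.elim⟩
  have h1 := (h.correct.cons (by simp [hn1]) hsl).cons (by simp [hn1]) (sw_cut ht)
  have h2 := (forest_append.1 (h1 (fun _ => ∅) fun _ _ => ⟨by simp, by simp⟩)).2.1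
  exact (forest_cons.1 h2).2 (.logical b) (by simp) (.logical c) (by simp) hcb
    (Conn.of_mem (H := {.logical c, .logical b}) (by simp) (by simp) (by simp))

/-- The values at the removed links are reconstructed from those of their premises. For an
exponential cut the valuations of all the copies are gathered into one list for the box. It is
non-empty because the `?`-link has a premise, which is where erasing steps fail. The conclusion `σ s
≠ []` carries this through boxes. -/
theorem Struct.NonErasing.sem_reflecting {f : ℕ → ℕ} {σ : ℕ → List ℕ} {S S' : Struct}
    (h : NonErasing f σ S S') : S.Good → ∀ (e' : Valuation A) (n' : ℕ),
    Links.Sem True S'.links e' n' →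
    ∃ e n, Links.Sem True S.links e n ∧ S.concl.map e.1 = S'.concl.map e'.1 ∧
      ∀ s ∈ S.aux, σ s ≠ [] ∧ ((σ s).map e'.2).sum = e.2 s := by
  induction h with
  | @ax S a b c l t R hl ht h =>
    intro hS e' n hn
    have hm := hS.isModule.perm h
    obtain ⟨hbc, ⟨hb1, hb2⟩, -, -⟩ := hS.cut_fresh ht (h.trans (.swap _ _ _))
    have hc := hm.nodup_conc
    have hlc : .logical a ∈ l.conclusions ∧ .logical b ∈ l.conclusions := by
      rcases hl with rfl | rfl <;> simp [Link.conclusions]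
    have ha := notMem_conc_of_cons hc hlc.1
    have hb := notMem_conc_of_cons hc hlc.2
    simp only [conc_cons, prem_cons, Multiset.mem_add, not_or] at ha hb hb1
    have hca : c ≠ a := hm.ax_ne hl ht
    have hba : b ≠ a := by
      rintro rfl
      simp only [conc_cons] at hc
      have := (Multiset.nodup_add.1 hc).1
      rcases hl with rfl | rfl <;> simp [Link.conclusions] at this
    -- In the reduct `c` stands for `a`; the vanished edge `b` receives the dual value.
    let e : Valuation A := (fun i => if i = b then (e'.1 c).dual else
      e'.1 (if i = a then c else i), e'.2)
    have he : ∀ i, i ≠ b → e'.1 (if i = a then c else i) = e.1 i := fun i hi => by simp [e, hi]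
    have hR : Links.Sem True R e n := hn.of_map fun l hl i hi => by
      refine (Link.Sem.renamePremises (e := e) (e' := e') (fun i hi => ?_) (fun i hi => ?_) rfl).1 hi
      · exact he i fun h : i = b => hb1.2 (mem_prem.2 ⟨l, hl, h ▸ hi⟩)
      · rw [← he i fun h : i = b => hb.2 (mem_conc.2 ⟨l, hl, h ▸ hi⟩),
          if_neg fun h : i = a => ha.2 (mem_conc.2 ⟨l, hl, h ▸ hi⟩)]
    refine ⟨e, 1 + (0 + n), Links.Sem.perm h.symm (Links.Sem.cons_iff.2 ⟨_, _, rfl, ?_,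
      Links.Sem.cons_iff.2 ⟨_, _, rfl, ?_, hR⟩⟩), ?_, by simp [e]⟩
    · rw [Link.sem_ax hl]
      simp [e, hba.symm]
    · rw [Link.sem_cut ht]
      simp [e, hbc.symm, hca]
    · rw [List.map_map]
      exact List.map_congr_left fun i hi => (he i fun h : i = b => hb2 (h ▸ hi)).symm
  | @mult S a b c a' b' c' t R ht h =>
    intro hS e' n hn
    have h' : S.links.Perm (t :: .tens a b c :: .par a' b' c' :: R) := by
      refine h.trans ?_
      exact (List.Perm.cons _ (List.Perm.swap _ _ _)).trans (.swap _ _ _)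
    obtain ⟨hcc, ⟨hc1, hc2⟩, hc1', hc2'⟩ := hS.cut_fresh ht h'
    have hc := (hS.isModule.perm h).nodup_conc
    have hc3 := notMem_conc_of_cons hc (x := .logical c) (by simp [Link.conclusions])
    have hc3' := notMem_conc_of_cons (nodup_conc_of_cons hc) (x := .logical c')
      (by simp [Link.conclusions])
    simp only [conc_cons, prem_cons, Multiset.mem_add, not_or, Link.premises,
      Multiset.mem_coe, List.mem_cons, List.not_mem_nil, or_false, Edge.logical.injEq]
      at hc3 hc3' hc1 hc1'
    obtain ⟨i, _, rfl, h1, hn1⟩ := Links.Sem.cons_iff.1 hn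
    obtain ⟨j, r, rfl, h2, h3⟩ := Links.Sem.cons_iff.1 hn1
    simp only [Link.Sem] at h1 h2
    let e : Valuation A := (fun i => if i = c then .pair .pos (e'.1 a) (e'.1 b) else
      if i = c' then .pair .neg (e'.1 a') (e'.1 b') else e'.1 i, e'.2)
    have hR : Links.Sem True R e r := h3.congr_prem_conc fun x hx => by
      cases x with
      | logical i =>
        have h4 : i ≠ c := by rintro rfl; tauto
        have h5 : i ≠ c' := by rintro rfl; tauto
        simp [Agree, e, h4, h5]
      | structural i => rfl
    refine ⟨e, 1 + (1 + (0 + r)), Links.Sem.perm h.symm (Links.Sem.cons_iff.2 ⟨_, _, rfl, ?_,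
      Links.Sem.cons_iff.2 ⟨_, _, rfl, ?_, Links.Sem.cons_iff.2 ⟨_, _, rfl, ?_, hR⟩⟩⟩), ?_,
      by simp [e]⟩
    · have h4 : a ≠ c ∧ a ≠ c' ∧ b ≠ c ∧ b ≠ c' := by grind
      simp [Link.Sem, e, h4]
    · have h4 : a' ≠ c ∧ a' ≠ c' ∧ b' ≠ c ∧ b' ≠ c' := by grind
      simp [Link.Sem, e, h4, hcc.symm]
    · rw [Link.sem_cut ht]
      simp [e, hcc.symm, h1.1, h2.1, Sign.flip]
    · refine List.map_congr_left fun i hi => ?_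
      have h4 : i ≠ c := by rintro rfl; exact hc2 hi
      have h5 : i ≠ c' := by rintro rfl; exact hc2' hi
      simp [e, h4, h5]
  | @unit S c c' t R ht h =>
    intro hS e' n hn
    have h' : S.links.Perm (t :: .one c :: .bot c' :: R) := by
      refine h.trans ?_
      exact (List.Perm.cons _ (List.Perm.swap _ _ _)).trans (.swap _ _ _)
    obtain ⟨hcc, ⟨hc1, hc2⟩, hc1', hc2'⟩ := hS.cut_fresh ht h'
    have hc := (hS.isModule.perm h).nodup_conc
    have hc3 := notMem_conc_of_cons hc (x := .logical c) (by simp [Link.conclusions])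
    have hc3' := notMem_conc_of_cons (nodup_conc_of_cons hc) (x := .logical c')
      (by simp [Link.conclusions])
    simp only [conc_cons, prem_cons, Multiset.mem_add, not_or] at hc3 hc3' hc1 hc1'
    let e : Valuation A := (fun i => if i = c then .star .pos else
      if i = c' then .star .neg else e'.1 i, e'.2)
    have hR : Links.Sem True R e n := Links.Sem.congr_prem_conc hn fun x hx => by
      cases x with
      | logical i =>
        have h4 : i ≠ c := by rintro rfl; tauto
        have h5 : i ≠ c' := by rintro rfl; tauto
        simp [Agree, e, h4, h5]
      | structural i => rfl
    refine ⟨e, 1 + (1 + (0 + n)), Links.Sem.perm h.symm (Links.Sem.cons_iff.2 ⟨_, _, rfl, ?_,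
      Links.Sem.cons_iff.2 ⟨_, _, rfl, ?_, Links.Sem.cons_iff.2 ⟨_, _, rfl, ?_, hR⟩⟩⟩), ?_,
      by simp [e]⟩
    · simp [Link.Sem, e]
    · simp [Link.Sem, e, hcc.symm]
    · rw [Link.sem_cut ht]
      simp [e, hcc.symm, Sign.flip]
    · refine List.map_congr_left fun i hi => ?_
      have h4 : i ≠ c := by rintro rfl; exact hc2 hi
      have h5 : i ≠ c' := by rintro rfl; exact hc2' hi
      simp [e, h4, h5]
  | @exp S c w m L aux ps t R hps ht h =>
    intro hS e' n' hn
    have h' : S.links.Perm (t :: .bang c L m aux :: .why ps w :: R) := by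
      refine h.trans ?_
      exact (List.Perm.cons _ (List.Perm.swap _ _ _)).trans (.swap _ _ _)
    obtain ⟨hcw, ⟨hc1, hc2⟩, hc1', hc2'⟩ := hS.cut_fresh ht h'
    have hm := hS.isModule.perm h
    have hc3 := notMem_conc_of_cons hm.nodup_conc (x := .logical c) (by simp [Link.conclusions])
    have hc3' := notMem_conc_of_cons (nodup_conc_of_cons hm.nodup_conc) (x := .logical w)
      (by simp [Link.conclusions])
    simp only [conc_cons, prem_cons, Multiset.mem_add, not_or] at hc3 hc3' hc1 hc1'
    obtain ⟨-, hap, hca, -⟩ := hm.exp_cut ht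
    have hg := Struct.graftReady hS ht h
    obtain ⟨e0, n0, v, h1, h2, h3, h4⟩ := hg.of_sem hn
    have hv : ∀ p ∈ ps, v p ≠ [] ∧ (∀ k ∈ v p, Links.Sem True L k.1 k.2) ∧
        (((v p).map fun k => (k.1.1 m).dual : List (D A)) : Multiset (D A)) = e0.2 (tag 0 p) := by
      intro p hp
      rw [← List.zipIdx_map_fst 0 ps] at hp
      obtain ⟨q, hq, rfl⟩ := List.mem_map.1 hp
      exact ⟨(h2 q hq).1, (h2 q hq).2.1, (h2 q hq).2.2.1⟩
    -- The restored `!`- and `?`-links receive all the values gathered from the copies, and a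
    -- structural edge receives the sum over its copies.
    let e : Valuation A := (fun i =>
      if i = c then .bag .pos (((ps.flatMap v).map fun k => k.1.1 m : List (D A))) else
      if i = w then .bag .neg (((ps.flatMap v).map fun k => (k.1.1 m).dual : List (D A)))
      else e0.1 (tag 0 i), fun s => ((copies ps.length aux s).map e0.2).sum)
    have he2 : ∀ s, s ∉ aux → e.2 s = e0.2 (tag 0 s) := fun s hs => by simp [e, copies, hs]
    have hne : ∀ s, copies ps.length aux s ≠ [] := by
      intro s
      unfold copies
      split_ifs
      · simpa using hps
      · simp
    have hR : Links.Sem True R e n0 := h1.of_substWhy (tag_injective 0)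
      (fun i hi => by
        have h4 : i ≠ c := by rintro rfl; tauto
        have h5 : i ≠ w := by rintro rfl; tauto
        simp [e, h4, h5])
      (fun s hs => (he2 s (hca s hs)).symm) (fun s _ => ⟨hne s, rfl⟩)
    have hmem : ∀ k ∈ ps.flatMap v, Links.Sem True L k.1 k.2 := by
      intro k hk
      obtain ⟨p, hp, hk⟩ := List.mem_flatMap.1 hk
      exact (hv p hp).2.1 k hk
    refine ⟨e, 1 + ((ps.flatMap v).map Prod.snd).sum + (1 + (0 + n0)),
      Links.Sem.perm h.symm (Links.Sem.cons_iff.2 ⟨_, _, rfl, ?_,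
      Links.Sem.cons_iff.2 ⟨_, _, rfl, ?_, Links.Sem.cons_iff.2 ⟨_, _, rfl, ?_, hR⟩⟩⟩), ?_, ?_⟩
    · simp only [Link.Sem]
      refine ⟨ps.flatMap v, ?_, hmem, by simp [e], fun s hs => ?_, rfl⟩
      · obtain ⟨p, hp⟩ := List.exists_mem_of_ne_nil _ hps
        exact fun h => (hv p hp).1 (List.flatMap_eq_nil_iff.1 h p hp)
      · simp only [e]
        rw [copies_eq hs, List.map_map, sum_map_flatMap, ← map_fst_zipIdx]
        exact congrArg _ (List.map_congr_left fun q hq => (h2 q hq).2.2.2 s hs)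
    · simp only [Link.Sem, and_true]
      have : (ps.map e.2).sum =
          (((ps.flatMap v).map fun k => (k.1.1 m).dual : List (D A)) : Multiset (D A)) := by
        rw [coe_map_flatMap]
        refine congrArg _ (List.map_congr_left fun p hp => ?_)
        rw [(hv p hp).2.2, he2 p fun h => hap p h hp]
      exact ⟨_, by simp [e, hcw.symm], this.le, fun _ _ => this⟩
    · rw [Link.sem_cut ht]
      simp [e, hcw.symm, Sign.flip, Function.comp_def]
    · rw [List.map_map]
      refine List.map_congr_left fun i hi => ?_
      have h5 : i ≠ c := by rintro rfl; exact hc2 hi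
      have h6 : i ≠ w := by rintro rfl; exact hc2' hi
      simp [e, h5, h6, h3]
    · intro s hs
      refine ⟨hne s, congrArg _ (List.map_congr_left fun x hx => (h4 x fun q hq he => ?_).symm)⟩
      rcases mem_copies.1 hx with ⟨_, j, _, rfl⟩ | ⟨_, rfl⟩
      · have := (tag_inj.1 he).1; omega
      · have h5 := (tag_inj.1 he).2
        have h6 := hm.nodup_prem_add
        have h7 : Edge.structural s ∈ S.outputs := by simp [Struct.outputs, hs]
        refine Multiset.disjoint_left.1 (Multiset.nodup_add.1 h6).2.2 ?_ h7
        refine mem_prem.2 ⟨.why ps w, by simp, ?_⟩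
        simpa [Link.premises, h5] using List.fst_mem_of_mem_zipIdx hq
  | @box f σ S c m m' L L' R aux aux' h step ih =>
    intro hS e' n' hn
    have hm := hS.isModule.perm h
    have hr := step.stepWith.isRenaming
    have haux' : aux' = aux.flatMap σ := step.stepWith.aux_eq
    obtain ⟨i, r, rfl, h1, h2⟩ := Links.Sem.cons_iff.1 hn
    simp only [Link.Sem] at h1
    obtain ⟨es, hne, hes, hc, haux, rfl⟩ := h1
    have hstep : ∀ k' ∈ es, ∃ k : Valuation A × ℕ, Links.Sem True L k.1 k.2 ∧
        k.1.1 m = k'.1.1 m' ∧ ∀ s ∈ aux, σ s ≠ [] ∧ ((σ s).map k'.1.2).sum = k.1.2 s := by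
      intro k' hk'
      obtain ⟨e, n, h3, h4, h5⟩ := ih (hS.boxes (h.mem_iff.2 List.mem_cons_self)) k'.1 k'.2
        (hes k' hk')
      exact ⟨(e, n), h3, by simpa using h4, h5⟩
    have : Nonempty (Valuation A × ℕ) := ⟨(e', 0)⟩
    choose! φ hφ using hstep
    -- One valuation of the box is needed merely to extract from the induction hypothesis that no
    -- auxiliary conclusion disappears.
    obtain ⟨k0, hk0⟩ := List.exists_mem_of_ne_nil _ hne
    have hσ : ∀ s, (if s ∈ aux then σ s else [f s]) ≠ [] := by
      intro s
      split_ifs with hs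
      · exact ((hφ k0 hk0).2.2 s hs).1
      · simp
    let e : Valuation A := (fun i => e'.1 (f i),
      fun s => ((if s ∈ aux then σ s else [f s]).map e'.2).sum)
    have hnd := hm.nodup
    simp only [conc_cons, coe_conclusions_bang] at hnd
    have hR : Links.Sem True R e r := h2.of_substWhy hr.inj (fun _ _ => rfl)
      (fun s hs => by
        have : s ∉ aux := fun hsa => Multiset.disjoint_left.1
          (Multiset.nodup_add.1 (Multiset.nodup_add.1 hnd).1).2.2
          (show Edge.structural s ∈ _ by simp [hsa]) hs
        simp [e, this]) fun s _ => ⟨hσ s, rfl⟩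
    refine ⟨e, 1 + ((es.map φ).map Prod.snd).sum + r, Links.Sem.perm h.symm
      (Links.Sem.cons_iff.2 ⟨_, _, rfl, ?_, hR⟩), by simp [e], fun s _ => ⟨hσ s, rfl⟩⟩
    simp only [Link.Sem]
    refine ⟨es.map φ, by simpa using hne, ?_, ?_, ?_, rfl⟩
    · intro k hk
      obtain ⟨k', hk', rfl⟩ := List.mem_map.1 hk
      exact (hφ k' hk').1
    · simp only [e]
      rw [hc, List.map_map]
      congr 2
      exact List.map_congr_left fun k hk => (hφ k hk).2.1.symm
    · intro s hs
      simp only [e, if_pos hs]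
      have : (σ s).map e'.2 = (σ s).map fun x => (es.map fun k => k.1.2 x).sum :=
        List.map_congr_left fun x hx => haux x (haux' ▸ List.mem_flatMap.2 ⟨s, hs, hx⟩)
      rw [this, sum_map_sum_comm, List.map_map]
      exact congrArg _ (List.map_congr_left fun k hk => ((hφ k hk).2.2 s hs).2)

/-! ### Normal forms -/

variable {A : Type u}

theorem Struct.Good.exists_conclusion {S : Struct} (hS : S.Good) {x : Edge}
    (hx : x ∈ prem S.links) : ∃ l ∈ S.links, x ∈ l.conclusions := by
  refine mem_conc.1 ?_
  have := hS.isModule.bal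
  rw [add_zero] at this
  rw [this]
  exact Multiset.mem_add.2 (.inl hx)

/-- The link above an edge fixes the sign and the shape of its value unless it is an axiom. Duality
flips the sign and keeps the shape, which leaves just the three legitimate pairs of links. A clash
inside a box is excluded because the box has at least one valuation. -/
theorem Struct.HasClash.not_sem {S : Struct} (h : S.HasClash) (hS : S.Good) (e : Valuation A)
    (n : ℕ) : ¬ Links.Sem False S.links e n := by
  induction h generalizing e n with
  | here S a b h hab hba ha hb =>
    intro hn
    obtain ⟨_, _, hc⟩ := hn.of_mem h
    obtain ⟨la, hla, hca⟩ := hS.exists_conclusion (x := .logical a)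
      (mem_prem.2 ⟨_, h, by simp [Link.premises]⟩)
    obtain ⟨lb, hlb, hcb⟩ := hS.exists_conclusion (x := .logical b)
      (mem_prem.2 ⟨_, h, by simp [Link.premises]⟩)
    obtain ⟨_, _, hva⟩ := hn.of_mem hla
    obtain ⟨_, _, hvb⟩ := hn.of_mem hlb
    simp only [Link.Sem] at hc
    have hv := congrArg D.view hc.1
    cases la <;> simp only [Link.conclusions, List.mem_cons, List.mem_map, List.not_mem_nil,
      or_false, Edge.logical.injEq, reduceCtorEq, and_false, exists_false] at hca
    case ax x y =>
      rcases hca with rfl | rfl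
      · exact ha ⟨_, .inl hla⟩
      · exact ha ⟨_, .inr hla⟩
    all_goals
      subst hca
      cases lb <;> simp only [Link.conclusions, List.mem_cons, List.mem_map, List.not_mem_nil,
        or_false, Edge.logical.injEq, reduceCtorEq, and_false, exists_false] at hcb
      case ax x y =>
        rcases hcb with rfl | rfl
        · exact hb ⟨_, .inl hlb⟩
        · exact hb ⟨_, .inr hlb⟩
      all_goals
        subst hcb
        simp only [Link.Sem] at hva hvb
        first
        | exact hab (.inl ⟨_, _, _, _, hla, hlb⟩)
        | exact hba (.inl ⟨_, _, _, _, hlb, hla⟩)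
        | exact hab (.inr (.inl ⟨hla, hlb⟩))
        | exact hba (.inr (.inl ⟨hlb, hla⟩))
        | exact hab (.inr (.inr ⟨_, _, _, _, hla, hlb⟩))
        | exact hba (.inr (.inr ⟨_, _, _, _, hlb, hla⟩))
        | (clear hc; grind [D.view_star, D.view_pair, D.view_bag, D.dual_star, D.dual_pair,
            D.dual_bag, Sign.flip])
  | box S c m L aux h hc ih =>
    intro hn
    obtain ⟨_, _, hc⟩ := hn.of_mem h
    simp only [Link.Sem] at hc
    obtain ⟨es, hne, hes, -⟩ := hc
    obtain ⟨k, hk⟩ := List.exists_mem_of_ne_nil _ hne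
    exact ih (hS.boxes h) _ _ (hes k hk)

/-- The rank is the number of edges strictly above; these are premises, hence finitely many. It
serves to compute values from the axioms downwards. -/
theorem Struct.exists_rank {S : Struct} {I O : Multiset Edge} (h : IsModule S.links [] I O) :
    ∃ r : Edge → ℕ, ∀ a b, S.Above a b → r a < r b := by
  refine ⟨fun b => {a | Relation.TransGen S.Above a b}.ncard, fun a _ hab => ?_⟩
  refine Set.ncard_lt_ncard ⟨fun c hc => hc.tail hab, fun hs => ?_⟩ ?_
  · exact Struct.acyclic_of_isModule h a (hs (.single hab))
  · refine Set.Finite.subset (Multiset.finite_toSet (prem S.links)) fun c hc => ?_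
    obtain ⟨d, ⟨l, hl, hcl, _⟩, _⟩ := Relation.TransGen.head'_iff.1 hc
    exact mem_prem.2 ⟨l, hl, hcl⟩

/-- The value of a conclusion of a link, given the values of its premises, the values `ω` of the
`?`-links without premises, and a valuation `κ` of the box of every `!`-link. -/
noncomputable def Link.output (κ : Link → Valuation A) (ω : ℕ → Multiset (D A)) (e : Valuation A) :
    Link → Edge → D A × Multiset (D A)
  | .ax a _, x => open Classical in (if x = .logical a then .star .pos else .star .neg, 0)
  | .tens a b _, _ => (.pair .pos (e.1 a) (e.1 b), 0)
  | .par a b _, _ => (.pair .neg (e.1 a) (e.1 b), 0)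
  | .one _, _ => (.star .pos, 0)
  | .bot _, _ => (.star .neg, 0)
  | .flat a _, _ => (.star .pos, {e.1 a})
  | .why [] c, _ => (.bag .neg (ω c), 0)
  | .why (p :: ps) _, _ => (.bag .neg ((p :: ps).map e.2).sum, 0)
  | .bang c L m aux, x => (.bag .pos {(κ (.bang c L m aux)).1 m},
      (κ (.bang c L m aux)).2 x.name)
  | .cut _ _, _ => (.star .pos, 0)

theorem Link.output_congr {κ : Link → Valuation A} {ω : ℕ → Multiset (D A)} {e e' : Valuation A}
    {l : Link} (h : ∀ x ∈ l.premises, Agree e e' x) (x : Edge) :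
    l.output κ ω e x = l.output κ ω e' x := by
  cases l with
  | why ps c =>
    cases ps with
    | nil => rfl
    | cons p ps =>
      have : (p :: ps).map e.2 = (p :: ps).map e'.2 := List.map_congr_left fun s hs =>
        h (.structural s) (List.mem_map_of_mem hs)
      simp only [output, this]
  | _ => simp_all [output, premises, Agree]

/-- Values of all edges that are compatible with all links but the cuts. -/
theorem Struct.exists_output {S : Struct} {I O : Multiset Edge} (h : IsModule S.links [] I O)
    (κ : Link → Valuation A) (ω : ℕ → Multiset (D A)) :
    ∃ e : Valuation A, ∀ l ∈ S.links,
      (∀ i, .logical i ∈ l.conclusions → e.1 i = (l.output κ ω e (.logical i)).1) ∧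
      ∀ s, .structural s ∈ l.conclusions → e.2 s = (l.output κ ω e (.structural s)).2 := by
  classical
  obtain ⟨r, hr⟩ := exists_rank h
  -- One simultaneous recomputation of all edges from the link above each. The defaults concern
  -- edges that are the conclusion of no link.
  let next : Valuation A → Valuation A := fun e =>
    (fun i => if h : ∃ l ∈ S.links, Edge.logical i ∈ l.conclusions then
        (h.choose.output κ ω e (.logical i)).1 else .star .pos,
      fun s => if h : ∃ l ∈ S.links, Edge.structural s ∈ l.conclusions then
        (h.choose.output κ ω e (.structural s)).2 else 0)
  have hnext : ∀ e, ∀ l ∈ S.links,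
      (∀ i, .logical i ∈ l.conclusions → (next e).1 i = (l.output κ ω e (.logical i)).1) ∧
      ∀ s, .structural s ∈ l.conclusions → (next e).2 s = (l.output κ ω e (.structural s)).2 := by
    intro e l hl
    constructor
    · intro i hi
      have hex : ∃ l ∈ S.links, Edge.logical i ∈ l.conclusions := ⟨l, hl, hi⟩
      rw [show (next e).1 i = _ from dif_pos hex, eq_of_mem_conclusions h.nodup_conc
        hex.choose_spec.1 hl hex.choose_spec.2 hi]
    · intro i hi
      have hex : ∃ l ∈ S.links, Edge.structural i ∈ l.conclusions := ⟨l, hl, hi⟩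
      rw [show (next e).2 i = _ from dif_pos hex, eq_of_mem_conclusions h.nodup_conc
        hex.choose_spec.1 hl hex.choose_spec.2 hi]
  let e : ℕ → Valuation A := fun k => next^[k] (fun _ => .star .pos, fun _ => 0)
  have hstep : ∀ k, e (k + 1) = next (e k) := fun k => Function.iterate_succ_apply' _ _ _
  -- After `k` rounds the edges of rank less than `k` have reached their final value, because the
  -- premises above them have smaller rank.
  have hstable : ∀ k x, r x < k → Agree (e k) (e (k + 1)) x := by
    intro k
    induction k with
    | zero => intro x hx; omega
    | succ k ih =>
      intro x hx
      have hl : ∀ l ∈ S.links, x ∈ l.conclusions → ∀ y,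
          l.output κ ω (e k) y = l.output κ ω (e (k + 1)) y := fun l hl hxl y =>
        Link.output_congr (fun z hz => ih z (by have := hr z x ⟨l, hl, hz, hxl⟩; omega)) y
      cases x with
      | logical i =>
        rw [Agree, hstep k, hstep (k + 1)]
        by_cases hex : ∃ l ∈ S.links, Edge.logical i ∈ l.conclusions
        · obtain ⟨l, hlS, hi⟩ := hex
          rw [(hnext _ l hlS).1 i hi, (hnext _ l hlS).1 i hi, hl l hlS hi]
        · simp [next, hex]
      | structural i =>
        rw [Agree, hstep k, hstep (k + 1)]
        by_cases hex : ∃ l ∈ S.links, Edge.structural i ∈ l.conclusions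
        · obtain ⟨l, hlS, hi⟩ := hex
          rw [(hnext _ l hlS).2 i hi, (hnext _ l hlS).2 i hi, hl l hlS hi]
        · simp [next, hex]
  obtain ⟨K, hK⟩ : ∃ K, ∀ x ∈ conc S.links, r x < K := by
    refine ⟨((conc S.links).map r).sum + 1, fun x hx => ?_⟩
    exact Nat.lt_succ_of_le (Multiset.single_le_sum (fun _ _ => Nat.zero_le _) _
      (Multiset.mem_map_of_mem r hx))
  refine ⟨e K, fun l hl => ⟨fun i hi => ?_, fun s hs => ?_⟩⟩
  · rw [show (e K).1 i = (e (K + 1)).1 i from hstable K (.logical i) (hK _ (mem_conc.2 ⟨l, hl, hi⟩)),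
      hstep, (hnext _ l hl).1 i hi]
  · rw [show (e K).2 s = (e (K + 1)).2 s from
      hstable K (.structural s) (hK _ (mem_conc.2 ⟨l, hl, hs⟩)), hstep, (hnext _ l hl).2 s hs]

theorem exists_perm_cons_cons {α : Type*} {T : List α} {a b : α} (ha : a ∈ T) (hb : b ∈ T)
    (hab : a ≠ b) : ∃ R, T.Perm (a :: b :: R) := by
  classical
  have h1 := List.perm_cons_erase ha
  have hb' : b ∈ T.erase a := (List.mem_cons.1 (h1.mem_iff.1 hb)).resolve_left hab.symm
  exact ⟨_, h1.trans ((List.perm_cons_erase hb').cons a)⟩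

theorem exists_perm_cons_cons_cons {α : Type*} {T : List α} {a b c : α} (ha : a ∈ T) (hb : b ∈ T)
    (hc : c ∈ T) (hab : a ≠ b) (hac : a ≠ c) (hbc : b ≠ c) : ∃ R, T.Perm (a :: b :: c :: R) := by
  obtain ⟨R, hR⟩ := exists_perm_cons_cons ha hb hab
  have hc' : c ∈ R := by
    have := hR.mem_iff.1 hc
    simp only [List.mem_cons] at this
    exact (this.resolve_left hac.symm).resolve_left hbc.symm
  classical
  exact ⟨_, hR.trans (((List.perm_cons_erase hc').cons b).cons a)⟩

namespace Struct

theorem NonErasing.length_concl {f : ℕ → ℕ} {σ : ℕ → List ℕ} {S S' : Struct}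
    (h : NonErasing f σ S S') : S'.concl.length = S.concl.length := by
  cases h <;> simp

/-- In a normal form without clashes, a cut is between a `!`-link and a `?`-link without
premises. -/
theorem cut_of_normal {S : Struct} (hn : ¬ ∃ f σ S', NonErasing f σ S S') (hc : ¬ S.HasClash)
    {a b : ℕ} (h : Link.cut a b ∈ S.links) : ∃ c w, (a = c ∧ b = w ∨ a = w ∧ b = c) ∧
      (∃ L m aux, Link.bang c L m aux ∈ S.links) ∧ Link.why [] w ∈ S.links := by
  have hax : ∀ a b, (Link.cut a b ∈ S.links ∨ Link.cut b a ∈ S.links) → ¬ S.IsAxConclusion a := by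
    rintro a b hcut ⟨x, hx⟩
    obtain ⟨t, ht, htS⟩ : ∃ t, (t = Link.cut a b ∨ t = .cut b a) ∧ t ∈ S.links := by
      rcases hcut with h | h
      · exact ⟨_, .inl rfl, h⟩
      · exact ⟨_, .inr rfl, h⟩
    obtain ⟨l, hl, hlS⟩ : ∃ l, (l = Link.ax x a ∨ l = .ax a x) ∧ l ∈ S.links := by
      rcases hx with h | h
      · exact ⟨_, .inr rfl, h⟩
      · exact ⟨_, .inl rfl, h⟩
    have hne : l ≠ t := by rcases ht with rfl | rfl <;> rcases hl with rfl | rfl <;> simp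
    obtain ⟨R, hR⟩ := exists_perm_cons_cons hlS htS hne
    exact hn ⟨_, _, _, .ax hl ht hR⟩
  have key : ∀ a b t, (t = Link.cut a b ∨ t = .cut b a) → t ∈ S.links → S.DualEdges a b →
      (∃ L m aux, Link.bang a L m aux ∈ S.links) ∧ Link.why [] b ∈ S.links := by
    rintro a b t ht htS (⟨x, y, x', y', h1, h2⟩ | ⟨h1, h2⟩ | ⟨L, m, aux, ps, h1, h2⟩)
    · obtain ⟨R, hR⟩ := exists_perm_cons_cons_cons h1 h2 htS (by simp)
        (by rcases ht with rfl | rfl <;> simp) (by rcases ht with rfl | rfl <;> simp)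
      exact (hn ⟨_, _, _, .mult ht hR⟩).elim
    · obtain ⟨R, hR⟩ := exists_perm_cons_cons_cons h1 h2 htS (by simp)
        (by rcases ht with rfl | rfl <;> simp) (by rcases ht with rfl | rfl <;> simp)
      exact (hn ⟨_, _, _, .unit ht hR⟩).elim
    · obtain ⟨R, hR⟩ := exists_perm_cons_cons_cons h1 h2 htS (by simp)
        (by rcases ht with rfl | rfl <;> simp) (by rcases ht with rfl | rfl <;> simp)
      rcases eq_or_ne ps [] with rfl | hps
      · exact ⟨⟨_, _, _, h1⟩, h2⟩
      · exact (hn ⟨_, _, _, .exp hps ht hR⟩).elim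
  by_cases hab : S.DualEdges a b
  · exact ⟨a, b, .inl ⟨rfl, rfl⟩, key a b _ (.inl rfl) h hab⟩
  by_cases hba : S.DualEdges b a
  · exact ⟨b, a, .inr ⟨rfl, rfl⟩, key b a _ (.inr rfl) h hba⟩
  exact (hc (.here S a b h hab hba (hax a b (.inl h)) (hax b a (.inr h)))).elim

/-- One valuation per box is supplied by induction on the depth, and the remaining values are
computed downwards. Only the cuts impose a further condition, and the free values of `?`-links
without premises are chosen to meet it. -/
theorem Good.sem_of_normal {S : Struct} (hS : S.Good) (hn : ¬ ∃ f σ S', NonErasing f σ S S')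
    (hc : ¬ S.HasClash) : ∃ (e : Valuation A) (n : ℕ), Links.Sem True S.links e n := by
  induction hS with
  | intro S hm hb ih =>
    have hbox : ∀ l : Link, ∃ k : Valuation A × ℕ, ∀ c L m aux, l = .bang c L m aux →
        l ∈ S.links → Links.Sem True L k.1 k.2 := by
      intro l
      cases l with
      | bang c L m aux =>
        by_cases hl : Link.bang c L m aux ∈ S.links
        · have hL : ¬ ∃ f σ S', NonErasing f σ ⟨L, [m], aux⟩ S' := by
            rintro ⟨f, σ, ⟨L', C', aux'⟩, hstep⟩
            obtain ⟨m', rfl⟩ : ∃ m', C' = [m'] := List.length_eq_one_iff.1 hstep.length_concl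
            classical
            exact hn ⟨_, _, _, .box (List.perm_cons_erase hl) hstep⟩
          obtain ⟨e, n, h⟩ := ih c L m aux hl hL fun h => hc (.box S c m L aux hl h)
          refine ⟨(e, n), ?_⟩
          rintro _ _ _ _ he -
          simp only [Link.bang.injEq] at he
          obtain ⟨-, rfl, -, -⟩ := he
          exact h
        · exact ⟨((fun _ => .star .pos, fun _ => 0), 0), fun _ _ _ _ _ h => absurd h hl⟩
      | _ => exact ⟨((fun _ => .star .pos, fun _ => 0), 0), by simp⟩
    choose κ hκ using hbox
    -- Each box has exactly one valuation, so the facing `?`-link gets the singleton of the dual of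
    -- its main value. The choice is consistent because the cut at `w` and the box above it are
    -- unique.
    have hω : ∀ w, ∃ μ : Multiset (D A), ∀ c L m aux,
        (Link.cut c w ∈ S.links ∨ Link.cut w c ∈ S.links) → Link.bang c L m aux ∈ S.links →
        μ = {((κ (.bang c L m aux)).1.1 m).dual} := by
      intro w
      by_cases hex : ∃ c L m aux, (Link.cut c w ∈ S.links ∨ Link.cut w c ∈ S.links) ∧
          Link.bang c L m aux ∈ S.links
      · obtain ⟨c, L, m, aux, h1, h2⟩ := hex
        refine ⟨{((κ (.bang c L m aux)).1.1 m).dual}, fun c' L' m' aux' h1' h2' => ?_⟩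
        have hcc : c = c' := by
          rcases h1 with h1 | h1 <;> rcases h1' with h1' | h1' <;>
          · have := eq_of_mem_premises hm.nodup_prem h1 h1' (x := .logical w)
              (by simp [Link.premises]) (by simp [Link.premises])
            simp only [Link.cut.injEq] at this
            grind
        subst hcc
        have := eq_of_mem_conclusions hm.nodup_conc h2 h2' (x := .logical c)
          (by simp [Link.conclusions]) (by simp [Link.conclusions])
        simp only [Link.bang.injEq] at this
        obtain ⟨-, rfl, rfl, rfl⟩ := this
        rfl
      · exact ⟨0, fun c L m aux h1 h2 => absurd ⟨c, L, m, aux, h1, h2⟩ hex⟩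
    choose ω hω using hω
    obtain ⟨e, he⟩ := exists_output hm (fun l => (κ l).1) ω
    refine ⟨e, Links.Sem.of_forall fun l hl => ?_⟩
    obtain ⟨he1, he2⟩ := he l hl
    cases l with
    | cut a b =>
      obtain ⟨c, w, hcw, ⟨L, m, aux, h1⟩, h2⟩ := cut_of_normal hn hc hl
      refine ⟨0, (Link.sem_cut (a := c) (b := w) ?_).2 ⟨?_, rfl⟩⟩
      · rcases hcw with ⟨rfl, rfl⟩ | ⟨rfl, rfl⟩ <;> simp
      · have h3 := (he _ h1).1 c (by simp [Link.conclusions])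
        have h4 := (he _ h2).1 w (by simp [Link.conclusions])
        have h5 := hω w c L m aux (by rcases hcw with ⟨rfl, rfl⟩ | ⟨rfl, rfl⟩ <;> simp [hl]) h1
        simp only [Link.output] at h3 h4
        rw [h3, h4, h5]
        simp [Sign.flip]
    | ax a b =>
      have hab : b ≠ a := by
        rintro rfl
        obtain ⟨T, hT⟩ : ∃ T, S.links.Perm (.ax b b :: T) := by
          classical exact ⟨_, List.perm_cons_erase hl⟩
        have := hm.nodup_conc
        rw [conc_perm hT, conc_cons] at this
        simpa [Link.conclusions] using (Multiset.nodup_add.1 this).1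
      have h1 := he1 a (by simp [Link.conclusions])
      have h2 := he1 b (by simp [Link.conclusions])
      refine ⟨1, ?_⟩
      simp only [Link.Sem, h1, h2]
      simp [Link.output, hab, Sign.flip]
    | why ps c =>
      have h1 := he1 c (by simp [Link.conclusions])
      refine ⟨1, ?_⟩
      simp only [Link.Sem, h1, and_true]
      cases ps with
      | nil => exact ⟨ω c, rfl, by simp, fun _ h => absurd rfl h⟩
      | cons p ps => exact ⟨_, rfl, le_rfl, fun _ _ => rfl⟩
    | bang c L m aux =>
      have h1 := he1 c (by simp [Link.conclusions])
      refine ⟨_, [κ (.bang c L m aux)], by simp, ?_, ?_, fun s hs => ?_, rfl⟩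
      · intro k hk
        rw [List.mem_singleton.1 hk]
        exact hκ _ c L m aux rfl hl
      · rw [h1]; rfl
      · rw [he2 s (by simp [Link.conclusions, hs])]
        simp [Link.output, Edge.name]
    | flat a s =>
      exact ⟨1, by simpa [Link.Sem, Link.output] using he2 s (by simp [Link.conclusions])⟩
    | tens a b c =>
      exact ⟨1, by simpa [Link.Sem, Link.output] using he1 c (by simp [Link.conclusions])⟩
    | par a b c =>
      exact ⟨1, by simpa [Link.Sem, Link.output] using he1 c (by simp [Link.conclusions])⟩
    | one c =>
      exact ⟨1, by simpa [Link.Sem, Link.output] using he1 c (by simp [Link.conclusions])⟩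
    | bot c =>
      exact ⟨1, by simpa [Link.Sem, Link.output] using he1 c (by simp [Link.conclusions])⟩

end Struct

/-! ### Strong normalization -/

variable {A : Type u}

theorem Links.Sem.weaken {T : List Link} {e : Valuation A} {n : ℕ} (h : Links.Sem True T e n) :
    Links.Sem False T e n := by
  induction T using links_induction generalizing e n with
  | h T ih =>
    have := h.map (φ := id) (strict' := False) (e' := e) fun l hl i hi => ?_
    · rwa [List.map_id] at this
    · cases l with
      | why ps c =>
        simp only [id, Link.Sem, false_imp_iff, and_true] at hi ⊢
        obtain ⟨⟨μ, h1, h2, -⟩, h3⟩ := hi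
        exact ⟨⟨μ, h1, h2⟩, h3⟩
      | bang c L m aux =>
        simp only [id, Link.Sem] at hi ⊢
        obtain ⟨es, h1, h2, h3⟩ := hi
        exact ⟨es, h1, fun k hk => ih c L m aux hl (h2 k hk), h3⟩
      | _ => simpa only [id, Link.Sem] using hi

namespace Struct

theorem Good.acc_of_sem {S : Struct} (hS : S.Good) {e : Valuation A} {n : ℕ}
    (h : Links.Sem False S.links e n) : Acc (fun S' S => Step S S') S := by
  induction n using Nat.strong_induction_on generalizing S e with
  | _ n ih =>
    refine ⟨_, fun S' hstep => ?_⟩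
    obtain ⟨f, σ, hstep⟩ := hstep
    obtain ⟨e', n', hlt, h', -⟩ := hstep.sem_decreasing hS e n h
    exact ih n' hlt (hstep.good hS) h'

theorem Good.sem_of_reflTransGen {S S' : Struct} (hS : S.Good) {e : Valuation A} {n : ℕ}
    (h : Links.Sem False S.links e n) (hr : Relation.ReflTransGen Step S S') :
    S'.Good ∧ ∃ (e' : Valuation A) (n' : ℕ), Links.Sem False S'.links e' n' := by
  induction hr with
  | refl => exact ⟨hS, e, n, h⟩
  | tail _ hstep ih =>
    obtain ⟨hg, e', n', h'⟩ := ih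
    obtain ⟨f, σ, hstep⟩ := hstep
    obtain ⟨e1, n1, -, h1, -⟩ := hstep.sem_decreasing hg e' n' h'
    exact ⟨hstep.good hg, e1, n1, h1⟩

/-- Only non-erasing steps are followed, since only these reflect valuations. Where none is left,
`Good.sem_of_normal` applies even though erasing steps may remain. -/
theorem Good.sem_of_acc {S : Struct} (hacc : Acc (fun S' S => Step S S') S) (hS : S.Good)
    (hc : ∀ S', Relation.ReflTransGen Step S S' → ¬ S'.HasClash) :
    ∃ (e : Valuation A) (n : ℕ), Links.Sem True S.links e n := by
  induction hacc with
  | intro S _ ih =>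
    by_cases hn : ∃ f σ S', NonErasing f σ S S'
    · obtain ⟨f, σ, S', hstep⟩ := hn
      have hs : Step S S' := ⟨f, σ, hstep.stepWith⟩
      obtain ⟨e', n', h'⟩ := ih S' hs (hstep.stepWith.good hS) fun S'' h => hc S'' (.head hs h)
      obtain ⟨e, n, h, -⟩ := hstep.sem_reflecting hS e' n' h'
      exact ⟨e, n, h⟩
    · exact hS.sem_of_normal hn (hc S .refl)

theorem IsNet.stronglyNormalizable_iff {S : Struct} (hS : S.IsNet) : S.StronglyNormalizable ↔
    ∃ (e : Valuation A) (n : ℕ), Links.Sem True S.links e n := by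
  have hg := good_of_isFlatNet hS.1
  constructor
  · rintro ⟨-, hinf, hc⟩
    refine Good.sem_of_acc ?_ hg hc
    by_contra hacc
    exact hinf (not_acc_iff_exists_descending_chain.1 hacc)
  · rintro ⟨e, n, h⟩
    refine ⟨hS, fun hF => ?_, fun S' hr hc => ?_⟩
    · exact not_acc_iff_exists_descending_chain.2 hF (hg.acc_of_sem h.weaken)
    · obtain ⟨hg', e', n', h'⟩ := hg.sem_of_reflTransGen h.weaken hr
      exact hc.not_sem hg' e' n' h'

end Struct

/-! ### Experiments and valuations -/

theorem Experiment.IsExperiment.sem {S : Struct} {E : Experiment A} (h : E.IsExperiment S) :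
    ∃ n, Links.Sem True S.links (E.val, E.str) n := by
  induction h with
  | intro S E sat nonempty boxes ih =>
    refine Links.Sem.of_forall fun l hl => ?_
    have hs := sat l hl
    cases l with
    | why ps c =>
      refine ⟨1, ?_⟩
      simp only [Link.Sem, and_true]
      cases ps with
      | nil =>
        obtain ⟨μ, hμ⟩ : ∃ μ : Multiset (D A), E.val c = D.bag .neg μ := hs
        exact ⟨μ, hμ, by simp, fun _ h => absurd rfl h⟩
      | cons p ps => exact ⟨_, hs, le_rfl, fun _ _ => rfl⟩
    | bang c L m aux =>
      have ih' := ih c L m aux hl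
      choose! ν hν using ih'
      refine ⟨_, (E.box c).map fun E' => ((E'.val, E'.str), ν E'), ?_, ?_, ?_, fun s h => ?_, rfl⟩
      · simpa using nonempty c L m aux hl
      · intro k hk
        obtain ⟨E', hE', rfl⟩ := List.mem_map.1 hk
        exact hν E' hE'
      · rw [List.map_map]
        exact hs.1
      · rw [List.map_map]
        exact hs.2 s h
    | ax a b => exact ⟨1, by rw [Link.Sem]; exact ⟨hs, rfl⟩⟩
    | cut a b => exact ⟨0, by rw [Link.Sem]; exact ⟨hs, rfl⟩⟩
    | tens a b c => exact ⟨1, by rw [Link.Sem]; exact ⟨hs, rfl⟩⟩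
    | par a b c => exact ⟨1, by rw [Link.Sem]; exact ⟨hs, rfl⟩⟩
    | one c => exact ⟨1, by rw [Link.Sem]; exact ⟨hs, rfl⟩⟩
    | bot c => exact ⟨1, by rw [Link.Sem]; exact ⟨hs, rfl⟩⟩
    | flat a s => exact ⟨1, by rw [Link.Sem]; exact ⟨hs, rfl⟩⟩

/-- An experiment stores the experiments of boxes by the name of the main conclusion. Since that
name determines its `!`-link, the valuations given separately for each link can be assembled. -/
theorem Struct.Good.exists_experiment {S : Struct} (hS : S.Good) (e : Valuation A) (n : ℕ)
    (h : Links.Sem True S.links e n) :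
    ∃ E : Experiment A, E.IsExperiment S ∧ E.val = e.1 ∧ E.str = e.2 := by
  induction hS generalizing e n with
  | intro S hm hb ih =>
    have hbox : ∀ c, ∃ B : List (Experiment A), ∀ L m aux, Link.bang c L m aux ∈ S.links →
        B ≠ [] ∧ (∀ E ∈ B, E.IsExperiment ⟨L, [m], aux⟩) ∧
        e.1 c = D.bag .pos (B.map fun E => E.val m : List (D A)) ∧
        ∀ s ∈ aux, e.2 s = (B.map fun E => E.str s).sum := by
      intro c
      by_cases hex : ∃ L m aux, Link.bang c L m aux ∈ S.links
      · obtain ⟨L, m, aux, hl⟩ := hex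
        obtain ⟨_, _, hl'⟩ := h.of_mem hl
        simp only [Link.Sem] at hl'
        obtain ⟨es, hne, hes, hc, haux, -⟩ := hl'
        have hk := fun k hk => ih c L m aux hl k.1 k.2 (hes k hk)
        have : Nonempty (Experiment A) := ⟨.mk e.1 e.2 fun _ => []⟩
        choose! φ hφ using hk
        have hφ1 : ∀ k ∈ es, (φ k).val = k.1.1 := fun k hk => (hφ k hk).2.1
        have hφ2 : ∀ k ∈ es, (φ k).str = k.1.2 := fun k hk => (hφ k hk).2.2
        refine ⟨es.map φ, fun L' m' aux' hl' => ?_⟩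
        have := eq_of_mem_conclusions hm.nodup_conc hl hl' (x := .logical c)
          (by simp [Link.conclusions]) (by simp [Link.conclusions])
        simp only [Link.bang.injEq] at this
        obtain ⟨-, rfl, rfl, rfl⟩ := this
        refine ⟨by simpa using hne, ?_, ?_, fun s hs => ?_⟩
        · intro E hE
          obtain ⟨k, hk, rfl⟩ := List.mem_map.1 hE
          exact (hφ k hk).1
        · rw [hc, List.map_map]
          congr 2
          exact List.map_congr_left fun k hk => by simp [hφ1 k hk]
        · rw [haux s hs, List.map_map]
          exact congrArg _ (List.map_congr_left fun k hk => by simp [hφ2 k hk])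
      · exact ⟨[], fun L m aux hl => absurd ⟨L, m, aux, hl⟩ hex⟩
    choose B hB using hbox
    refine ⟨.mk e.1 e.2 B, ⟨S, _, fun l hl => ?_, fun c L m aux hl => (hB c L m aux hl).1,
      fun c L m aux hl => (hB c L m aux hl).2.1⟩, rfl, rfl⟩
    obtain ⟨_, _, hi⟩ := h.of_mem hl
    cases l with
    | why ps c =>
      simp only [Link.Sem, true_imp_iff] at hi
      obtain ⟨⟨μ, hc, -, hμ⟩, -⟩ := hi
      cases ps with
      | nil => exact ⟨μ, hc⟩
      | cons p ps =>
        rw [← hμ (by simp)] at hc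
        exact hc
    | bang c L m aux => exact (hB c L m aux hl).2.2
    | _ =>
      simp only [Link.Sem] at hi
      exact hi.1

/-! ### Cuts between nets -/

theorem forest_append_of_disjoint {E : Type*} {Hs Hs' : List (Set E)} (h : Forest Hs)
    (h' : Forest Hs') (hd : ∀ H ∈ Hs, ∀ H' ∈ Hs', Disjoint H H') : Forest (Hs ++ Hs') := by
  refine forest_append.2 ⟨h, h', Submodule.disjoint_def.2 fun z hz hz' => ?_⟩
  have h1 := (cutSpace_le_zeroSum Hs hz).1
  have h2 := (cutSpace_le_zeroSum Hs' hz').1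
  rw [← Finsupp.support_eq_empty, Finset.eq_empty_iff_forall_notMem]
  intro x hx
  obtain ⟨H, hH, hxH⟩ := h1 hx
  obtain ⟨H', hH', hxH'⟩ := h2 hx
  exact Set.disjoint_left.1 (hd H hH H' hH') hxH hxH'

namespace Struct

theorem fst_name_of_mem {i : ℕ} {T : List Link} {l : Link} (hl : l ∈ T.map (Link.rename (tag i)))
    {x : Edge} (hx : x ∈ l.premises ∨ x ∈ l.conclusions) : x.name.unpair.1 = i := by
  obtain ⟨l, _, rfl⟩ := List.mem_map.1 hl
  rw [Link.premises_rename, Link.conclusions_rename, List.mem_map, List.mem_map] at hx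
  rcases hx with ⟨y, _, rfl⟩ | ⟨y, _, rfl⟩ <;> simp [tag]

/-- The two renamed nets share no edge, so their union is a forest in every switching, and the new
cut joins points of different nets. -/
theorem Good.cutNets {S S' : Struct} (hS : S.Good) (hS' : S'.Good) (i : Fin S.concl.length)
    (j : Fin S'.concl.length) : (Struct.cutNets S S' i j).Good := by
  have h1 := hS.rename (tag_injective 0)
  have h2 := hS'.rename (tag_injective 1)
  have hm1 := h1.isModule
  have hm2 := h2.isModule
  have hne : ∀ x y : Edge, x.name.unpair.1 = 0 → y.name.unpair.1 = 1 → x ≠ y := by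
    rintro x y hx hy rfl
    omega
  have hd : Disjoint (conc (S.links.map (Link.rename (tag 0))))
      (conc (S'.links.map (Link.rename (tag 1)))) := by
    refine Multiset.disjoint_left.2 fun {x} hx hx' => ?_
    obtain ⟨l, hl, hx⟩ := mem_conc.1 hx
    obtain ⟨l', hl', hx'⟩ := mem_conc.1 hx'
    exact hne x x (fst_name_of_mem hl (.inr hx)) (fst_name_of_mem hl' (.inr hx')) rfl
  refine ⟨_, ⟨?_, ?_, ?_, ?_⟩, ?_⟩
  · simp only [Struct.cutNets, conc_cons, conc_append, add_zero,
      coe_conclusions_cut (.inl rfl), zero_add]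
    exact Multiset.nodup_add.2 ⟨hm1.nodup_conc, hm2.nodup_conc, hd⟩
  · have hb1 := hm1.bal
    have hb2 := hm2.bal
    simp only [add_zero] at hb1 hb2
    have ho : ∀ (S : Struct) (i : Fin S.concl.length) (k : ℕ),
        Struct.outputs ⟨S.links.map (Link.rename (tag k)), S.concl.map (tag k), S.aux.map (tag k)⟩ =
          {Edge.logical (tag k S.concl[i])} + (((S.concl.eraseIdx i).map (tag k)).map Edge.logical :
            List Edge) + ((S.aux.map (tag k)).map Edge.structural : List Edge) := by
      intro S i k
      rw [outputs, ← Multiset.coe_add]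
      congr 1
      have : S.concl.Perm (S.concl[i] :: S.concl.eraseIdx i) :=
        (List.getElem_cons_eraseIdx_perm i.2).symm
      rw [Multiset.coe_eq_coe.2 ((this.map _).map _)]
      rfl
    rw [ho S i 0] at hb1
    rw [ho S' j 1] at hb2
    simp only [Struct.cutNets, conc_cons, prem_cons, conc_append, prem_append, add_zero, outputs,
      List.map_append, ← Multiset.coe_add, coe_conclusions_cut (.inl rfl),
      coe_premises_cut (.inl rfl), zero_add]
    rw [hb1, hb2]
    abel
  · intro l hl
    rcases List.mem_cons.1 hl with rfl | hl
    · simp [Link.conclusions]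
    · rcases List.mem_append.1 hl with hl | hl
      · exact hm1.loopless l hl
      · exact hm2.loopless l hl
  · intro k hk
    have hk1 : ∀ l ∈ S.links.map (Link.rename (tag 0)), ∀ x ∈ k l, x.name.unpair.1 = 0 :=
      fun l hl x hx => fst_name_of_mem hl ((hk l (by simp [Struct.cutNets, hl])).1 x hx)
    have hk2 : ∀ l ∈ S'.links.map (Link.rename (tag 1)), ∀ x ∈ k l, x.name.unpair.1 = 1 :=
      fun l hl x hx => fst_name_of_mem hl ((hk l (by simp [Struct.cutNets, hl])).1 x hx)
    have hf1 := hm1.correct k fun l hl => hk l (by simp [Struct.cutNets, hl])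
    have hf2 := hm2.correct k fun l hl => hk l (by simp [Struct.cutNets, hl])
    rw [List.append_nil] at hf1 hf2 ⊢
    simp only [Struct.cutNets, List.map_cons, List.map_append (l₁ := List.map (Link.rename _) _)]
    have hcut := (hk (.cut (tag 0 S.concl[i]) (tag 1 S'.concl[j]))
      (by simp [Struct.cutNets])).cut
    refine forest_cons.2 ⟨forest_append_of_disjoint hf1 hf2 ?_, fun x hx y hy hxy hc => hxy ?_⟩
    · intro H hH H' hH'
      obtain ⟨l, hl, rfl⟩ := List.mem_map.1 hH
      obtain ⟨l', hl', rfl⟩ := List.mem_map.1 hH'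
      exact Set.disjoint_left.2 fun x hx hx' => hne x x (hk1 l hl x hx) (hk2 l' hl' x hx') rfl
    -- Connected edges carry the same tag, as every hyperedge lies within one of the two nets.
    · have hxy' : x.name.unpair.1 = y.name.unpair.1 := by
        refine hc.induction (r := fun x y => x.name.unpair.1 = y.name.unpair.1)
          ⟨fun _ => rfl, fun h => h.symm, fun h h' => h.trans h'⟩ ?_
        intro H hH a ha b hb
        rcases List.mem_append.1 hH with hH | hH
        · obtain ⟨l, hl, rfl⟩ := List.mem_map.1 hH
          rw [hk1 l hl a ha, hk1 l hl b hb]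
        · obtain ⟨l, hl, rfl⟩ := List.mem_map.1 hH
          rw [hk2 l hl a ha, hk2 l hl b hb]
      rcases hcut hx with rfl | rfl <;> rcases hcut hy with rfl | rfl
      · rfl
      · simp [Edge.name, tag] at hxy'
      · simp [Edge.name, tag] at hxy'
      · rfl
  · intro c L m aux hl
    rcases List.mem_cons.1 hl with he | hl
    · cases he
    · rcases List.mem_append.1 hl with hl | hl
      · exact h1.boxes hl
      · exact h2.boxes hl

theorem IsNet.cutNets {S S' : Struct} (hS : S.IsNet) (hS' : S'.IsNet) (i : Fin S.concl.length)
    (j : Fin S'.concl.length) : (Struct.cutNets S S' i j).IsNet :=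
  ⟨((good_of_isFlatNet hS.1).cutNets (good_of_isFlatNet hS'.1) i j).isFlatNet,
    by simp [Struct.cutNets, hS.2, hS'.2]⟩

/-- Disjointness of the tags lets two valuations be glued without any condition; the cut contributes
the one equation. -/
theorem sem_cutNets_iff {A : Type u} {S S' : Struct} {i : Fin S.concl.length}
    {j : Fin S'.concl.length} :
    (∃ (e : Valuation A) (n : ℕ), Links.Sem True (Struct.cutNets S S' i j).links e n) ↔
      ∃ (e : Valuation A) (n : ℕ) (e' : Valuation A) (n' : ℕ), Links.Sem True S.links e n ∧
        Links.Sem True S'.links e' n' ∧ e.1 S.concl[i] = (e'.1 S'.concl[j]).dual := by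
  simp only [Struct.cutNets, Links.Sem.cons_iff, Links.Sem.append_iff, Link.Sem,
    Links.sem_rename (tag_injective _)]
  constructor
  · rintro ⟨e, _, _, _, -, ⟨hc, -⟩, n, n', -, h, h'⟩
    exact ⟨_, n, _, n', h, h', hc⟩
  · rintro ⟨e, n, e', n', h, h', hc⟩
    let e0 : Valuation A := (fun x => if x.unpair.1 = 0 then e.1 x.unpair.2 else e'.1 x.unpair.2,
      fun x => if x.unpair.1 = 0 then e.2 x.unpair.2 else e'.2 x.unpair.2)
    have h0 : e0.comap (tag 0) = e := by ext x <;> simp [e0, Valuation.comap, tag]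
    have h1 : e0.comap (tag 1) = e' := by ext x <;> simp [e0, Valuation.comap, tag]
    refine ⟨e0, 0 + (n + n'), 0, n + n', rfl, ⟨?_, rfl⟩, n, n', rfl, by rwa [h0], by rwa [h1]⟩
    simpa [e0, tag] using hc

end Struct

end LLNet

-- Strong normalization of a cut between two nets

theorem mainTheorem3 {A : Type*} (π π' : LLNet.Struct) (hπ : π.IsNet) (hπ' : π'.IsNet)
    (c : Fin π.concl.length) (c' : Fin π'.concl.length) :
    (LLNet.Struct.cutNets π π' c c').StronglyNormalizable ↔
      ∃ x W x' W', (x, W) ∈ LLNet.Struct.interpEx A π ∧ (x', W') ∈ LLNet.Struct.interpEx A π' ∧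
        x c = (x' c').dual := by
  rw [(hπ.cutNets hπ' c c').stronglyNormalizable_iff (A := A), LLNet.Struct.sem_cutNets_iff]
  constructor
  · rintro ⟨e, n, e', n', h, h', hc⟩
    obtain ⟨E, hE, hv, -⟩ := (LLNet.Struct.good_of_isFlatNet hπ.1).exists_experiment e n h
    obtain ⟨E', hE', hv', -⟩ := (LLNet.Struct.good_of_isFlatNet hπ'.1).exists_experiment e' n' h'
    refine ⟨_, _, _, _, ⟨E, hE, rfl⟩, ⟨E', hE', rfl⟩, ?_⟩
    simpa only [hv, hv'] using hc
  · rintro ⟨_, _, _, _, ⟨E, hE, he⟩, ⟨E', hE', he'⟩, hc⟩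
    obtain ⟨rfl, -⟩ := Prod.mk.inj he
    obtain ⟨rfl, -⟩ := Prod.mk.inj he'
    obtain ⟨n, h⟩ := hE.sem
    obtain ⟨n', h'⟩ := hE'.sem
    exact ⟨_, n, _, n', h, h', hc⟩
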